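/- Let $n,d$ be natural numbers with $d$ even and $\gcd(n,d)=1$. Let $\theta(A)=({}^tA)^{-1}$ be the Cartan involution of $\mathrm{GL}_n$, and let $$X_{n,d}=\{(D_1,D_2)\in \mathrm{GL}_n\times\mathrm{GL}_n \;:\; D_1\theta(D_1)D_2\theta(D_2)\,e^{\pi i d/n}=I_n\}$$ over $\mathbb{C}$, on which $\mathrm{GL}_n$ acts by $g\cdot D_k=g\,D_k\,{}^tg$. (This is the variety of representations attached to a compact Riemann surface of genus $r-1=1$ with a fixed-point-free antiholomorphic involution, for instance the elliptic curve $\mathbb{C}/\langle 1,i\rangle$ with $\sigma(z)=\bar z+\tfrac12$, with one puncture on the quotient and the central orbit $\{e^{\pi i d/n}I_n\}$.) Let $\mathcal{M}^{\epsilon}_{n,d}=[X_{n,d}/\mathrm{GL}_n]$ be the character stack (the quotient stack) and $M^{\epsilon}_{n,d}=X_{n,d}/\!/\mathrm{GL}_n=\operatorname{Spec}\mathcal{O}(X_{n,d})^{\mathrm{GL}_n}$ the character variety (the GIT quotient). Then the affine scheme $X_{n,d}$ defined by the displayed equations is reduced, the character variety $M^{\epsilon}_{n,d}$ is isomorphic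 to $\mathbb{C}^*$ as an affine variety over $\mathbb{C}$, and the character stack $\mathcal{M}^{\epsilon}_{n,d}$ is a $\mu_2$-gerbe over $\mathbb{C}^*$ for the étale topology; more precisely, there is an isomorphism $M^{\epsilon}_{n,d}\cong\mathbb{C}^*$ for which the composite of the canonical morphism $\mathcal{M}^{\epsilon}_{n,d}\to M^{\epsilon}_{n,d}$ with it is a gerbe banded by $\mu_2$. -/

import Mathlib

open CategoryTheory AlgebraicGeometry Opposite

noncomputable section

namespace CharacterStack

/-! ### Stacks in groupoids and banded gerbes over a site -/

section Gerbes

universe v u v' u'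

variable {C : Type u} [Category.{v} C] {𝒳 : Type u'} [Category.{v'} 𝒳]

/-- The functor `p : 𝒳 ⥤ C` is a stack in groupoids over the site `(C, J)`:
it is a category fibered in groupoids, morphisms glue along covering sieves, and every descent
datum is effective. A descent datum on a covering sieve `R` of `S` is given (as in Giraud) by a
functor from the category of arrows of `R` to `𝒳` lying over the domain functor. -/
structure IsStackInGroupoids (J : GrothendieckTopology C) (p : 𝒳 ⥤ C) : Prop where
  fibered : p.IsFibered
  groupoids : ∀ {x y : 𝒳} (φ : x ⟶ y), p.IsStronglyCartesian (p.map φ) φ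
  glue_hom : ∀ (x y : 𝒳) (u : p.obj x ⟶ p.obj y) (R : Sieve (p.obj x)), R ∈ J (p.obj x) →
    ∀ ψ : (∀ {x' : 𝒳} (φ : x' ⟶ x), R (p.map φ) → (x' ⟶ y)),
      (∀ {x' : 𝒳} (φ : x' ⟶ x) (h : R (p.map φ)), p.map (ψ φ h) = p.map φ ≫ u) →
      (∀ {x'' x' : 𝒳} (χ : x'' ⟶ x') (φ : x' ⟶ x) (h : R (p.map φ)) (h' : R (p.map (χ ≫ φ))),
        ψ (χ ≫ φ) h' = χ ≫ ψ φ h) →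
      ∃! Ψ : x ⟶ y, p.map Ψ = u ∧
        ∀ {x' : 𝒳} (φ : x' ⟶ x) (h : R (p.map φ)), φ ≫ Ψ = ψ φ h
  effective : ∀ (S : C) (R : Sieve S), R ∈ J S →
    ∀ (F : R.arrows.category ⥤ 𝒳) (α : F ⋙ p ≅ R.arrows.diagram),
      ∃ (x : 𝒳) (e : p.obj x ≅ S) (c : ∀ f : R.arrows.category, F.obj f ⟶ x),
        (∀ {f f' : R.arrows.category} (h : f ⟶ f'), F.map h ≫ c f' = c f) ∧
        ∀ f : R.arrows.category, p.map (c f) ≫ e.hom = α.hom.app f ≫ f.obj.hom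

/-- Let `p : 𝒳 ⥤ C` be a category over the site `(C, J)`, let `Y` be an object of `C` and `A` a
presheaf of commutative groups. The family `q` of morphisms `q x : p x ⟶ Y` is a morphism from `𝒳`
to `Y` which is a gerbe banded by `A`:
* `𝒳` is a stack in groupoids and `q` is compatible with all morphisms of `𝒳`;
* locally, every point of `Y` lifts to `𝒳`;
* two objects of `𝒳` with the same image in `Y` are locally isomorphic;
* for each object `x` of `𝒳` there is an isomorphism of `A (p x)` with the group of automorphisms
  of `x` over the identity of `p x`, compatible with all morphisms of `𝒳` (in particular with
  restriction, so that it is an isomorphism of sheaves `A|_{p x} ≅ Aut(x)`). -/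
structure IsGerbe (J : GrothendieckTopology C) (p : 𝒳 ⥤ C) (A : Cᵒᵖ ⥤ CommGrpCat)
    (Y : C) (q : ∀ x : 𝒳, p.obj x ⟶ Y) : Prop where
  stack : IsStackInGroupoids J p
  natural : ∀ {x y : 𝒳} (φ : x ⟶ y), p.map φ ≫ q y = q x
  locally_nonempty : ∀ (S : C) (s : S ⟶ Y), ∃ R ∈ J S, ∀ (U : C) (f : U ⟶ S), R f →
    ∃ (x : 𝒳) (e : U ≅ p.obj x), e.hom ≫ q x = f ≫ s
  locally_connected : ∀ (x y : 𝒳) (e : p.obj x ≅ p.obj y), e.hom ≫ q y = q x →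
    ∃ R ∈ J (p.obj x), ∀ (x' : 𝒳) (φ : x' ⟶ x), R (p.map φ) →
      ∃ ψ : x' ⟶ y, p.map ψ = p.map φ ≫ e.hom
  band : ∃ ι : ∀ x : 𝒳, A.obj (op (p.obj x)) →* Aut x,
    (∀ x, Function.Injective (ι x)) ∧
    (∀ (x : 𝒳) (a : Aut x), a ∈ Set.range (ι x) ↔ p.map a.hom = 𝟙 (p.obj x)) ∧
    ∀ {x y : 𝒳} (φ : x ⟶ y) (a : A.obj (op (p.obj y))),
      (ι x (A.map (p.map φ).op a)).hom ≫ φ = φ ≫ (ι y a).hom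

end Gerbes

/-! ### Quotient stacks -/

section QuotientStacks

universe w w₁ w₂ v u

variable {C : Type u} [Category.{v} C]

/-- A presheaf of sets with an action of the presheaf of groups `G`. -/
structure GSpace (G : Cᵒᵖ ⥤ GrpCat.{w}) where
  /-- the underlying presheaf -/
  space : Cᵒᵖ ⥤ Type w₁
  /-- the action on sections -/
  action : ∀ T : Cᵒᵖ, MulAction (G.obj T) (space.obj T)
  map_smul : ∀ {T T' : Cᵒᵖ} (f : T ⟶ T') (g : G.obj T) (x : space.obj T),
    space.map f (g • x) = G.map f g • space.map f x

attribute [instance] GSpace.action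

/-- Equivariant morphisms of presheaves with an action of `G`. -/
@[ext]
structure GSpace.Hom {G : Cᵒᵖ ⥤ GrpCat.{w}} (P : GSpace.{w, w₁} G) (X : GSpace.{w, w₂} G) where
  /-- the map on sections -/
  app : ∀ T : Cᵒᵖ, P.space.obj T → X.space.obj T
  naturality : ∀ {T T' : Cᵒᵖ} (f : T ⟶ T') (x : P.space.obj T),
    app T' (P.space.map f x) = X.space.map f (app T x)
  equivariant : ∀ (T : Cᵒᵖ) (g : G.obj T) (x : P.space.obj T), app T (g • x) = g • app T x

/-- A `G`-torsor over the object `S` of the site `(C, J)`: a sheaf `P` with an action of `G` and an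
invariant morphism `π : P ⟶ S`, such that `G` acts simply transitively on the sections of `P`
lying over a given `T ⟶ S`, and such that `P` has sections locally on `S`. -/
structure Torsor (J : GrothendieckTopology C) (G : Cᵒᵖ ⥤ GrpCat.{w}) (S : C) where
  /-- the total space -/
  P : GSpace.{w, w₁} G
  isSheaf : Presieve.IsSheaf J P.space
  /-- the structure morphism to `S` -/
  π : ∀ T : Cᵒᵖ, P.space.obj T → (T.unop ⟶ S)
  π_naturality : ∀ {T T' : Cᵒᵖ} (f : T ⟶ T') (x : P.space.obj T),
    π T' (P.space.map f x) = f.unop ≫ π T x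
  π_smul : ∀ (T : Cᵒᵖ) (g : G.obj T) (x : P.space.obj T), π T (g • x) = π T x
  simply_transitive : ∀ (T : Cᵒᵖ) (x y : P.space.obj T), π T x = π T y → ∃! g : G.obj T, g • x = y
  locally_trivial : ∃ R ∈ J S, ∀ (U : C) (f : U ⟶ S), R f → ∃ x : P.space.obj (op U), π _ x = f

/-- The objects of the quotient stack `[X / G]`: a `G`-torsor `P ⟶ S` over some object `S` of the
site, together with a `G`-equivariant morphism `P ⟶ X`. The sets of sections of `P` are allowed to
live in a universe `w₁` of their own; as they are empty or in bijection with `G(T)`, this choice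
does not matter. -/
structure QuotientStack (J : GrothendieckTopology C) {G : Cᵒᵖ ⥤ GrpCat.{w}}
    (X : GSpace.{w, w₂} G) where
  /-- the base -/
  base : C
  /-- the torsor -/
  torsor : Torsor.{w, w₁} J G base
  /-- the equivariant morphism to `X` -/
  toX : torsor.P.Hom X

namespace QuotientStack

variable {J : GrothendieckTopology C} {G : Cᵒᵖ ⥤ GrpCat.{w}} {X : GSpace.{w, w₂} G}

/-- A morphism in `[X / G]`: a morphism of the bases covered by a `G`-equivariant morphism of the
torsors which commutes with the morphisms to `X`. -/
@[ext]
structure Hom (ξ η : QuotientStack.{w, w₁} J X) where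
  /-- the morphism of the bases -/
  base : ξ.base ⟶ η.base
  /-- the morphism of the torsors -/
  map : ξ.torsor.P.Hom η.torsor.P
  comm_π : ∀ (T : Cᵒᵖ) (x : ξ.torsor.P.space.obj T),
    η.torsor.π T (map.app T x) = ξ.torsor.π T x ≫ base
  comm_toX : ∀ (T : Cᵒᵖ) (x : ξ.torsor.P.space.obj T),
    η.toX.app T (map.app T x) = ξ.toX.app T x

instance : Category (QuotientStack.{w, w₁} J X) where
  Hom := Hom
  id ξ :=
    { base := 𝟙 ξ.base
      map := ⟨fun _ x => x, fun _ _ => rfl, fun _ _ _ => rfl⟩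
      comm_π := fun _ _ => (Category.comp_id _).symm
      comm_toX := fun _ _ => rfl }
  comp f g :=
    { base := f.base ≫ g.base
      map := ⟨fun T x => g.map.app T (f.map.app T x),
        fun h x => by rw [f.map.naturality, g.map.naturality],
        fun T h x => by rw [f.map.equivariant, g.map.equivariant]⟩
      comm_π := fun T x => by rw [g.comm_π, f.comm_π, Category.assoc]
      comm_toX := fun T x => by rw [g.comm_toX, f.comm_toX] }
  id_comp f := Hom.ext (Category.id_comp _) rfl
  comp_id f := Hom.ext (Category.comp_id _) rfl
  assoc f g h := Hom.ext (Category.assoc _ _ _) rfl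

variable (J X) in
/-- The structure functor of `[X / G]`, sending a torsor `P ⟶ S` to `S`. -/
def proj : QuotientStack.{w, w₁} J X ⥤ C where
  obj ξ := ξ.base
  map f := f.base

end QuotientStack

end QuotientStacks

/-! ### Schemes over the complex numbers -/

/-- The category of schemes over `ℂ`. -/
abbrev SchC : Type 1 := Over (Spec (CommRingCat.of ℂ))

/-- The big étale topology on schemes over `ℂ`. -/
abbrev etale : GrothendieckTopology SchC := Scheme.etaleTopology.over (Spec (CommRingCat.of ℂ))

/-- The ring of global functions of a scheme over `ℂ`. -/
abbrev 𝒪 (T : SchC) : Type := Γ(T.left, ⊤)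

/-- The ring homomorphism `ℂ → Γ(T, 𝒪_T)` given by the structure morphism of `T`. -/
def scalars (T : SchC) : ℂ →+* 𝒪 T :=
  ((Scheme.ΓSpecIso (CommRingCat.of ℂ)).inv ≫ T.hom.appTop).hom

instance (T : SchC) : Algebra ℂ (𝒪 T) := (scalars T).toAlgebra

/-- Pullback of functions along a morphism of schemes over `ℂ`. -/
def pullbackFun {T T' : SchC} (f : T' ⟶ T) : 𝒪 T →ₐ[ℂ] 𝒪 T' where
  __ := f.left.appTop.hom
  commutes' c := by
    change f.left.appTop.hom (scalars T c) = scalars T' c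
    have h : T.hom.appTop ≫ f.left.appTop = T'.hom.appTop := by
      rw [← Scheme.Hom.comp_appTop, Over.w]
    simp only [scalars, ← h]
    rfl

lemma pullbackFun_id (T : SchC) : pullbackFun (𝟙 T) = AlgHom.id ℂ (𝒪 T) := by
  ext x
  change (𝟙 T : T ⟶ T).left.appTop.hom x = x
  simp

lemma pullbackFun_comp {T T' T'' : SchC} (f : T' ⟶ T) (g : T'' ⟶ T') :
    pullbackFun (g ≫ f) = (pullbackFun g).comp (pullbackFun f) := by
  ext x
  change (g ≫ f).left.appTop.hom x = g.left.appTop.hom (f.left.appTop.hom x)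
  rw [Over.comp_left, Scheme.Hom.comp_appTop]
  rfl

/-- The affine scheme `Spec B` over `ℂ`, for a commutative `ℂ`-algebra `B`. -/
def specC (B : Type) [CommRing B] [Algebra ℂ B] : SchC :=
  Over.mk (Spec.map (CommRingCat.ofHom (algebraMap ℂ B)))

/-- The morphism `T ⟶ Spec B` of schemes over `ℂ` given by an algebra homomorphism
`B → Γ(T, 𝒪_T)`. -/
def toSpecC {B : Type} [CommRing B] [Algebra ℂ B] {T : SchC} (f : B →ₐ[ℂ] 𝒪 T) : T ⟶ specC B :=
  Over.homMk (T.left.toSpecΓ ≫ Spec.map (CommRingCat.ofHom f.toRingHom)) <| by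
    have h : CommRingCat.ofHom (algebraMap ℂ B) ≫ CommRingCat.ofHom f.toRingHom =
        (Scheme.ΓSpecIso (CommRingCat.of ℂ)).inv ≫ T.hom.appTop := by
      ext c
      exact f.commutes c
    change (T.left.toSpecΓ ≫ Spec.map (CommRingCat.ofHom f.toRingHom)) ≫
      Spec.map (CommRingCat.ofHom (algebraMap ℂ B)) = T.hom
    rw [Category.assoc, ← Spec.map_comp, h, Spec.map_comp, ← Scheme.toSpecΓ_naturality_assoc]
    have h2 : (Spec (CommRingCat.of ℂ)).toSpecΓ ≫
        Spec.map (Scheme.ΓSpecIso (CommRingCat.of ℂ)).inv = 𝟙 _ := by simp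
    exact (congrArg (T.hom ≫ ·) h2).trans (Category.comp_id _)

/-- The affine variety `ℂ*` over `ℂ`, with coordinate ring `ℂ[T, T⁻¹]`. -/
def Gm : SchC := specC (LaurentPolynomial ℂ)

/-- The group scheme `μ₂` over `ℂ`: its sections over `T` are the `a` in `Γ(T, 𝒪_T)` with
`a ^ 2 = 1`. -/
def mu2 : SchCᵒᵖ ⥤ CommGrpCat.{0} where
  obj T := CommGrpCat.of (rootsOfUnity 2 (𝒪 T.unop))
  map f := CommGrpCat.ofHom (restrictRootsOfUnity (pullbackFun f.unop) 2)
  map_id T := by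
    ext a
    change pullbackFun (𝟙 T.unop) _ = _
    rw [pullbackFun_id]
    rfl
  map_comp f g := by
    ext a
    change pullbackFun (g.unop ≫ f.unop) _ = _
    rw [pullbackFun_comp]
    rfl

/-- The group scheme `GL_n` over `ℂ`. -/
def GLn (n : ℕ) : SchCᵒᵖ ⥤ GrpCat.{0} where
  obj T := GrpCat.of (GL (Fin n) (𝒪 T.unop))
  map f := GrpCat.ofHom (Matrix.GeneralLinearGroup.map (pullbackFun f.unop).toRingHom)
  map_id T := by
    ext a i j
    change pullbackFun (𝟙 T.unop) _ = _
    rw [pullbackFun_id]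
    rfl
  map_comp f g := by
    ext a i j
    change pullbackFun (g.unop ≫ f.unop) _ = _
    rw [pullbackFun_comp]
    rfl

/-! ### The representation variety -/

section Representations

/-- The transpose of an invertible matrix. -/
def transp {n : ℕ} {R : Type} [CommRing R] (A : GL (Fin n) R) : GL (Fin n) R where
  val := A.val.transpose
  inv := A.inv.transpose
  val_inv := by rw [← Matrix.transpose_mul, A.inv_val, Matrix.transpose_one]
  inv_val := by rw [← Matrix.transpose_mul, A.val_inv, Matrix.transpose_one]

lemma transp_mul {n : ℕ} {R : Type} [CommRing R] (A B : GL (Fin n) R) :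
    transp (A * B) = transp B * transp A :=
  Units.ext (Matrix.transpose_mul _ _)

lemma transp_transp {n : ℕ} {R : Type} [CommRing R] (A : GL (Fin n) R) :
    transp (transp A) = A :=
  Units.ext (Matrix.transpose_transpose _)

lemma transp_one {n : ℕ} {R : Type} [CommRing R] : transp (1 : GL (Fin n) R) = 1 :=
  Units.ext Matrix.transpose_one

lemma transp_map {n : ℕ} {R R' : Type} [CommRing R] [CommRing R'] (f : R →+* R')
    (A : GL (Fin n) R) : transp (A.map f) = (transp A).map f :=
  Units.ext rfl

/-- The Cartan involution `θ(A) = (ᵗA)⁻¹` of `GL_n`. -/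
def cartan {n : ℕ} {R : Type} [CommRing R] (A : GL (Fin n) R) : GL (Fin n) R := (transp A)⁻¹

/-- The complex number `e^{π i d / n}`. -/
def zeta (n d : ℕ) : ℂ := Complex.exp (Real.pi * Complex.I * d / n)

/-- The `R`-points of the variety of tuples `D_1, …, D_r` in `GL_n` such that
`D_1 θ(D_1) ⋯ D_r θ(D_r) Z = 1`, where `Z` is the central matrix `e^{π i d / n} I_n`. -/
@[ext]
structure RepPoint (r n d : ℕ) (R : Type) [CommRing R] [Algebra ℂ R] where
  /-- the matrices `D_1, …, D_r` -/
  D : Fin r → GL (Fin n) R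
  relation : ((List.ofFn fun k => D k * cartan (D k)).prod : GL (Fin n) R).val *
    algebraMap ℂ (Matrix (Fin n) (Fin n) R) (zeta n d) = 1

lemma conj_relation {n : ℕ} {R : Type} [CommRing R] (g D : GL (Fin n) R) :
    (g * D * transp g) * cartan (g * D * transp g) = MulAut.conj g (D * cartan D) := by
  simp only [cartan, transp_mul, transp_transp, MulAut.conj_apply]
  group

variable {r n d : ℕ} {R R' : Type} [CommRing R] [Algebra ℂ R] [CommRing R'] [Algebra ℂ R']

/-- The action of `GL_n` on tuples: `g • D_k = g D_k ᵗg`. -/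
instance : MulAction (GL (Fin n) R) (RepPoint r n d R) where
  smul g x :=
    { D := fun k => g * x.D k * transp g
      relation := by
        have h : (List.ofFn fun k => g * x.D k * transp g * cartan (g * x.D k * transp g)).prod =
            g * (List.ofFn fun k => x.D k * cartan (x.D k)).prod * g⁻¹ := by
          rw [← MulAut.conj_apply, map_list_prod, List.map_ofFn]
          simp only [conj_relation]
          rfl
        rw [h, Units.val_mul, Units.val_mul, mul_assoc, ← Algebra.commutes, ← mul_assoc,
          mul_assoc g.val, x.relation, mul_one, Units.mul_inv] }
  one_smul x := by
    refine RepPoint.ext (funext fun k => ?_)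
    change 1 * x.D k * transp 1 = x.D k
    rw [transp_one, one_mul, mul_one]
  mul_smul g h x := by
    refine RepPoint.ext (funext fun k => ?_)
    change g * h * x.D k * transp (g * h) = g * (h * x.D k * transp h) * transp g
    simp only [transp_mul, mul_assoc]

/-- The image of a tuple under an algebra homomorphism. -/
def RepPoint.map (f : R →ₐ[ℂ] R') (x : RepPoint r n d R) : RepPoint r n d R' where
  D k := (x.D k).map f.toRingHom
  relation := by
    have h : (List.ofFn fun k => (x.D k).map f.toRingHom * cartan ((x.D k).map f.toRingHom)).prod =
        (List.ofFn fun k => x.D k * cartan (x.D k)).prod.map f.toRingHom := by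
      rw [map_list_prod, List.map_ofFn]
      congr 2
      funext k
      simp only [cartan, transp_map, Function.comp_apply, map_mul, map_inv]
    have h' := congrArg f.mapMatrix x.relation
    rw [map_mul, map_one, AlgHom.commutes] at h'
    rw [h]
    exact h'

lemma RepPoint.map_smul (f : R →ₐ[ℂ] R') (g : GL (Fin n) R) (x : RepPoint r n d R) :
    (g • x).map f = g.map f.toRingHom • x.map f := by
  refine RepPoint.ext (funext fun k => ?_)
  change (g * x.D k * transp g).map f.toRingHom =
    g.map f.toRingHom * (x.D k).map f.toRingHom * transp (g.map f.toRingHom)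
  rw [transp_map, map_mul, map_mul]

/-- The presheaf `T ↦ {(D_1, …, D_r) | D_1 θ(D_1) ⋯ D_r θ(D_r) Z = 1}` on schemes over `ℂ`,
with the action of `GL_n`. -/
def repSpace (r n d : ℕ) : GSpace.{0, 0} (GLn n) where
  space :=
    { obj := fun T => RepPoint r n d (𝒪 T.unop)
      map := fun f => TypeCat.ofHom (RepPoint.map (pullbackFun f.unop))
      map_id := fun T => by
        ext x k i j
        change pullbackFun (𝟙 T.unop) _ = _
        rw [pullbackFun_id]
        rfl
      map_comp := fun f g => by
        ext x k i j
        change pullbackFun (g.unop ≫ f.unop) _ = _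
        rw [pullbackFun_comp]
        rfl }
  action T := (inferInstance : MulAction (GL (Fin n) (𝒪 T.unop)) (RepPoint r n d (𝒪 T.unop)))
  map_smul f g x := RepPoint.map_smul (pullbackFun f.unop) g x

/-- The character stack `[{(D_1, …, D_r) | D_1 θ(D_1) ⋯ D_r θ(D_r) Z = 1} / GL_n]`, where
`Z = e^{π i d / n} I_n` and `GL_n` acts by `g • D_k = g D_k ᵗg`. -/
abbrev CharStack (r n d : ℕ) := QuotientStack.{0, 1} etale (repSpace r n d)

/-! ### The GIT quotient -/

/-- The coordinates: the entries of `D_1, …, D_r` (`Sum.inl`) and of their inverses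
(`Sum.inr`). -/
abbrev Coord (r n : ℕ) : Type := (Fin r × Fin n × Fin n) ⊕ (Fin r × Fin n × Fin n)

/-- The generic matrix `D_k`. -/
def genD (r n : ℕ) (k : Fin r) : Matrix (Fin n) (Fin n) (MvPolynomial (Coord r n) ℂ) :=
  Matrix.of fun i j => MvPolynomial.X (Sum.inl (k, i, j))

/-- The generic inverse of `D_k`. -/
def genE (r n : ℕ) (k : Fin r) : Matrix (Fin n) (Fin n) (MvPolynomial (Coord r n) ℂ) :=
  Matrix.of fun i j => MvPolynomial.X (Sum.inr (k, i, j))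

/-- The ideal generated by the entries of `D_k E_k - 1`, of `E_k D_k - 1` and of
`D_1 ᵗE_1 ⋯ D_r ᵗE_r Z - 1`. -/
def repIdeal (r n d : ℕ) : Ideal (MvPolynomial (Coord r n) ℂ) :=
  Ideal.span
    ({f | ∃ k i j, f = (genD r n k * genE r n k - 1) i j} ∪
     {f | ∃ k i j, f = (genE r n k * genD r n k - 1) i j} ∪
     {f | ∃ i j, f = ((List.ofFn fun k => genD r n k * (genE r n k).transpose).prod *
        algebraMap ℂ (Matrix (Fin n) (Fin n) (MvPolynomial (Coord r n) ℂ)) (zeta n d) - 1) i j})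

/-- The coordinate ring of the affine scheme of tuples `D_1, …, D_r` in `GL_n` with
`D_1 θ(D_1) ⋯ D_r θ(D_r) Z = 1`. -/
abbrev RepRing (r n d : ℕ) : Type := MvPolynomial (Coord r n) ℂ ⧸ repIdeal r n d

/-- Evaluation of polynomials in the coordinates at a tuple of invertible matrices. -/
def evalPoly (D : Fin r → GL (Fin n) R) : MvPolynomial (Coord r n) ℂ →ₐ[ℂ] R :=
  MvPolynomial.aeval (Sum.elim (fun p => (D p.1).val p.2.1 p.2.2) fun p => (D p.1)⁻¹.val p.2.1 p.2.2)

lemma evalPoly_genD (D : Fin r → GL (Fin n) R) (k : Fin r) :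
    (evalPoly D).mapMatrix (genD r n k) = (D k).val := by
  ext i j
  simp [evalPoly, genD]

lemma evalPoly_genE (D : Fin r → GL (Fin n) R) (k : Fin r) :
    (evalPoly D).mapMatrix (genE r n k) = (D k)⁻¹.val := by
  ext i j
  simp [evalPoly, genE]

lemma evalPoly_eq_zero (x : RepPoint r n d R) {f : MvPolynomial (Coord r n) ℂ}
    (hf : f ∈ repIdeal r n d) : evalPoly x.D f = 0 := by
  have hE (k : Fin r) : (evalPoly x.D).mapMatrix (genE r n k).transpose = (cartan (x.D k)).val := by
    change ((evalPoly x.D).mapMatrix (genE r n k)).transpose = _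
    rw [evalPoly_genE]
    rfl
  have hprod : (evalPoly x.D).mapMatrix
      (List.ofFn fun k => genD r n k * (genE r n k).transpose).prod =
        (List.ofFn fun k => x.D k * cartan (x.D k)).prod.val := by
    rw [map_list_prod, List.map_ofFn, ← Units.coeHom_apply, map_list_prod, List.map_ofFn]
    congr 2
    funext k
    simp only [Function.comp_apply, map_mul, evalPoly_genD, hE, Units.coeHom_apply]
  have key : repIdeal r n d ≤ RingHom.ker (evalPoly x.D) := by
    refine Ideal.span_le.2 ?_
    rintro f ((⟨k, i, j, rfl⟩ | ⟨k, i, j, rfl⟩) | ⟨i, j, rfl⟩)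
    · change (evalPoly x.D).mapMatrix (genD r n k * genE r n k - 1) i j = 0
      rw [map_sub, map_mul, evalPoly_genD, evalPoly_genE, map_one, Units.mul_inv, sub_self]
      rfl
    · change (evalPoly x.D).mapMatrix (genE r n k * genD r n k - 1) i j = 0
      rw [map_sub, map_mul, evalPoly_genD, evalPoly_genE, map_one, Units.inv_mul, sub_self]
      rfl
    · change (evalPoly x.D).mapMatrix (_ - 1) i j = 0
      rw [map_sub, map_mul, hprod, AlgHom.commutes, x.relation, map_one, sub_self]
      rfl
  exact key hf

/-- The value `f(x)` of a function `f` in the coordinate ring at an `R`-point `x`. -/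
def RepPoint.eval (x : RepPoint r n d R) : RepRing r n d →ₐ[ℂ] R :=
  Ideal.Quotient.liftₐ (repIdeal r n d) (evalPoly x.D) fun _ hf => evalPoly_eq_zero x hf

/-- The algebra of `GL_n`-invariant functions, i.e. of those `f` with `f(g • x) = f(x)` for all
points `x` and `g` with values in all commutative `ℂ`-algebras. -/
def invariants (r n d : ℕ) : Subalgebra ℂ (RepRing r n d) where
  carrier := {f | ∀ (R : Type) [CommRing R] [Algebra ℂ R] (g : GL (Fin n) R)
    (x : RepPoint r n d R), (g • x).eval f = x.eval f}
  mul_mem' hf hf' R _ _ g x := by rw [map_mul, map_mul, hf, hf']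
  add_mem' hf hf' R _ _ g x := by rw [map_add, map_add, hf, hf']
  algebraMap_mem' c R _ _ g x := by rw [AlgHom.commutes, AlgHom.commutes]

/-- The character variety: the GIT quotient of the affine scheme of tuples by `GL_n`, i.e. the
spectrum of the algebra of invariant functions. -/
def charVariety (r n d : ℕ) : SchC := specC (invariants r n d)

/-- The image in the GIT quotient of a point of the affine scheme of tuples. -/
def toCharVariety {T : SchC} (x : RepPoint r n d (𝒪 T)) : T ⟶ charVariety r n d :=
  toSpecC (x.eval.comp (invariants r n d).val)

/-- `q` is the canonical morphism from the character stack to the character variety: it is induced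
by the quotient morphism from the scheme of tuples to the GIT quotient, i.e. for an object
`(P ⟶ S, P ⟶ X)` of the stack, the composite `P ⟶ S ⟶ X // GL_n` is `P ⟶ X ⟶ X // GL_n`. (There is
at most one such `q`, as `P ⟶ S` is locally surjective.) -/
def IsCanonical (q : ∀ ξ : CharStack r n d,
    (QuotientStack.proj etale (repSpace r n d)).obj ξ ⟶ charVariety r n d) : Prop :=
  ∀ (ξ : CharStack r n d) (T : SchCᵒᵖ) (p : ξ.torsor.P.space.obj T),
    ξ.torsor.π T p ≫ q ξ = toCharVariety (ξ.toX.app T p)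

end Representations

end CharacterStack

end

open CharacterStack

open CategoryTheory AlgebraicGeometry Opposite

noncomputable section

namespace CharacterStack

/-! ### Properties that hold étale locally on a ring -/

/-! Put M = ᵗD₁D₂⁻¹ and W = D₂. The pair (M, W) determines (D₁, D₂), the group GL_n acts on M by
conjugation, and the defining equation becomes MW = ζ·W·ᵗM with ζ = e^{πid/n}. As d is even and
prime to n, n is odd and ζ is a primitive n-th root of unity. Since M is conjugate to ζ·ᵗM, its
characteristic polynomial has no terms of degree strictly between 0 and n, so it is Xⁿ − t with t =
det M = det D₁/det D₂. This invariant t is the quotient map to ℂ*.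

Étale locally t = cⁿ, and M becomes diagonal with entries cζⁱ (`RepPoint.etaleLocally_diagonal`).
The equation then forces W to be a cyclic permutation matrix with unit weights, on which a diagonal
matrix h acts by w_{ij} ↦ h_i w_{ij} h_j. Because the cycle has odd length, all weights can be made
1 after extracting one square root (`RepPoint.etaleLocally_isNormal`). The normal form depends only
on c, so two points with the same t are étale locally in one orbit
(`RepPoint.etaleLocally_exists_smul_eq`), and a walk round the same odd cycle shows that stabilisers
are μ₂ (`RepPoint.stabilizer`). This works over every ℂ-algebra because n and the differences ζⁱ −
ζʲ are invertible there.

The map t also has a global section s by monomial matrices (`sectionPoint`). Hence every point is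
étale locally of the form g·s(t), and functions on X_{n,d} embed into functions on GL_n × ℂ*. That
ring is reduced, so the coordinate ring is too (`isReduced_repRing`); an invariant function is
determined by its restriction to s, so the invariants are ℂ[T, T⁻¹] (`laurentEquivInvariants`).

What remains is formal (`QuotientStack.isGerbe`): on a subcanonical site, the quotient of a sheaf X
by a sheaf of groups is a gerbe over Y banded by A if X → Y is invariant and surjective on sections,
the group is locally transitive on fibres, and every stabiliser is the same central subgroup A. The
stack axioms come from gluing sections of torsors. A descent datum is made effective by taking as
sections over T the compatible families of sections over the arrows of the sieve that factor through
T; such families range over a whole sieve and so live in `Type 1`. -/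

/-- A property of `ℂ`-algebras over `R` holds étale locally if each geometric point of `Spec R`
lifts to an étale `R`-algebra with this property. -/
def EtaleLocally (R : Type) [CommRing R] [Algebra ℂ R]
    (P : ∀ (S : Type) [CommRing S] [Algebra ℂ S], (R →ₐ[ℂ] S) → Prop) : Prop :=
  ∀ (K : Type) [Field K] [IsAlgClosed K] (φ : R →+* K),
    ∃ (S : Type) (_ : CommRing S) (_ : Algebra ℂ S) (f : R →ₐ[ℂ] S) (ψ : S →+* K),
      f.toRingHom.Etale ∧ ψ.comp f.toRingHom = φ ∧ P S f

section EtaleLocally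

variable {R : Type} [CommRing R] [Algebra ℂ R]

/-- A geometric point is lifted twice in succession, and étale homomorphisms compose. This is what
allows roots and eigenbases to be adjoined one after another. -/
lemma EtaleLocally.trans {P Q : ∀ (S : Type) [CommRing S] [Algebra ℂ S], (R →ₐ[ℂ] S) → Prop}
    (hP : EtaleLocally R P)
    (hQ : ∀ (S : Type) [CommRing S] [Algebra ℂ S] (f : R →ₐ[ℂ] S), P S f →
      EtaleLocally S fun S' _ _ g => Q S' (g.comp f)) : EtaleLocally R Q := by
  intro K _ _ φ
  obtain ⟨S, _, _, f, ψ, hf, hψ, hPS⟩ := hP K φ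
  obtain ⟨S', _, _, g, χ, hg, hχ, hQS⟩ := hQ S f hPS K ψ
  refine ⟨S', _, _, g.comp f, χ, ?_, ?_, hQS⟩
  · exact RingHom.Etale.stableUnderComposition _ _ hf hg
  · rw [← hψ, ← hχ]
    rfl

lemma EtaleLocally.mono {P Q : ∀ (S : Type) [CommRing S] [Algebra ℂ S], (R →ₐ[ℂ] S) → Prop}
    (hP : EtaleLocally R P)
    (hPQ : ∀ (S : Type) [CommRing S] [Algebra ℂ S] (f : R →ₐ[ℂ] S), P S f → Q S f) :
    EtaleLocally R Q := by
  intro K _ _ φ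
  obtain ⟨S, _, _, f, ψ, hf, hψ, hPS⟩ := hP K φ
  exact ⟨S, _, _, f, ψ, hf, hψ, hPQ S f hPS⟩

/-- If `r` dies in a flat algebra, some element of its annihilator is nonzero at a given point of
this algebra. -/
lemma exists_mul_eq_zero_of_flat {R S K : Type} [CommRing R] [CommRing S] [Field K] {f : R →+* S}
    (hf : f.Flat) (ψ : S →+* K) {r : R} (h0 : f r = 0) : ∃ a, r * a = 0 ∧ ψ (f a) ≠ 0 := by
  let : Algebra R S := f.toAlgebra
  -- The equational criterion of flatness for the relation r·1 = 0 writes 1 = ∑ f(aⱼ)yⱼ with r·aⱼ =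
  -- 0. The f(aⱼ) cannot all vanish at `ψ`, since `ψ` sends 1 to 1.
  have : Module.Flat R S := hf
  obtain ⟨k, a, y, hy, ha⟩ := Module.Flat.isTrivialRelation_of_sum_smul_eq_zero (R := R) (M := S)
    (ι := Fin 1) (f := fun _ => r) (x := fun _ => 1) <| by
      rw [Fin.sum_univ_one, Algebra.smul_def, mul_one]
      exact h0
  have h1 : (1 : S) = ∑ j, f (a 0 j) * y j := by
    refine (hy 0).trans (Finset.sum_congr rfl fun j _ => Algebra.smul_def _ _)
  have ha' (j : Fin k) : r * a 0 j = 0 := by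
    rw [← ha j, Fin.sum_univ_one]
  by_contra! hcon
  refine one_ne_zero (α := K) ?_
  rw [← map_one ψ, h1, map_sum]
  refine Finset.sum_eq_zero fun j _ => ?_
  rw [map_mul, hcon (a 0 j) (ha' j), zero_mul]

/-- An element which vanishes étale locally is zero. -/
lemma EtaleLocally.eq_zero {r : R} (h : EtaleLocally R fun _ _ _ f => f r = 0) : r = 0 := by
  by_contra hr
  -- If r ≠ 0, its annihilator lies in a maximal ideal m. A geometric point over m sends the
  -- annihilator to 0, contrary to `exists_mul_eq_zero_of_flat`.
  have hI : Ideal.span {a : R | r * a = 0} ≠ ⊤ := by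
    intro htop
    have hle : Ideal.span {a : R | r * a = 0} ≤ LinearMap.ker (LinearMap.mulLeft R r) :=
      Ideal.span_le.2 fun a ha => ha
    have : (1 : R) ∈ LinearMap.ker (LinearMap.mulLeft R r) := hle (htop ▸ Submodule.mem_top)
    exact hr (by simpa using this)
  obtain ⟨m, hm, hle⟩ := Ideal.exists_le_maximal _ hI
  obtain ⟨S, _, _, f, ψ, hf, hψ, h0⟩ := h (AlgebraicClosure m.ResidueField)
    ((algebraMap m.ResidueField (AlgebraicClosure m.ResidueField)).comp
      (algebraMap R m.ResidueField))
  have hflat : f.toRingHom.Flat := (RingHom.Etale.iff_flat_and_formallyUnramified.1 hf).1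
  obtain ⟨a, ha, hne⟩ := exists_mul_eq_zero_of_flat hflat ψ (r := r) h0
  apply hne
  have ham : a ∈ m := hle (Ideal.subset_span ha)
  rw [← RingHom.comp_apply, hψ, RingHom.comp_apply, Ideal.algebraMap_residueField_eq_zero.2 ham,
    map_zero]

/-- An element which does not vanish at a geometric point becomes invertible étale locally. -/
lemma etaleLocally_isUnit {ι : Type} (r : ι → R)
    (h : ∀ (K : Type) [Field K] [IsAlgClosed K] (φ : R →+* K), ∃ i, φ (r i) ≠ 0) :
    EtaleLocally R fun _ _ _ f => ∃ i, IsUnit (f (r i)) := by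
  intro K _ _ φ
  obtain ⟨i, hi⟩ := h K φ
  refine ⟨Localization.Away (r i), inferInstance, inferInstance,
    IsScalarTower.toAlgHom ℂ R _, IsLocalization.Away.lift (r i) hi.isUnit, ?_, ?_, i, ?_⟩
  · change (algebraMap R (Localization.Away (r i))).Etale
    rw [RingHom.etale_algebraMap]
    exact Algebra.Etale.of_isLocalizationAway (r i)
  · exact IsLocalization.Away.lift_comp (r i) hi.isUnit
  · exact IsLocalization.Away.algebraMap_isUnit (r i)

open Polynomial in
/-- A unit has an `m`-th root étale locally. -/
lemma etaleLocally_exists_pow_eq (u : Rˣ) {m : ℕ} (hm : m ≠ 0) :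
    EtaleLocally R fun S _ _ f => ∃ c : Sˣ, (c : S) ^ m = f u := by
  intro K _ _ φ
  have hmR : IsUnit (m : R) := by
    have : (m : R) = algebraMap ℂ R m := by simp
    rw [this]
    exact (IsUnit.mk0 (m : ℂ) (by exact_mod_cast hm)).map _
  obtain ⟨v, hv⟩ := hmR.mul u.isUnit
  let P : StandardEtalePair R :=
    { f := X ^ m - Polynomial.C (u : R)
      monic_f := monic_X_pow_sub_C _ hm
      g := 1
      cond := by
        -- With f = X^m − u one has X·f′ − m·f = m·u = v, a unit, so multiplying by v⁻¹ gives the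
        -- Bézout relation between f and f′.
        refine ⟨X * Polynomial.C (↑v⁻¹ : R), -(Polynomial.C ((m : R) * ↑v⁻¹)), 1, ?_⟩
        obtain ⟨k, rfl⟩ := Nat.exists_eq_succ_of_ne_zero hm
        have hv' : Polynomial.C (((k + 1 : ℕ) : R)) * Polynomial.C (u : R) *
            Polynomial.C (↑v⁻¹ : R) = 1 := by
          rw [← Polynomial.C_mul, ← Polynomial.C_mul, ← hv, Units.mul_inv, Polynomial.C_1]
        simp only [derivative_sub, derivative_X_pow, derivative_C, sub_zero, Polynomial.C_mul,
          Nat.succ_eq_add_one, Nat.add_sub_cancel, one_pow]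
        linear_combination hv' }
  let : Algebra ℂ P.Ring := ((algebraMap R P.Ring).comp (algebraMap ℂ R)).toAlgebra
  have : IsScalarTower ℂ R P.Ring := IsScalarTower.of_algebraMap_eq fun _ => rfl
  let : Algebra R K := φ.toAlgebra
  obtain ⟨b, hb⟩ := IsAlgClosed.exists_pow_nat_eq (φ u) (Nat.pos_of_ne_zero hm)
  have hmap : P.HasMap b := by
    refine ⟨?_, ?_⟩
    · simp only [P, map_sub, map_pow, aeval_X, aeval_C, hb]
      exact sub_self _
    · simp [P]
  have hX : (P.X : P.Ring) ^ m = algebraMap R P.Ring u := by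
    have := P.hasMap_X.1
    simpa [P, sub_eq_zero] using this
  refine ⟨P.Ring, inferInstance, inferInstance, IsScalarTower.toAlgHom ℂ R _,
    (P.lift b hmap).toRingHom, ?_, ?_, ?_⟩
  · change (algebraMap R P.Ring).Etale
    rw [RingHom.etale_algebraMap]
    infer_instance
  · exact (P.lift b hmap).comp_algebraMap
  · have hu : IsUnit (P.X : P.Ring) := by
      rw [← isUnit_pow_iff hm, hX]
      exact u.isUnit.map _
    exact ⟨hu.unit, hX⟩

end EtaleLocally

lemma transp_inv {n : ℕ} {R : Type} [CommRing R] (A : GL (Fin n) R) :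
    transp A⁻¹ = (transp A)⁻¹ := rfl

/-! ### The pair of matrices attached to a point -/

section Pair

variable {n d : ℕ} {R S : Type} [CommRing R] [Algebra ℂ R] [CommRing S] [Algebra ℂ S]

lemma zeta_ne_zero (n d : ℕ) : zeta n d ≠ 0 := Complex.exp_ne_zero _

/-- The root of unity `e^{π i d / n}` as a unit of `R`. -/
def zetaUnit (n d : ℕ) (R : Type) [CommRing R] [Algebra ℂ R] : Rˣ :=
  Units.map (algebraMap ℂ R).toMonoidHom (Units.mk0 (zeta n d) (zeta_ne_zero n d))

lemma map_zetaUnit (f : R →ₐ[ℂ] S) :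
    f (zetaUnit n d R : R) = zetaUnit n d S := f.commutes _

/-- The central matrix `e^{π i d / n} I_n`. -/
def zetaScalar (n d : ℕ) (R : Type) [CommRing R] [Algebra ℂ R] : GL (Fin n) R :=
  Matrix.GeneralLinearGroup.scalar (Fin n) (zetaUnit n d R)

lemma zetaScalar_val :
    (zetaScalar n d R).val = algebraMap ℂ (Matrix (Fin n) (Fin n) R) (zeta n d) := by
  rw [IsScalarTower.algebraMap_apply ℂ R (Matrix (Fin n) (Fin n) R)]
  rfl

lemma zetaScalar_mul (g : GL (Fin n) R) : zetaScalar n d R * g = g * zetaScalar n d R :=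
  Matrix.GeneralLinearGroup.scalar_commute _ g

/-- Centrality of ζ allows the equation to be solved for ᵗD₁. In this form it turns into the twisted
commutation MW = ζ·W·ᵗM, and it is also the form checked for the explicit section. -/
lemma relation_iff (D : Fin 2 → GL (Fin n) R) :
    ((List.ofFn fun k => D k * cartan (D k)).prod : GL (Fin n) R).val *
      algebraMap ℂ (Matrix (Fin n) (Fin n) R) (zeta n d) = 1 ↔
    transp (D 0) = zetaScalar n d R * D 1 * (transp (D 1))⁻¹ * D 0 := by
  rw [← zetaScalar_val, ← Units.val_mul, ← Units.val_one, Units.val_inj]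
  simp only [List.ofFn_succ, List.ofFn_zero, List.prod_cons, List.prod_nil, mul_one, cartan,
    Fin.succ_zero_eq_one]
  rw [← zetaScalar_mul]
  have h : zetaScalar n d R * (D 0 * (transp (D 0))⁻¹ * (D 1 * (transp (D 1))⁻¹)) =
      D 0 * (transp (D 0))⁻¹ * (zetaScalar n d R * D 1 * (transp (D 1))⁻¹) := by
    rw [← mul_assoc, zetaScalar_mul]
    simp only [mul_assoc]
  have hgrp (a b c : GL (Fin n) R) : a * b⁻¹ * c = 1 ↔ b = c * a := by
    constructor
    · intro h
      rw [← inv_eq_of_mul_eq_one_right h]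
      group
    · rintro rfl
      group
  rw [h, hgrp]

/-- The matrix `ᵗD₁ D₂⁻¹`, on which `GL_n` acts by conjugation. -/
def RepPoint.conjMatrix (x : RepPoint 2 n d R) : GL (Fin n) R := transp (x.D 0) * (x.D 1)⁻¹

/-- The invariant `det D₁ / det D₂`. -/
def RepPoint.detRatio (x : RepPoint 2 n d R) : Rˣ := Matrix.GeneralLinearGroup.det x.conjMatrix

lemma RepPoint.smul_D (g : GL (Fin n) R) (x : RepPoint 2 n d R) (k : Fin 2) :
    (g • x).D k = g * x.D k * transp g := rfl

lemma RepPoint.map_D (f : R →ₐ[ℂ] S) (x : RepPoint 2 n d R) (k : Fin 2) :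
    (x.map f).D k = (x.D k).map f.toRingHom := rfl

lemma RepPoint.map_comp {T : Type} [CommRing T] [Algebra ℂ T] (f : R →ₐ[ℂ] S) (g : S →ₐ[ℂ] T)
    {r : ℕ} (x : RepPoint r n d R) : (x.map f).map g = x.map (g.comp f) := rfl

/-- Transposing g D₁ ᵗg gives g ᵗD₁ ᵗg, so the factor ᵗg cancels against the one in (g D₂ ᵗg)⁻¹. -/
lemma RepPoint.conjMatrix_smul (g : GL (Fin n) R) (x : RepPoint 2 n d R) :
    (g • x).conjMatrix = g * x.conjMatrix * g⁻¹ := by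
  simp only [conjMatrix, smul_D, transp_mul, transp_transp]
  group

lemma RepPoint.conjMatrix_map (f : R →ₐ[ℂ] S) (x : RepPoint 2 n d R) :
    (x.map f).conjMatrix = x.conjMatrix.map f.toRingHom := by
  simp only [conjMatrix, map_D, transp_map, map_mul, map_inv]

lemma RepPoint.detRatio_smul (g : GL (Fin n) R) (x : RepPoint 2 n d R) :
    (g • x).detRatio = x.detRatio := by
  rw [detRatio, conjMatrix_smul, map_mul, map_mul, map_inv, mul_comm, inv_mul_cancel_left]
  rfl

lemma RepPoint.detRatio_map (f : R →ₐ[ℂ] S) (x : RepPoint 2 n d R) :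
    ((x.map f).detRatio : S) = f x.detRatio := by
  rw [detRatio, conjMatrix_map, Matrix.GeneralLinearGroup.map_det]
  rfl

lemma RepPoint.transp_D_zero (x : RepPoint 2 n d R) :
    transp (x.D 0) = x.conjMatrix * x.D 1 := by
  simp [conjMatrix]

lemma RepPoint.eq_of_conjMatrix_eq {x y : RepPoint 2 n d R} (h : x.conjMatrix = y.conjMatrix)
    (h' : x.D 1 = y.D 1) : x = y := by
  refine RepPoint.ext (funext fun k => ?_)
  fin_cases k
  · change x.D 0 = y.D 0
    rw [← transp_transp (x.D 0), ← transp_transp (y.D 0), transp_D_zero, transp_D_zero, h, h']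
  · exact h'

/-- Since ᵗM = (ᵗD₂)⁻¹D₁, the equation solved for ᵗD₁ = M D₂ is exactly this identity. Everything
below uses the representation relation only through it. -/
lemma RepPoint.conjMatrix_mul (x : RepPoint 2 n d R) :
    x.conjMatrix * x.D 1 = zetaScalar n d R * x.D 1 * transp x.conjMatrix := by
  rw [← transp_D_zero, (relation_iff x.D).1 x.relation, conjMatrix, transp_mul, transp_transp,
    transp_inv]
  simp only [mul_assoc]

lemma RepPoint.conjMatrix_mul_val (x : RepPoint 2 n d R) :
    x.conjMatrix.val * (x.D 1).val =
      (zetaUnit n d R : R) • ((x.D 1).val * x.conjMatrix.val.transpose) := by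
  have h := congrArg Units.val x.conjMatrix_mul
  rw [Units.val_mul, Units.val_mul, Units.val_mul, zetaScalar] at h
  rw [h, Matrix.GeneralLinearGroup.coe_scalar, mul_assoc, Matrix.scalar_apply,
    ← Matrix.smul_eq_diagonal_mul]
  rfl

end Pair

/-! ### Roots of unity -/

section RootsOfUnity

variable {n d : ℕ} {R S : Type} [CommRing R] [Algebra ℂ R]

/-- Writing d = 2k gives e^{πid/n} = e^{2πik/n}, and k is prime to n. This is where evenness of d
enters. -/
lemma zeta_isPrimitiveRoot (hd : Even d) (hnd : Nat.Coprime d n) (hn : n ≠ 0) :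
    IsPrimitiveRoot (zeta n d) n := by
  obtain ⟨k, rfl⟩ := hd
  have hk : k.Coprime n := by
    rw [← two_mul] at hnd
    exact hnd.coprime_mul_left
  convert Complex.isPrimitiveRoot_exp_of_coprime k n hn hk using 1
  rw [zeta]
  congr 1
  push_cast
  ring

lemma odd_of_even_of_coprime (hd : Even d) (hnd : Nat.Coprime d n) : Odd n := by
  rw [← Nat.not_even_iff_odd]
  intro h
  have := Nat.dvd_gcd hd.two_dvd h.two_dvd
  rw [hnd] at this
  omega




lemma zetaUnit_pow (hz : IsPrimitiveRoot (zeta n d) n) : (zetaUnit n d R : R) ^ n = 1 := by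
  change (algebraMap ℂ R (zeta n d)) ^ n = 1
  rw [← map_pow, hz.pow_eq_one, map_one]

/-- The difference is the image of a nonzero complex number, hence invertible in every ℂ-algebra.
Distinct eigenvalues thus stay distinct at every point, and eigenvalue arguments work over arbitrary
rings. -/
lemma isUnit_zetaUnit_pow_sub (hz : IsPrimitiveRoot (zeta n d) n) {i j : ℕ}
    (hi : i < n) (hj : j < n) (hij : i ≠ j) :
    IsUnit ((zetaUnit n d R : R) ^ i - (zetaUnit n d R : R) ^ j) := by
  change IsUnit (algebraMap ℂ R (zeta n d) ^ i - algebraMap ℂ R (zeta n d) ^ j)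
  rw [← map_pow, ← map_pow, ← map_sub]
  refine (IsUnit.mk0 _ ?_).map _
  rw [sub_ne_zero]
  exact fun h => hij (hz.pow_inj hi hj h)

lemma zetaUnit_pow_mod (hz : IsPrimitiveRoot (zeta n d) n) (k : ℕ) :
    (zetaUnit n d R : R) ^ (k % n) = (zetaUnit n d R : R) ^ k := by
  conv_rhs => rw [← Nat.mod_add_div k n, pow_add, pow_mul, zetaUnit_pow hz, one_pow, mul_one]

end RootsOfUnity

/-! ### Matrices similar to a multiple of their transpose -/

section TwistedSymmetric

variable {n : ℕ} {R : Type} [CommRing R] {ζ : R} {M : Matrix (Fin n) (Fin n) R} {W : GL (Fin n) R}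

lemma pow_mul_eq_of_twisted (h : M * W.val = ζ • (W.val * M.transpose)) (k : ℕ) :
    M ^ k * W.val = ζ ^ k • (W.val * (M ^ k).transpose) := by
  induction k with
  | zero => simp
  | succ k ih =>
    rw [pow_succ, mul_assoc, h, mul_smul_comm, ← mul_assoc, ih, smul_mul_assoc, smul_smul,
      ← pow_succ', mul_assoc, ← Matrix.transpose_mul, ← pow_succ', ← pow_succ]

/-- M^k is conjugate to ζ^k·ᵗ(M^k), so its trace τ satisfies τ = ζ^k τ. -/
lemma trace_pow_eq_zero_of_twisted (h : M * W.val = ζ • (W.val * M.transpose)) {k : ℕ}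
    (hk : IsUnit (1 - ζ ^ k)) : (M ^ k).trace = 0 := by
  have h1 : M ^ k = ζ ^ k • (W.val * (M ^ k).transpose * W⁻¹.val) := by
    rw [← smul_mul_assoc, ← pow_mul_eq_of_twisted h, mul_assoc, Units.mul_inv, mul_one]
  have h2 : (M ^ k).trace = ζ ^ k * (M ^ k).trace := by
    conv_lhs => rw [h1]
    rw [Matrix.trace_smul, Matrix.trace_mul_comm, ← mul_assoc, Units.inv_mul, one_mul,
      Matrix.trace_transpose, smul_eq_mul]
  refine hk.mul_left_cancel ?_
  rw [mul_zero, sub_mul, one_mul, ← h2, sub_self]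

open Polynomial in
-- This is det(ζX − ζM) = ζⁿ·det(X − M), read as a substitution in the entries of the characteristic
-- matrix.
lemma charpoly_smul_comp (M : Matrix (Fin n) (Fin n) R) (ζ : R) :
    (ζ • M).charpoly.comp (C ζ * X) = C (ζ ^ n) * M.charpoly := by
  have h : (Matrix.charmatrix (ζ • M)).map (compRingHom (C ζ * X)) =
      C ζ • Matrix.charmatrix M := by
    ext1 i j
    by_cases hij : i = j
    · subst hij
      simp [mul_sub]
    · simp [Matrix.charmatrix_apply_ne _ _ _ hij]
  have h2 := congrArg Matrix.det h
  rw [Matrix.det_smul, Fintype.card_fin, ← RingHom.mapMatrix_apply, ← RingHom.map_det] at h2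
  rw [C_pow]
  exact h2

open Polynomial in
-- As M is conjugate to ζ·ᵗM and ζⁿ = 1, the characteristic polynomial is invariant under X ↦ ζX.
-- Its coefficients in degrees strictly between 0 and n therefore vanish, and its constant term is
-- −det M because n is odd. Cayley–Hamilton finishes the argument.
lemma pow_eq_det_of_twisted (hn : Odd n) (h : M * W.val = ζ • (W.val * M.transpose))
    (hζ : ζ ^ n = 1) (hk : ∀ k, 0 < k → k < n → IsUnit (1 - ζ ^ k)) :
    M ^ n = M.det • (1 : Matrix (Fin n) (Fin n) R) := by
  have hn0 : n ≠ 0 := by rintro rfl; simp at hn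
  rcases subsingleton_or_nontrivial R with _ | _
  · exact Subsingleton.elim _ _
  have h1 : M = ζ • (W.val * M.transpose * W⁻¹.val) := by
    rw [← smul_mul_assoc, ← h, mul_assoc, Units.mul_inv, mul_one]
  have h2 : M.charpoly.comp (C ζ * X) = M.charpoly := by
    conv_lhs => rw [h1]
    rw [charpoly_smul_comp, hζ, C_1, one_mul, Matrix.coe_units_inv, ← Matrix.coe_units_inv,
      Matrix.charpoly_mul_comm, ← mul_assoc, Units.inv_mul, one_mul, Matrix.charpoly_transpose]
  have hdeg : M.charpoly.natDegree = n := by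
    rw [Matrix.charpoly_natDegree_eq_dim, Fintype.card_fin]
  have h3 (k : ℕ) (h0 : 0 < k) (hkn : k < n) : M.charpoly.coeff k = 0 := by
    have h4 := congrArg (fun p => p.coeff k) h2
    simp only [comp_C_mul_X_coeff] at h4
    refine (hk k h0 hkn).mul_left_cancel ?_
    rw [mul_zero, sub_mul, one_mul, mul_comm _ (coeff _ _), h4, sub_self]
  have h5 : M.charpoly = X ^ n - C M.det := by
    ext k
    rcases Nat.eq_zero_or_pos k with rfl | h0
    · rw [coeff_sub, coeff_X_pow, coeff_C_zero, if_neg (Ne.symm hn0), zero_sub,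
        Matrix.det_eq_sign_charpoly_coeff, Fintype.card_fin, hn.neg_one_pow]
      ring
    · rw [coeff_sub, coeff_X_pow, coeff_C, if_neg h0.ne', sub_zero]
      rcases lt_trichotomy k n with hkn | rfl | hkn
      · rw [h3 k h0 hkn, if_neg hkn.ne]
      · rw [if_pos rfl]
        have hlead : M.charpoly.coeff M.charpoly.natDegree = 1 := M.charpoly_monic
        rwa [hdeg] at hlead
      · rw [if_neg hkn.ne', coeff_eq_zero_of_natDegree_lt (by rwa [hdeg])]
  have h6 := Matrix.aeval_self_charpoly M
  rw [h5, map_sub, map_pow, aeval_X, aeval_C, sub_eq_zero, Algebra.algebraMap_eq_smul_one] at h6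
  exact h6

/-- The projector (up to the factor `n`) to the eigenspace of `M` with eigenvalue `a⁻¹`, for a
matrix `M` with `(a M) ^ n = 1`. -/
def eigenProj (M : Matrix (Fin n) (Fin n) R) (a : R) : Matrix (Fin n) (Fin n) R :=
  ∑ k ∈ Finset.range n, (a • M) ^ k

/-- Telescoping: (A − 1)·∑ A^k = Aⁿ − 1 = 0 for A = a·M. Hence every column of the projector
satisfies the eigenvector equation. -/
lemma mul_eigenProj {M : Matrix (Fin n) (Fin n) R} {a : R} (h : (a • M) ^ n = 1) :
    (a • M) * eigenProj M a = eigenProj M a := by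
  have := mul_geom_sum (a • M) n
  rw [h, sub_self, sub_mul, one_mul, sub_eq_zero] at this
  exact this

/-- Only the term k = 0 has nonzero trace. Since n is invertible, the projector has a nonzero
diagonal entry, hence a nonzero column, at each point. -/
lemma trace_eigenProj (hn : n ≠ 0) {M : Matrix (Fin n) (Fin n) R} {a : R}
    (h : ∀ k, 0 < k → k < n → (M ^ k).trace = 0) : (eigenProj M a).trace = n := by
  rw [eigenProj, Matrix.trace_sum, Finset.sum_eq_single 0]
  · simp
  · intro k hk hk0
    rw [smul_pow, Matrix.trace_smul, h k (Nat.pos_of_ne_zero hk0) (Finset.mem_range.1 hk),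
      smul_zero]
  · simp [Nat.pos_iff_ne_zero, hn]

end TwistedSymmetric

/-! ### Étale local diagonalisation of ᵗD₁D₂⁻¹ -/

section Points

variable {n d : ℕ} {R S : Type} [CommRing R] [Algebra ℂ R] [CommRing S] [Algebra ℂ S]

lemma isUnit_one_sub_zetaUnit_pow (hz : IsPrimitiveRoot (zeta n d) n) {k : ℕ} (hk : 0 < k)
    (hkn : k < n) : IsUnit (1 - (zetaUnit n d R : R) ^ k) := by
  simpa using isUnit_zetaUnit_pow_sub (R := R) hz (hk.trans hkn) hkn hk.ne

lemma RepPoint.conjMatrix_pow (hz : IsPrimitiveRoot (zeta n d) n) (hn : Odd n)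
    (x : RepPoint 2 n d R) :
    x.conjMatrix.val ^ n = (x.detRatio : R) • (1 : Matrix (Fin n) (Fin n) R) :=
  pow_eq_det_of_twisted hn x.conjMatrix_mul_val (zetaUnit_pow hz)
    fun _ => isUnit_one_sub_zetaUnit_pow hz

lemma det_ne_zero_of_eigenvectors {K : Type} [Field K] {A V : Matrix (Fin n) (Fin n) K}
    {c : Fin n → K} (hc : Function.Injective c) (hV : A * V = V * Matrix.diagonal c)
    (h0 : ∀ i, V.col i ≠ 0) : V.det ≠ 0 := by
  have hli : LinearIndependent K V.col := by
    refine Module.End.eigenvectors_linearIndependent' (Matrix.toLin' A) c hc V.col fun i => ?_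
    refine ⟨?_, h0 i⟩
    rw [Module.End.mem_eigenspace_iff]
    ext j
    have := congrFun (congrFun hV j) i
    rw [Matrix.mul_diagonal] at this
    simpa [Matrix.mulVec, dotProduct, Matrix.mul_apply, mul_comm] using this
  rw [← isUnit_iff_ne_zero, ← Matrix.isUnit_iff_isUnit_det]
  exact Matrix.linearIndependent_cols_iff_isUnit.1 hli

/-- If `det D₁ / det D₂ = c ^ n`, the matrix `ᵗD₁ D₂⁻¹` is étale locally conjugate to the diagonal
matrix with entries `c ζ ^ i`. -/
lemma RepPoint.etaleLocally_diagonal (hz : IsPrimitiveRoot (zeta n d) n) (hn : Odd n)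
    (x : RepPoint 2 n d R) (c : Rˣ) (hc : (c : R) ^ n = x.detRatio) :
    EtaleLocally R fun S _ _ f => ∃ g : GL (Fin n) S,
      (g • x.map f).conjMatrix.val =
        Matrix.diagonal fun i : Fin n => f c * (zetaUnit n d S : S) ^ (i : ℕ) := by
  have hn0 : n ≠ 0 := by rintro rfl; simp at hn
  set M := x.conjMatrix.val with hM
  -- The prospective eigenvalues cζⁱ, which are n-th roots of det M.
  let u (i : Fin n) : Rˣ := c * zetaUnit n d R ^ (i : ℕ)
  have hu (i : Fin n) : (((u i)⁻¹ : Rˣ) : R) ^ n * (x.detRatio : R) = 1 := by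
    have h1 : (u i : R) ^ n = x.detRatio := by
      simp only [u, Units.val_mul, mul_pow, hc, Units.val_pow_eq_pow_val]
      rw [← pow_mul, mul_comm (i : ℕ), pow_mul, zetaUnit_pow hz, one_pow, mul_one]
    rw [← h1, ← mul_pow, Units.inv_mul, one_pow]
  have hpow (i : Fin n) : ((((u i)⁻¹ : Rˣ) : R) • M) ^ n = 1 := by
    rw [smul_pow, x.conjMatrix_pow hz hn, smul_smul, hu, one_smul]
  have htr (i : Fin n) : (eigenProj M (((u i)⁻¹ : Rˣ) : R)).trace = n :=
    trace_eigenProj hn0 fun k h0 hk =>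
      trace_pow_eq_zero_of_twisted x.conjMatrix_mul_val (isUnit_one_sub_zetaUnit_pow hz h0 hk)
  -- Column i is the column `s i` of the projector for the eigenvalue `u i`. No single `s` need work
  -- globally; invertibility is sought locally, over the finitely many choices.
  let V (s : Fin n → Fin n) : Matrix (Fin n) (Fin n) R :=
    Matrix.of fun r i => eigenProj M (((u i)⁻¹ : Rˣ) : R) r (s i)
  have hV (s : Fin n → Fin n) : M * V s = V s * Matrix.diagonal fun i => (u i : R) := by
    ext r i
    have h1 := congrFun (congrFun (mul_eigenProj (hpow i)) r) (s i)
    rw [smul_mul_assoc, Matrix.smul_apply, smul_eq_mul, Units.inv_mul_eq_iff_eq_mul] at h1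
    rw [Matrix.mul_diagonal, mul_comm]
    exact h1
  refine (etaleLocally_isUnit (fun s => (V s).det) ?_).mono ?_
  · intro K _ _ φ
    have hφn : φ n ≠ 0 := by
      have h1 : (n : R) = algebraMap ℂ R n := by simp
      rw [h1]
      exact (((IsUnit.mk0 (n : ℂ) (by exact_mod_cast hn0)).map (algebraMap ℂ R)).map φ).ne_zero
    have hex (i : Fin n) : ∃ j, φ (eigenProj M (((u i)⁻¹ : Rˣ) : R) j j) ≠ 0 := by
      by_contra! hcon
      apply hφn
      rw [← htr i, Matrix.trace, map_sum]
      exact Finset.sum_eq_zero fun j _ => hcon j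
    -- At a geometric point, the nonzero diagonal entry of the i-th projector selects a nonzero
    -- eigenvector, and eigenvectors for distinct eigenvalues are independent.
    choose s hs using hex
    refine ⟨s, ?_⟩
    rw [RingHom.map_det]
    refine det_ne_zero_of_eigenvectors (A := φ.mapMatrix M) (c := fun i => φ (u i)) ?_ ?_ ?_
    · intro i j hij
      by_contra hne
      refine (((isUnit_zetaUnit_pow_sub (R := R) hz i.2 j.2 fun h => hne (Fin.ext h)).map φ).mul
        (c.isUnit.map φ)).ne_zero ?_
      simp only [u, Units.val_mul, Units.val_pow_eq_pow_val, map_mul, map_pow] at hij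
      rw [map_sub, map_pow, map_pow]
      linear_combination hij
    · rw [← map_mul, hV, map_mul]
      congr 1
      ext i j
      by_cases hij : i = j
      · subst hij; simp
      · simp [hij]
    · intro i h0
      exact hs i (congrFun h0 (s i))
  · rintro S _ _ f ⟨s, hs⟩
    rw [AlgHom.map_det] at hs
    let v : GL (Fin n) S := Matrix.GeneralLinearGroup.mk'' _ hs
    refine ⟨v⁻¹, ?_⟩
    rw [conjMatrix_smul, conjMatrix_map, inv_inv, Units.val_mul, Units.val_mul, mul_assoc]
    have h1 : (x.conjMatrix.map f.toRingHom).val * v.val =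
        v.val * Matrix.diagonal fun i : Fin n => f c * (zetaUnit n d S : S) ^ (i : ℕ) := by
      have h2 := congrArg f.mapMatrix (hV s)
      rw [map_mul, map_mul] at h2
      refine h2.trans ?_
      congr 1
      ext i j
      by_cases hij : i = j
      · subst hij
        simp [u, map_zetaUnit]
      · simp [hij]
    rw [h1, ← mul_assoc, Units.inv_mul, one_mul]

end Points

/-! ### The normal form -/

section NormalForm

variable {n d : ℕ} {R S : Type} [CommRing R] [Algebra ℂ R] [CommRing S] [Algebra ℂ S]

lemma map_diagonal_zetaUnit (f : R →ₐ[ℂ] S) (c : R) :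
    f.mapMatrix (Matrix.diagonal fun i : Fin n => c * (zetaUnit n d R : R) ^ (i : ℕ)) =
      Matrix.diagonal fun i : Fin n => f c * (zetaUnit n d S : S) ^ (i : ℕ) := by
  ext i j
  by_cases hij : i = j
  · subst hij
    simp [map_zetaUnit]
  · simp [hij]

variable [NeZero n]

lemma Fin.val_add_one_mod (j : Fin n) : ((j + 1 : Fin n) : ℕ) = (j + 1) % n := by
  rw [Fin.val_add, Fin.val_one', Nat.add_mod_mod]

lemma zetaUnit_pow_fin_add_one (hz : IsPrimitiveRoot (zeta n d) n) (j : Fin n) :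
    (zetaUnit n d R : R) ^ ((j + 1 : Fin n) : ℕ) =
      (zetaUnit n d R : R) ^ (j : ℕ) * zetaUnit n d R := by
  rw [Fin.val_add_one_mod, zetaUnit_pow_mod hz, pow_succ]

lemma GL_apply_congr {n : ℕ} {R : Type} [CommRing R] {A B : GL (Fin n) R} (h : A = B)
    (i j : Fin n) : A.val i j = B.val i j := by
  rw [h]

/-- The matrix of a cyclic permutation. -/
def cyclicMatrix (n : ℕ) [NeZero n] (R : Type) [CommRing R] : Matrix (Fin n) (Fin n) R :=
  Matrix.of fun i j => if i = j + 1 then 1 else 0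

/-- `x` is in normal form with eigenvalues `c ζ ^ i`: the matrix `ᵗD₁ D₂⁻¹` is diagonal with these
entries and `D₂` is a cyclic permutation matrix. -/
structure RepPoint.IsNormal (x : RepPoint 2 n d R) (c : R) : Prop where
  conjMatrix_eq : x.conjMatrix.val =
    Matrix.diagonal fun i : Fin n => c * (zetaUnit n d R : R) ^ (i : ℕ)
  D_one_eq : (x.D 1).val = cyclicMatrix n R

lemma RepPoint.IsNormal.unique {x y : RepPoint 2 n d R} {c : R} (hx : x.IsNormal c)
    (hy : y.IsNormal c) : x = y :=
  eq_of_conjMatrix_eq (Units.ext (hx.1.trans hy.1.symm)) (Units.ext (hx.2.trans hy.2.symm))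

lemma RepPoint.IsNormal.map {x : RepPoint 2 n d R} {c : R} (hx : x.IsNormal c) (f : R →ₐ[ℂ] S) :
    (x.map f).IsNormal (f c) where
  conjMatrix_eq := by
    rw [conjMatrix_map, ← map_diagonal_zetaUnit, ← hx.1]
    rfl
  D_one_eq := by
    rw [map_D]
    change f.mapMatrix (x.D 1).val = _
    rw [hx.2]
    ext i j
    simp [cyclicMatrix]

/-- Conjugation by diagonal matrices turns a weighted cyclic permutation matrix into a cyclic
permutation matrix if the weights admit a suitable square root. -/
lemma exists_recursion_units {n : ℕ} {R : Type} [CommRing R] (a : ℕ → Rˣ) (hn : Odd n) :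
    ∃ p : Rˣ, ∀ (S : Type) [CommRing S] (f : R →+* S) (s : Sˣ), (s : S) ^ 2 = f p →
      ∃ h : ℕ → Sˣ, h n = h 0 ∧
        ∀ k, h (k + 1) * Units.map (f : R →* S) (a k) * h k = 1 := by
  -- `p` solves the recursion with initial value 1. The initial value s multiplies its terms by s
  -- and s⁻¹ alternately, so for odd n the solution closes up exactly when p n · s⁻¹ = s. Hence p n
  -- is the unit whose square root is needed.
  let p : ℕ → Rˣ := fun k => Nat.rec 1 (fun k q => (a k * q)⁻¹) k
  have hp (k : ℕ) : p (k + 1) = (a k * p k)⁻¹ := rfl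
  refine ⟨p n, fun S _ f s hs => ?_⟩
  refine ⟨fun k => Units.map (f : R →* S) (p k) * if Even k then s else s⁻¹, ?_, fun k => ?_⟩
  · have hs' : s ^ 2 = Units.map (f : R →* S) (p n) := Units.ext (by simpa using hs)
    simp only [← hs', Nat.not_even_iff_odd.2 hn, if_false, Even.zero, if_true]
    change s ^ 2 * s⁻¹ = Units.map (f : R →* S) 1 * s
    rw [map_one, one_mul, pow_two, mul_inv_cancel_right]
  · have key (a p s : Sˣ) : (a * p)⁻¹ * s⁻¹ * a * (p * s) = 1 := by
      rw [mul_assoc, ← mul_inv, inv_mul_eq_one]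
      ac_rfl
    simp only [hp, Nat.even_add_one, map_inv, map_mul]
    split_ifs with h1
    · exact key _ _ _
    · simpa using key (Units.map (f : R →* S) (a k)) (Units.map (f : R →* S) (p k)) s⁻¹

/-- The (i, j) entry of MW = ζ·W·ᵗM reads c(ζⁱ − ζ^{j+1})·w_{ij} = 0. Off the cyclic pattern the
factor is a unit. -/
lemma RepPoint.D_one_apply_eq_zero (hz : IsPrimitiveRoot (zeta n d) n) {x : RepPoint 2 n d R}
    {c : R} (hc : IsUnit c) (hx : x.conjMatrix.val =
      Matrix.diagonal fun i : Fin n => c * (zetaUnit n d R : R) ^ (i : ℕ)) {i j : Fin n}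
    (hij : i ≠ j + 1) : (x.D 1).val i j = 0 := by
  have h1 := congrFun (congrFun x.conjMatrix_mul_val i) j
  rw [hx, Matrix.diagonal_transpose, Matrix.smul_apply, Matrix.diagonal_mul, Matrix.mul_diagonal,
    smul_eq_mul] at h1
  refine (hc.mul (isUnit_zetaUnit_pow_sub (R := R) hz i.2 (j + 1).2
    fun h => hij (Fin.ext h))).mul_left_cancel ?_
  rw [zetaUnit_pow_fin_add_one hz, mul_zero]
  linear_combination h1

/-- If `det D₁ / det D₂ = c ^ n`, then étale locally `(D₁, D₂)` has a normal form. -/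
lemma RepPoint.etaleLocally_isNormal (hz : IsPrimitiveRoot (zeta n d) n) (hn : Odd n)
    (x : RepPoint 2 n d R) (c : Rˣ) (hc : (c : R) ^ n = x.detRatio) :
    EtaleLocally R fun S _ _ f => ∃ g : GL (Fin n) S, (g • x.map f).IsNormal (f c) := by
  refine (x.etaleLocally_diagonal hz hn c hc).trans ?_
  rintro S _ _ f ⟨g, hg⟩
  set y := g • x.map f with hy
  have hfc : IsUnit (f c) := c.isUnit.map f
  -- Row j + 1 of D₂ can only be nonzero in column j, so the diagonal entry of D₂D₂⁻¹ = 1 exhibits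
  -- an inverse for that entry.
  have hunit (j : Fin n) : IsUnit ((y.D 1).val (j + 1) j) := by
    have h1 := congrFun (congrFun (y.D 1).mul_inv (j + 1)) (j + 1)
    rw [Matrix.mul_apply, Finset.sum_eq_single j, Matrix.one_apply_eq] at h1
    · exact IsUnit.of_mul_eq_one _ h1
    · intro k _ hk
      rw [D_one_apply_eq_zero hz hfc hg (fun h => hk (add_right_cancel h).symm), zero_mul]
    · simp
  choose a ha using hunit
  obtain ⟨p, hp⟩ := exists_recursion_units (fun k => a (Fin.ofNat n k)) hn
  refine (etaleLocally_exists_pow_eq p two_ne_zero).mono ?_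
  rintro S' _ _ f' ⟨s, hs⟩
  obtain ⟨h, hh0, hh⟩ := hp S' f'.toRingHom s hs
  let D : GL (Fin n) S' :=
    { val := Matrix.diagonal fun i => (h i : S')
      inv := Matrix.diagonal fun i => (((h i)⁻¹ : S'ˣ) : S')
      val_inv := by simp [Matrix.diagonal_mul_diagonal]
      inv_val := by simp [Matrix.diagonal_mul_diagonal] }
  -- The recursion runs over natural numbers, the matrix indices modulo n; `h n = h 0` reconciles
  -- the two at the last index.
  have hval (j : Fin n) : h ((j + 1 : Fin n) : ℕ) = h (j + 1) := by
    rw [Fin.val_add_one_mod]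
    rcases lt_or_eq_of_le (Nat.succ_le_of_lt j.2) with hj | hj
    · rw [Nat.mod_eq_of_lt hj]
    · rw [show (j : ℕ) + 1 = n from hj, Nat.mod_self, hh0]
  refine ⟨D * g.map f'.toRingHom, ?_⟩
  have hmap : (D * g.map f'.toRingHom) • x.map (f'.comp f) = D • y.map f' := by
    rw [hy, map_smul, mul_smul]
    rfl
  rw [hmap]
  have hconj : (y.map f').conjMatrix.val =
      Matrix.diagonal fun i : Fin n => f' (f c) * (zetaUnit n d S' : S') ^ (i : ℕ) := by
    rw [conjMatrix_map, ← map_diagonal_zetaUnit, ← hg]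
    rfl
  constructor
  · rw [conjMatrix_smul, Units.val_mul, Units.val_mul, hconj]
    change Matrix.diagonal _ * Matrix.diagonal _ * Matrix.diagonal _ = _
    rw [Matrix.diagonal_mul_diagonal, Matrix.diagonal_mul_diagonal]
    congr 1
    ext i
    rw [mul_assoc, mul_comm, mul_assoc, Units.inv_mul, mul_one]
    rfl
  · rw [smul_D, Units.val_mul, Units.val_mul]
    change Matrix.diagonal _ * _ * (Matrix.diagonal _).transpose = _
    ext i j
    rw [Matrix.diagonal_transpose, Matrix.mul_diagonal, Matrix.diagonal_mul]
    change _ * f' ((y.D 1).val i j) * _ = if i = j + 1 then 1 else 0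
    split_ifs with hij
    · subst hij
      have h1 := congrArg Units.val (hh j)
      rw [← ha, hval]
      simpa using h1
    · rw [D_one_apply_eq_zero hz hfc hg hij, map_zero, mul_zero, zero_mul]

/-- Two points with the same value of `det D₁ / det D₂` are étale locally in the same orbit. -/
lemma RepPoint.etaleLocally_exists_smul_eq (hz : IsPrimitiveRoot (zeta n d) n) (hn : Odd n)
    (x y : RepPoint 2 n d R) (h : x.detRatio = y.detRatio) :
    EtaleLocally R fun S _ _ f => ∃ g : GL (Fin n) S, g • x.map f = y.map f := by
  refine (etaleLocally_exists_pow_eq x.detRatio (NeZero.ne n)).trans ?_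
  rintro S _ _ f ⟨c, hc⟩
  refine ((x.map f).etaleLocally_isNormal hz hn c (hc.trans (x.detRatio_map f).symm)).trans ?_
  rintro S' _ _ f' ⟨g, hg⟩
  -- The same root c serves for both points, so their normal forms coincide by
  -- `RepPoint.IsNormal.unique`.
  have hcy : ((Units.map f'.toRingHom.toMonoidHom c : S'ˣ) : S') ^ n =
      ((y.map f).map f').detRatio := by
    rw [detRatio_map, detRatio_map, ← h, ← hc, map_pow]
    rfl
  refine (((y.map f).map f').etaleLocally_isNormal hz hn _ hcy).mono ?_
  rintro S'' _ _ f'' ⟨g', hg'⟩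
  refine ⟨g'⁻¹ * g.map f''.toRingHom, ?_⟩
  have h1 := (hg.map f'').unique hg'
  rw [map_smul] at h1
  rw [mul_smul, inv_smul_eq_iff]
  exact h1

/-- Commuting with a diagonal matrix whose entries have invertible differences forces g to be
diagonal. Preserving the cyclic matrix gives g_{j+1}g_j = 1 for all j, so the entries alternate
between g₀ and its inverse; going once round the odd cycle gives g₀² = 1 and makes all entries
equal. -/
lemma RepPoint.IsNormal.stabilizer (hz : IsPrimitiveRoot (zeta n d) n) (hn : Odd n)
    {x : RepPoint 2 n d R} {c : R} (hc : IsUnit c) (hx : x.IsNormal c) {g : GL (Fin n) R}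
    (hg : g • x = x) : ∃ a : Rˣ, a ^ 2 = 1 ∧ g = Matrix.GeneralLinearGroup.scalar (Fin n) a := by
  have hcomm : g * x.conjMatrix = x.conjMatrix * g := by
    conv_rhs => rw [← hg, conjMatrix_smul]
    group
  have hoff (i j : Fin n) (hij : i ≠ j) : g.val i j = 0 := by
    have h1 := GL_apply_congr hcomm i j
    rw [Units.val_mul, Units.val_mul, hx.1, Matrix.diagonal_mul, Matrix.mul_diagonal] at h1
    refine (hc.mul (isUnit_zetaUnit_pow_sub (R := R) hz i.2 j.2
      fun h => hij (Fin.ext h))).mul_left_cancel ?_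
    rw [mul_zero]
    linear_combination -h1
  have hdiag : g.val = Matrix.diagonal fun i => g.val i i := by
    ext i j
    by_cases hij : i = j
    · subst hij; simp
    · rw [Matrix.diagonal_apply_ne _ hij, hoff i j hij]
  have hstep (j : Fin n) : g.val (j + 1) (j + 1) * g.val j j = 1 := by
    have h1 := GL_apply_congr (congrFun (congrArg RepPoint.D hg) 1) (j + 1) j
    rw [smul_D, Units.val_mul, Units.val_mul, show (transp g).val = g.val.transpose from rfl, hdiag,
      Matrix.diagonal_transpose, Matrix.mul_diagonal, Matrix.diagonal_mul, hx.2] at h1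
    simpa [cyclicMatrix] using h1
  -- For even k this says g_k = g₀, for odd k that g_k g₀ = 1, with indices modulo n. The case k = n
  -- returns to index 0 with odd parity.
  have hseq (k : ℕ) : g.val (Fin.ofNat n k) (Fin.ofNat n k) * (if Even k then 1 else g.val 0 0) =
      if Even k then g.val 0 0 else 1 := by
    induction k with
    | zero => simp
    | succ k ih =>
      have h1 := hstep (Fin.ofNat n k)
      have h2 : Fin.ofNat n k + 1 = Fin.ofNat n (k + 1) := by
        ext
        rw [Fin.val_add_one_mod]
        simp
      rw [h2] at h1
      simp only [Nat.even_add_one]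
      split_ifs at ih ⊢ with h3
      · rw [mul_one] at ih
        rwa [← ih]
      · linear_combination g.val 0 0 * h1 -
          g.val (Fin.ofNat n (k + 1)) (Fin.ofNat n (k + 1)) * ih
  have hsq : g.val 0 0 * g.val 0 0 = 1 := by
    have h1 := hseq n
    have h2 : Fin.ofNat n n = 0 := by ext; simp
    simpa [h2, Nat.not_even_iff_odd.2 hn] using h1
  have hall (i : Fin n) : g.val i i = g.val 0 0 := by
    have h1 := hseq i
    have h2 : Fin.ofNat n i = i := by ext; simp
    rw [h2] at h1
    split_ifs at h1
    · simpa using h1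
    · linear_combination g.val 0 0 * h1 - g.val i i * hsq
  refine ⟨⟨g.val 0 0, g.val 0 0, hsq, hsq⟩, Units.ext (by simpa [pow_two] using hsq),
    Units.ext ?_⟩
  rw [Matrix.GeneralLinearGroup.coe_scalar, Matrix.scalar_apply]
  refine hdiag.trans ?_
  simp only [hall]

/-- The stabiliser of a point consists of the scalar matrices with square `1`. -/
lemma RepPoint.stabilizer (hz : IsPrimitiveRoot (zeta n d) n) (hn : Odd n) {x : RepPoint 2 n d R}
    {g : GL (Fin n) R} (hg : g • x = x) :
    ∃ a : Rˣ, a ^ 2 = 1 ∧ g = Matrix.GeneralLinearGroup.scalar (Fin n) a := by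
  -- The normal form is available only étale locally. Being scalar with square 1 is a system of
  -- equations in the entries of g, and each of them descends by `EtaleLocally.eq_zero`.
  have hloc : EtaleLocally R fun S _ _ f => ∃ a : Sˣ, a ^ 2 = 1 ∧
      g.map f.toRingHom = Matrix.GeneralLinearGroup.scalar (Fin n) a := by
    refine (etaleLocally_exists_pow_eq x.detRatio (NeZero.ne n)).trans ?_
    rintro S _ _ f ⟨c, hc⟩
    refine ((x.map f).etaleLocally_isNormal hz hn c (hc.trans (x.detRatio_map f).symm)).mono ?_
    rintro S' _ _ f' ⟨h, hh⟩
    obtain ⟨a, ha, hga⟩ := hh.stabilizer hz hn (c.isUnit.map f')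
      (g := h * g.map (f'.comp f).toRingHom * h⁻¹) (by
        rw [mul_smul, mul_smul, inv_smul_smul, RepPoint.map_comp, ← map_smul, hg])
    refine ⟨a, ha, ?_⟩
    rw [mul_inv_eq_iff_eq_mul, Matrix.GeneralLinearGroup.scalar_commute] at hga
    exact mul_left_cancel hga
  have hoff (i j : Fin n) (hij : i ≠ j) : g.val i j = 0 := by
    refine EtaleLocally.eq_zero (hloc.mono ?_)
    rintro S _ _ f ⟨a, -, ha⟩
    have h1 := GL_apply_congr ha i j
    rw [Matrix.GeneralLinearGroup.coe_scalar, Matrix.scalar_apply,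
      Matrix.diagonal_apply_ne _ hij] at h1
    exact h1
  have hall (i : Fin n) : g.val i i - g.val 0 0 = 0 := by
    refine EtaleLocally.eq_zero (hloc.mono ?_)
    rintro S _ _ f ⟨a, -, ha⟩
    have h1 (i : Fin n) : f (g.val i i) = a := by
      have := GL_apply_congr ha i i
      rw [Matrix.GeneralLinearGroup.coe_scalar, Matrix.scalar_apply,
        Matrix.diagonal_apply_eq] at this
      exact this
    rw [map_sub, h1, h1, sub_self]
  have hsq : g.val 0 0 * g.val 0 0 - 1 = 0 := by
    refine EtaleLocally.eq_zero (hloc.mono ?_)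
    rintro S _ _ f ⟨a, ha, hg⟩
    have h1 : f (g.val 0 0) = a := by
      have := GL_apply_congr hg 0 0
      rw [Matrix.GeneralLinearGroup.coe_scalar, Matrix.scalar_apply,
        Matrix.diagonal_apply_eq] at this
      exact this
    rw [map_sub, map_mul, h1, map_one, ← pow_two, ← Units.val_pow_eq_pow_val, ha, Units.val_one,
      sub_self]
  rw [sub_eq_zero] at hsq
  refine ⟨⟨g.val 0 0, g.val 0 0, hsq, hsq⟩, Units.ext (by simpa [pow_two] using hsq),
    Units.ext ?_⟩
  ext i j
  rw [Matrix.GeneralLinearGroup.coe_scalar, Matrix.scalar_apply]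
  by_cases hij : i = j
  · subst hij
    rw [Matrix.diagonal_apply_eq]
    exact sub_eq_zero.1 (hall i)
  · rw [Matrix.diagonal_apply_ne _ hij, hoff i j hij]

end NormalForm

/-! ### Monomial matrices -/

section Monomial

variable {n : ℕ} {R S : Type} [CommRing R] [CommRing S]

/-- Diagonal matrices with invertible entries. -/
def diagGL (w : Fin n → Rˣ) : GL (Fin n) R where
  val := Matrix.diagonal fun i => (w i : R)
  inv := Matrix.diagonal fun i => (((w i)⁻¹ : Rˣ) : R)
  val_inv := by simp [Matrix.diagonal_mul_diagonal]
  inv_val := by simp [Matrix.diagonal_mul_diagonal]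

lemma diagGL_mul (w w' : Fin n → Rˣ) : diagGL w * diagGL w' = diagGL (w * w') :=
  Units.ext (by simp [diagGL, Matrix.diagonal_mul_diagonal])

lemma diagGL_inv (w : Fin n → Rˣ) : (diagGL w)⁻¹ = diagGL w⁻¹ :=
  Units.ext rfl

lemma transp_diagGL (w : Fin n → Rˣ) : transp (diagGL w) = diagGL w :=
  Units.ext (Matrix.diagonal_transpose _)

lemma diagGL_map (f : R →+* S) (w : Fin n → Rˣ) :
    (diagGL w).map f = diagGL fun i => Units.map (f : R →* S) (w i) := by
  ext i j
  by_cases hij : i = j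
  · subst hij
    simp [diagGL]
  · simp [diagGL, hij]

/-- The permutation matrix of an involution. -/
def involGL (R : Type) [CommRing R] (σ : Fin n → Fin n) (hσ : Function.Involutive σ) :
    GL (Fin n) R :=
  have h : (Matrix.of fun i j => if j = σ i then (1 : R) else 0 : Matrix (Fin n) (Fin n) R) *
      (Matrix.of fun i j => if j = σ i then (1 : R) else 0) = 1 := by
    ext i j
    simp only [Matrix.mul_apply, Matrix.of_apply, ite_mul, one_mul, zero_mul,
      Finset.sum_ite_eq', Finset.mem_univ, if_true, hσ i, Matrix.one_apply, eq_comm (a := j)]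
  { val := Matrix.of fun i j => if j = σ i then 1 else 0
    inv := Matrix.of fun i j => if j = σ i then 1 else 0
    val_inv := h
    inv_val := h }

variable {σ : Fin n → Fin n} (hσ : Function.Involutive σ)

lemma involGL_inv : (involGL R σ hσ)⁻¹ = involGL R σ hσ := Units.ext rfl

lemma transp_involGL : transp (involGL R σ hσ) = involGL R σ hσ := by
  refine Units.ext ?_
  ext i j
  simp only [transp, involGL, Matrix.transpose_apply, Matrix.of_apply]
  congr 1
  exact propext ⟨fun h => by rw [h, hσ], fun h => by rw [h, hσ]⟩

lemma involGL_mul_diagGL (w : Fin n → Rˣ) :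
    involGL R σ hσ * diagGL w = diagGL (w ∘ σ) * involGL R σ hσ := by
  refine Units.ext ?_
  ext i j
  simp only [Units.val_mul, involGL, diagGL, Matrix.mul_diagonal, Matrix.diagonal_mul,
    Matrix.of_apply]
  split_ifs with h
  · subst h; simp
  · simp

lemma involGL_mul_self : involGL R σ hσ * involGL R σ hσ = 1 := by
  nth_rewrite 1 [← involGL_inv]
  exact inv_mul_cancel _

lemma involGL_map (f : R →+* S) : (involGL R σ hσ).map f = involGL S σ hσ := by
  ext i j
  simp only [involGL]
  change f (if _ then _ else _) = if _ then _ else _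
  split_ifs <;> simp

end Monomial

/-! ### A section -/

section Section

variable {n d : ℕ} {R S : Type} [CommRing R] [Algebra ℂ R] [CommRing S] [Algebra ℂ S]

/-- The character `i ↦ ζ ^ i` of `ℤ / n`. -/
def zetaChar (n d : ℕ) (R : Type) [CommRing R] [Algebra ℂ R] (i : Fin n) : Rˣ :=
  zetaUnit n d R ^ (i : ℕ)

lemma zetaChar_add (hz : IsPrimitiveRoot (zeta n d) n) (i j : Fin n) :
    zetaChar n d R (i + j) = zetaChar n d R i * zetaChar n d R j := by
  refine Units.ext ?_
  simp only [zetaChar, Units.val_pow_eq_pow_val, Units.val_mul]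
  rw [Fin.val_add, zetaUnit_pow_mod hz, pow_add]

lemma map_zetaChar (f : R →ₐ[ℂ] S) (i : Fin n) :
    Units.map (f.toRingHom : R →* S) (zetaChar n d R i) = zetaChar n d S i := by
  refine Units.ext ?_
  simp only [zetaChar, map_pow, Units.val_pow_eq_pow_val]
  congr 1
  exact map_zetaUnit f

lemma detRatio_eq (x : RepPoint 2 n d R) :
    x.detRatio = Matrix.GeneralLinearGroup.det (x.D 0) *
      (Matrix.GeneralLinearGroup.det (x.D 1))⁻¹ := by
  rw [RepPoint.detRatio, RepPoint.conjMatrix, map_mul, map_inv]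
  congr 1
  exact Units.ext (Matrix.det_transpose _)

lemma involutive_neg_fin : Function.Involutive fun i : Fin n => -i := neg_neg

variable [NeZero n]

lemma zetaChar_zero : zetaChar n d R 0 = 1 := by simp [zetaChar]

lemma zetaChar_neg (hz : IsPrimitiveRoot (zeta n d) n) (i : Fin n) :
    zetaChar n d R (-i) = (zetaChar n d R i)⁻¹ := by
  rw [eq_inv_iff_mul_eq_one, ← zetaChar_add hz, neg_add_cancel, zetaChar_zero]

lemma zetaChar_one (hz : IsPrimitiveRoot (zeta n d) n) : zetaChar n d R 1 = zetaUnit n d R := by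
  refine Units.ext ?_
  simp only [zetaChar, Units.val_pow_eq_pow_val]
  rw [Fin.val_one', zetaUnit_pow_mod hz, pow_one]

lemma involutive_neg_one_sub : Function.Involutive fun i : Fin n => -1 - i := fun i => by
  simp

/-- A family of points of the representation variety, parametrised by `t`. -/
def monomialPoint (hz : IsPrimitiveRoot (zeta n d) n) (t : Rˣ) : RepPoint 2 n d R where
  -- For D = diag(w)·P_σ with σ an involution, Dθ(D) = diag(w_i / w_{σ(i)}). The two factors are
  -- diag(ζ^{2i}) and diag(ζ^{−1−2i}), whose product is ζ⁻¹. Index 0 is fixed by i ↦ −i, so the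
  -- weight there cancels from Dθ(D) and may be any unit t.
  D := ![diagGL (Function.update (zetaChar n d R) 0 t) * involGL R (fun i => -i) involutive_neg_fin,
    diagGL (fun i => zetaChar n d R (-1 - i)) * involGL R (fun i => -1 - i) involutive_neg_one_sub]
  relation := by
    rw [relation_iff]
    simp only [Matrix.cons_val_zero, Matrix.cons_val_one]
    rw [transp_mul, transp_diagGL, transp_involGL, transp_mul, transp_diagGL, transp_involGL,
      mul_inv_rev, involGL_inv, diagGL_inv, involGL_mul_diagGL, ← mul_assoc]
    refine congrArg (· * _) ?_
    rw [mul_assoc (zetaScalar n d R), mul_assoc (diagGL _), ← mul_assoc (involGL _ _ _),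
      involGL_mul_diagGL, mul_assoc (diagGL _), involGL_mul_self, mul_one, diagGL_mul, mul_assoc,
      diagGL_mul]
    have hs : zetaScalar n d R = diagGL fun _ => zetaUnit n d R := Units.ext rfl
    rw [hs, diagGL_mul]
    congr 1
    funext i
    simp only [Function.comp_apply, Pi.mul_apply, Pi.inv_apply]
    have h1 : zetaChar n d R (-1 - (-1 - i)) = zetaChar n d R i := by congr 1; simp
    have h2 : zetaUnit n d R * zetaChar n d R (-1 - i) = (zetaChar n d R i)⁻¹ := by
      rw [← zetaChar_one hz, ← zetaChar_add hz, ← zetaChar_neg hz]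
      congr 1
      abel
    rw [h1, ← mul_assoc, ← mul_assoc, h2]
    by_cases hi : i = 0
    · subst hi
      simp [zetaChar_zero]
    · rw [Function.update_of_ne (neg_ne_zero.2 hi), Function.update_of_ne hi, zetaChar_neg hz]
      group

lemma monomialPoint_map (hz : IsPrimitiveRoot (zeta n d) n) (t : Rˣ) (f : R →ₐ[ℂ] S) :
    (monomialPoint hz t).map f = monomialPoint hz (Units.map (f.toRingHom : R →* S) t) := by
  refine RepPoint.ext (funext fun k => ?_)
  rw [RepPoint.map_D]
  fin_cases k
  · change (diagGL _ * involGL _ _ _).map f.toRingHom = diagGL _ * involGL _ _ _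
    rw [map_mul, involGL_map, diagGL_map]
    congr 2
    funext i
    by_cases hi : i = 0
    · subst hi; simp
    · rw [Function.update_of_ne hi, Function.update_of_ne hi, map_zetaChar]
  · change (diagGL _ * involGL _ _ _).map f.toRingHom = diagGL _ * involGL _ _ _
    rw [map_mul, involGL_map, diagGL_map]
    simp only [map_zetaChar]

/-- The parameter enters D₁ as a left factor diag(t, 1, …, 1) and leaves D₂ unchanged. Dividing by
the constant at t = 1 then normalises the section. -/
lemma detRatio_monomialPoint (hz : IsPrimitiveRoot (zeta n d) n) (t : Rˣ) :
    (monomialPoint hz t).detRatio = t * (monomialPoint hz (1 : Rˣ)).detRatio := by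
  have h : (monomialPoint hz t).D 0 =
      diagGL (Function.update 1 0 t) * (monomialPoint hz (1 : Rˣ)).D 0 := by
    change diagGL _ * involGL _ _ _ = diagGL _ * (diagGL _ * involGL _ _ _)
    rw [← mul_assoc, diagGL_mul]
    congr 2
    funext i
    by_cases hi : i = 0
    · subst hi; simp
    · simp [hi]
  have hdet : Matrix.GeneralLinearGroup.det (diagGL (Function.update 1 0 t : Fin n → Rˣ)) = t := by
    refine Units.ext ?_
    change Matrix.det (Matrix.diagonal _) = _
    rw [Matrix.det_diagonal, Finset.prod_eq_single 0]
    · simp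
    · intro i _ hi
      simp [hi]
    · simp
  rw [detRatio_eq, detRatio_eq, h, map_mul, hdet, mul_assoc]
  rfl

/-- A point of the representation variety with `det D₁ / det D₂ = t`. -/
def sectionPoint (hz : IsPrimitiveRoot (zeta n d) n) (t : Rˣ) : RepPoint 2 n d R :=
  monomialPoint hz (t * (monomialPoint hz (1 : Rˣ)).detRatio⁻¹)

lemma detRatio_sectionPoint (hz : IsPrimitiveRoot (zeta n d) n) (t : Rˣ) :
    (sectionPoint hz t).detRatio = t := by
  rw [sectionPoint, detRatio_monomialPoint, inv_mul_cancel_right]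

/-- Naturality in the ring makes the section a morphism ℂ* → X_{n,d}, so statements about it can be
checked at the universal unit. -/
lemma sectionPoint_map (hz : IsPrimitiveRoot (zeta n d) n) (t : Rˣ) (f : R →ₐ[ℂ] S) :
    (sectionPoint hz t).map f = sectionPoint hz (Units.map (f.toRingHom : R →* S) t) := by
  have h : Units.map (f.toRingHom : R →* S) (monomialPoint hz (1 : Rˣ)).detRatio =
      (monomialPoint hz (1 : Sˣ)).detRatio := by
    refine Units.ext ((RepPoint.detRatio_map f _).symm.trans ?_)
    rw [monomialPoint_map, map_one]
  rw [sectionPoint, monomialPoint_map, map_mul, map_inv, h]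
  rfl

end Section

/-! ### The universal point -/

section Universal

variable {r n d : ℕ} {R S : Type} [CommRing R] [Algebra ℂ R] [CommRing S] [Algebra ℂ S]

variable (r n d) in
/-- The quotient map to the coordinate ring. -/
abbrev repMk : MvPolynomial (Coord r n) ℂ →ₐ[ℂ] RepRing r n d := Ideal.Quotient.mkₐ ℂ (repIdeal r n d)

lemma repMk_eq_zero {f : MvPolynomial (Coord r n) ℂ} (hf : f ∈ repIdeal r n d) :
    repMk r n d f = 0 := Ideal.Quotient.eq_zero_iff_mem.2 hf

variable (r n d) in
/-- The matrices of the universal point. -/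
def univD (k : Fin r) : GL (Fin n) (RepRing r n d) where
  val := (repMk r n d).mapMatrix (genD r n k)
  inv := (repMk r n d).mapMatrix (genE r n k)
  val_inv := by
    rw [← map_mul, ← sub_eq_zero, ← map_one (repMk r n d).mapMatrix, ← map_sub]
    ext i j
    exact repMk_eq_zero (Ideal.subset_span (Or.inl (Or.inl ⟨k, i, j, rfl⟩)))
  inv_val := by
    rw [← map_mul, ← sub_eq_zero, ← map_one (repMk r n d).mapMatrix, ← map_sub]
    ext i j
    exact repMk_eq_zero (Ideal.subset_span (Or.inl (Or.inr ⟨k, i, j, rfl⟩)))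

variable (r n d) in
/-- The universal point of the scheme of tuples. -/
def univPoint : RepPoint r n d (RepRing r n d) where
  D := univD r n d
  relation := by
    have h : (List.ofFn fun k => univD r n d k * cartan (univD r n d k)).prod.val =
        (repMk r n d).mapMatrix (List.ofFn fun k => genD r n k * (genE r n k).transpose).prod := by
      rw [map_list_prod, List.map_ofFn, ← Units.coeHom_apply, map_list_prod, List.map_ofFn]
      congr 2
      funext k
      simp only [Function.comp_apply, map_mul, Units.coeHom_apply]
      rfl
    rw [h, ← AlgHom.commutes (repMk r n d).mapMatrix, ← map_mul, ← sub_eq_zero,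
      ← map_one (repMk r n d).mapMatrix, ← map_sub]
    ext i j
    exact repMk_eq_zero (Ideal.subset_span (Or.inr ⟨i, j, rfl⟩))

/-- The coordinates of the inverse matrices are generators too, but an algebra homomorphism carries
inverses to inverses, so the entries of the D_k suffice. -/
lemma RepPoint.algHom_ext {φ ψ : RepRing r n d →ₐ[ℂ] R}
    (h : ∀ k i j, φ ((univD r n d k).val i j) = ψ ((univD r n d k).val i j)) : φ = ψ := by
  have h' (k : Fin r) : (univD r n d k).map φ.toRingHom = (univD r n d k).map ψ.toRingHom := by
    ext i j
    exact h k i j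
  refine Ideal.Quotient.algHom_ext _ (MvPolynomial.algHom_ext fun c => ?_)
  rcases c with ⟨k, i, j⟩ | ⟨k, i, j⟩
  · exact h k i j
  · have h2 := congrArg (fun g : GL (Fin n) R => g⁻¹.val i j) (h' k)
    exact h2

lemma RepPoint.eval_univD (x : RepPoint r n d R) (k : Fin r) (i j : Fin n) :
    x.eval ((univD r n d k).val i j) = (x.D k).val i j := by
  change evalPoly x.D (genD r n k i j) = _
  simp [evalPoly, genD]

/-- Together with `eval_univPoint` and `RepPoint.eval_map`, this says that `RepRing` represents the
functor of points. -/
lemma univPoint_map_eval (x : RepPoint r n d R) : (univPoint r n d).map x.eval = x := by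
  refine RepPoint.ext (funext fun k => ?_)
  ext i j
  exact x.eval_univD k i j

lemma eval_univPoint : (univPoint r n d).eval = AlgHom.id ℂ _ :=
  RepPoint.algHom_ext fun k i j => (univPoint r n d).eval_univD k i j

lemma RepPoint.eval_map (f : R →ₐ[ℂ] S) (x : RepPoint r n d R) :
    (x.map f).eval = f.comp x.eval :=
  RepPoint.algHom_ext fun k i j => by
    rw [eval_univD, AlgHom.comp_apply, eval_univD]
    rfl

lemma RepPoint.eval_map_apply (f : R →ₐ[ℂ] S) (x : RepPoint r n d R) (a : RepRing r n d) :
    (x.map f).eval a = f (x.eval a) := by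
  rw [eval_map]
  rfl

end Universal

/-! ### The coordinate ring and its invariants -/

section CoordinateRing

variable {n d : ℕ}

/-- The coordinate of `ℂ*` as a unit. -/
def laurentUnit : (LaurentPolynomial ℂ)ˣ where
  val := LaurentPolynomial.T 1
  inv := LaurentPolynomial.T (-1)
  val_inv := by rw [← LaurentPolynomial.T_add, add_neg_cancel, LaurentPolynomial.T_zero]
  inv_val := by rw [← LaurentPolynomial.T_add, neg_add_cancel, LaurentPolynomial.T_zero]

lemma laurentUnit_zpow (k : ℤ) :
    ((laurentUnit ^ k : (LaurentPolynomial ℂ)ˣ) : LaurentPolynomial ℂ) = LaurentPolynomial.T k := by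
  obtain ⟨m, rfl | rfl⟩ := k.eq_nat_or_neg
  · rw [zpow_natCast, Units.val_pow_eq_pow_val]
    exact (LaurentPolynomial.T_pow 1 m).trans (by simp)
  · rw [zpow_neg, zpow_natCast, ← inv_pow, Units.val_pow_eq_pow_val]
    exact (LaurentPolynomial.T_pow (-1) m).trans (by simp)

variable {R : Type} [CommRing R] [Algebra ℂ R]

lemma laurent_algHom_ext {φ ψ : LaurentPolynomial ℂ →ₐ[ℂ] R}
    (h : φ (laurentUnit : LaurentPolynomial ℂ) = ψ (laurentUnit : LaurentPolynomial ℂ)) :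
    φ = ψ := by
  have hu : Units.map (φ : LaurentPolynomial ℂ →* R) laurentUnit =
      Units.map (ψ : LaurentPolynomial ℂ →* R) laurentUnit := Units.ext h
  refine AddMonoidAlgebra.algHom_ext (fun k => ?_) (by ext)
  change φ (LaurentPolynomial.T k) = ψ (LaurentPolynomial.T k)
  rw [← laurentUnit_zpow]
  have h2 := congrArg Units.val (congrArg (· ^ k) hu)
  simp only [← map_zpow] at h2
  exact h2

/-- The homomorphism `ℂ[T, T⁻¹] → R` with a given value at `T`. -/
def laurentLift (u : Rˣ) : LaurentPolynomial ℂ →ₐ[ℂ] R where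
  __ := LaurentPolynomial.eval₂ (algebraMap ℂ R) u
  commutes' c := LaurentPolynomial.eval₂_C (algebraMap ℂ R) u c

lemma laurentLift_laurentUnit (u : Rˣ) :
    laurentLift u (laurentUnit : LaurentPolynomial ℂ) = u := by
  change LaurentPolynomial.eval₂ (algebraMap ℂ R) u (LaurentPolynomial.T 1) = _
  rw [LaurentPolynomial.eval₂_T, zpow_one]

/-- The invariant function `det D₁ / det D₂`. -/
def detRatioInv (n d : ℕ) : (invariants 2 n d)ˣ :=
  have h {R : Type} [CommRing R] [Algebra ℂ R] (x : RepPoint 2 n d R) :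
      Units.map (x.eval : RepRing 2 n d →* R) (univPoint 2 n d).detRatio = x.detRatio := by
    conv_rhs => rw [← univPoint_map_eval x]
    exact Units.ext (RepPoint.detRatio_map x.eval (univPoint 2 n d)).symm
  { val := ⟨(univPoint 2 n d).detRatio, fun R _ _ g x => by
      refine congrArg Units.val ((h (g • x)).trans ((RepPoint.detRatio_smul g x).trans (h x).symm))⟩
    inv := ⟨((univPoint 2 n d).detRatio⁻¹ : (RepRing 2 n d)ˣ), fun R _ _ g x => by
      have h1 := (h (g • x)).trans ((RepPoint.detRatio_smul g x).trans (h x).symm)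
      exact congrArg (fun u : Rˣ => ((u⁻¹ : Rˣ) : R)) h1⟩
    val_inv := Subtype.ext (Units.mul_inv _)
    inv_val := Subtype.ext (Units.inv_mul _) }

lemma eval_detRatioInv (x : RepPoint 2 n d R) :
    x.eval ((detRatioInv n d : invariants 2 n d) : RepRing 2 n d) = x.detRatio := by
  conv_rhs => rw [← univPoint_map_eval x]
  exact (RepPoint.detRatio_map _ _).symm

variable [NeZero n]

/-- A function on the representation variety which vanishes on the orbits of the section is zero. -/
lemma eq_zero_of_eval_smul_sectionPoint (hz : IsPrimitiveRoot (zeta n d) n) (hn : Odd n)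
    {a : RepRing 2 n d} (h : ∀ (R : Type) [CommRing R] [Algebra ℂ R] (g : GL (Fin n) R) (t : Rˣ),
      (g • sectionPoint (d := d) hz t).eval a = 0) : a = 0 := by
  -- The universal point has the same invariant as the section over that invariant, hence is étale
  -- locally conjugate to it. The value of a at the universal point is a itself.
  refine EtaleLocally.eq_zero (((univPoint 2 n d).etaleLocally_exists_smul_eq hz hn
    (sectionPoint hz (univPoint 2 n d).detRatio) (detRatio_sectionPoint hz _).symm).mono ?_)
  rintro S _ _ f ⟨g, hg⟩
  rw [← eq_inv_smul_iff, sectionPoint_map] at hg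
  have h1 := h S g⁻¹ (Units.map f.toRingHom (univPoint 2 n d).detRatio)
  rw [← hg, RepPoint.eval_map_apply, eval_univPoint] at h1
  exact h1

/-- The coordinate ring of the representation variety is reduced. -/
theorem isReduced_repRing (hz : IsPrimitiveRoot (zeta n d) n) (hn : Odd n) :
    IsReduced (RepRing 2 n d) := by
  refine ⟨fun a ⟨m, ha⟩ => eq_zero_of_eval_smul_sectionPoint hz hn ?_⟩
  intro R _ _ g t
  -- L is the coordinate ring of GL_n × ℂ*, a localisation of a polynomial ring and hence reduced.
  -- Any pair (g, t) over R is the image of the universal pair over L, where the value of a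
  -- nilpotent function must be 0.
  let A := MvPolynomial (Option (Fin n × Fin n)) ℂ
  let M : Matrix (Fin n) (Fin n) A := Matrix.of fun i j => MvPolynomial.X (some (i, j))
  let T : A := MvPolynomial.X none
  let L := Localization.Away (M.det * T)
  have hunit : IsUnit (algebraMap A L (M.det * T)) := IsLocalization.Away.algebraMap_isUnit _
  have hred : IsReduced L := isReduced_localizationPreserves (Submonoid.powers (M.det * T)) L
    (inferInstanceAs (IsReduced A))
  rw [map_mul] at hunit
  have hM : IsUnit ((algebraMap A L).mapMatrix M).det := by
    rw [← RingHom.map_det]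
    exact isUnit_of_mul_isUnit_left hunit
  have hT : IsUnit (algebraMap A L T) := isUnit_of_mul_isUnit_right hunit
  let g₀ : GL (Fin n) L := Matrix.GeneralLinearGroup.mk'' _ hM
  let φ₀ : A →ₐ[ℂ] R := MvPolynomial.aeval fun o => o.elim (t : R) fun p => g.val p.1 p.2
  have hφM : φ₀.mapMatrix M = g.val := by
    ext i j
    exact MvPolynomial.aeval_X _ _
  have hφT : φ₀ T = t := MvPolynomial.aeval_X _ _
  have hφ : IsUnit (φ₀ (M.det * T)) := by
    rw [map_mul, AlgHom.map_det, hφM, hφT]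
    exact (Matrix.GeneralLinearGroup.det g).isUnit.mul t.isUnit
  let φ : L →ₐ[ℂ] R := IsLocalization.liftAlgHom (M := Submonoid.powers (M.det * T)) (f := φ₀) <| by
    rintro ⟨_, k, rfl⟩
    rw [map_pow]
    exact hφ.pow k
  have hcomp (p : A) : φ (algebraMap A L p) = φ₀ p := by
    simp [φ]
  have hg : g₀.map φ.toRingHom = g := by
    ext i j
    exact (hcomp _).trans (congrFun (congrFun hφM i) j)
  have ht : Units.map (φ.toRingHom : L →* R) hT.unit = t := Units.ext ((hcomp _).trans hφT)
  have h0 : (g₀ • sectionPoint (d := d) hz hT.unit).eval a = 0 := by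
    refine IsNilpotent.eq_zero ⟨m, ?_⟩
    rw [← map_pow, ha, map_zero]
  rw [← hg, ← ht, ← sectionPoint_map, ← RepPoint.map_smul, RepPoint.eval_map_apply, h0, map_zero]

/-- The algebra of invariants is `ℂ[T, T⁻¹]`, where `T` corresponds to `det D₁ / det D₂`. -/
def laurentEquivInvariants (hz : IsPrimitiveRoot (zeta n d) n) (hn : Odd n) :
    LaurentPolynomial ℂ ≃ₐ[ℂ] invariants 2 n d :=
  have hleft : ((sectionPoint hz laurentUnit).eval.comp (invariants 2 n d).val).comp
      (laurentLift (detRatioInv n d)) = AlgHom.id ℂ _ := by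
    refine laurent_algHom_ext ?_
    rw [AlgHom.comp_apply, laurentLift_laurentUnit]
    exact (eval_detRatioInv _).trans (congrArg Units.val (detRatio_sectionPoint hz laurentUnit))
  -- By invariance, a function that vanishes on the section vanishes on all its translates, and so
  -- it is zero.
  have hinj : Function.Injective
      ((sectionPoint hz laurentUnit).eval.comp (invariants 2 n d).val) := by
    refine (injective_iff_map_eq_zero _).2 fun a ha => Subtype.ext ?_
    refine eq_zero_of_eval_smul_sectionPoint hz hn fun R _ _ g t => ?_
    have ht : Units.map ((laurentLift t).toRingHom : LaurentPolynomial ℂ →* R) laurentUnit = t :=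
      Units.ext (laurentLift_laurentUnit t)
    rw [a.2, ← ht, ← sectionPoint_map, RepPoint.eval_map_apply]
    exact (congrArg _ ha).trans (map_zero _)
  AlgEquiv.ofAlgHom (laurentLift (detRatioInv n d))
    ((sectionPoint hz laurentUnit).eval.comp (invariants 2 n d).val)
    (AlgHom.ext fun a => hinj (DFunLike.congr_fun hleft _)) hleft

lemma eval_laurentEquivInvariants (hz : IsPrimitiveRoot (zeta n d) n) (hn : Odd n)
    (x : RepPoint 2 n d R) :
    (x.eval.comp (invariants 2 n d).val).comp
      (laurentEquivInvariants hz hn : LaurentPolynomial ℂ →ₐ[ℂ] invariants 2 n d) =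
      laurentLift x.detRatio := by
  refine laurent_algHom_ext ?_
  rw [laurentLift_laurentUnit, ← eval_detRatioInv]
  exact congrArg (fun a : invariants 2 n d => x.eval (a : RepRing 2 n d))
    (laurentLift_laurentUnit (detRatioInv n d))

end CoordinateRing

/-! ### Morphisms to affine schemes and sheaves on the étale site -/

section EtaleSite

/-- The étale topology is coarser than the fpqc topology, for which representable presheaves are
sheaves. -/
instance : Scheme.etaleTopology.{0}.Subcanonical :=
  .of_le (Scheme.etaleTopology_le_proetaleTopology.trans Scheme.proetaleTopology_le_fpqcTopology)

instance : etale.Subcanonical := inferInstance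

variable {B B' : Type} [CommRing B] [Algebra ℂ B] [CommRing B'] [Algebra ℂ B'] {T T' : SchC}

lemma toSpecC_left (φ : B →ₐ[ℂ] 𝒪 T) :
    (toSpecC φ).left = T.left.toSpecΓ ≫ Spec.map (CommRingCat.ofHom φ.toRingHom) := rfl

lemma toSpecC_left_appTop (φ : B →ₐ[ℂ] 𝒪 T) :
    (Scheme.ΓSpecIso (CommRingCat.of B)).inv ≫ (toSpecC φ).left.appTop =
      CommRingCat.ofHom φ.toRingHom := by
  rw [toSpecC_left]
  change _ ≫ (T.left.toSpecΓ ≫ Spec.map (CommRingCat.ofHom φ.toRingHom)).appTop = _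
  rw [Scheme.Hom.comp_appTop, Scheme.toSpecΓ_appTop, Scheme.ΓSpecIso_naturality,
    Iso.inv_hom_id_assoc]

lemma toSpecC_injective : Function.Injective (toSpecC : (B →ₐ[ℂ] 𝒪 T) → (T ⟶ specC B)) := by
  intro φ ψ h
  have h1 := toSpecC_left_appTop φ
  rw [h, toSpecC_left_appTop ψ] at h1
  ext b
  exact (congrArg (fun f => f.hom b) h1).symm

lemma comp_toSpecC (f : T' ⟶ T) (φ : B →ₐ[ℂ] 𝒪 T) :
    f ≫ toSpecC φ = toSpecC ((pullbackFun f).comp φ) := by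
  refine Over.OverMorphism.ext ?_
  have h : (f.left ≫ T.left.toSpecΓ ≫ Spec.map (CommRingCat.ofHom φ.toRingHom) :
      T'.left ⟶ Spec (CommRingCat.of B)) =
      T'.left.toSpecΓ ≫ Spec.map (CommRingCat.ofHom ((pullbackFun f).comp φ).toRingHom) := by
    rw [Scheme.toSpecΓ_naturality_assoc, ← Spec.map_comp]
    rfl
  exact h

/-- The functions on `Spec B`. -/
def specCFun (B : Type) [CommRing B] [Algebra ℂ B] : B →ₐ[ℂ] 𝒪 (specC B) where
  __ := (Scheme.ΓSpecIso (CommRingCat.of B)).inv.hom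
  commutes' c := by
    change (Scheme.ΓSpecIso (CommRingCat.of B)).inv.hom (algebraMap ℂ B c) = scalars (specC B) c
    have h := Scheme.ΓSpecIso_inv_naturality (CommRingCat.ofHom (algebraMap ℂ B))
    exact congrArg (fun f => f.hom c) h

lemma toSpecC_specCFun : toSpecC (specCFun B) = 𝟙 (specC B) := by
  refine Over.OverMorphism.ext ?_
  rw [toSpecC_left]
  exact toSpecΓ_SpecMap_ΓSpecIso_inv (CommRingCat.of B)

lemma toSpecC_surjective : Function.Surjective (toSpecC : (B →ₐ[ℂ] 𝒪 T) → (T ⟶ specC B)) :=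
  fun f => ⟨(pullbackFun f).comp (specCFun B), by
    rw [← comp_toSpecC, toSpecC_specCFun, Category.comp_id]⟩

/-- Morphisms to `Spec B` correspond to algebra homomorphisms. -/
def specCEquiv (B : Type) [CommRing B] [Algebra ℂ B] (T : SchC) :
    (T ⟶ specC B) ≃ (B →ₐ[ℂ] 𝒪 T) :=
  (Equiv.ofBijective toSpecC ⟨toSpecC_injective, toSpecC_surjective⟩).symm

lemma specCEquiv_toSpecC (φ : B →ₐ[ℂ] 𝒪 T) : specCEquiv B T (toSpecC φ) = φ :=
  (Equiv.ofBijective toSpecC ⟨toSpecC_injective, toSpecC_surjective⟩).symm_apply_apply φ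

lemma specCEquiv_comp (f : T' ⟶ T) (h : T ⟶ specC B) :
    specCEquiv B T' (f ≫ h) = (pullbackFun f).comp (specCEquiv B T h) := by
  obtain ⟨φ, rfl⟩ := toSpecC_surjective h
  rw [comp_toSpecC, specCEquiv_toSpecC, specCEquiv_toSpecC]

/-- The morphism of affine schemes attached to a homomorphism of algebras. -/
def specCMap (φ : B →ₐ[ℂ] B') : specC B' ⟶ specC B := toSpecC ((specCFun B').comp φ)

lemma toSpecC_comp_specCMap (ψ : B' →ₐ[ℂ] 𝒪 T) (φ : B →ₐ[ℂ] B') :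
    toSpecC ψ ≫ specCMap φ = toSpecC (ψ.comp φ) := by
  rw [specCMap, comp_toSpecC, ← AlgHom.comp_assoc]
  congr 2
  refine toSpecC_injective ?_
  rw [← comp_toSpecC, toSpecC_specCFun, Category.comp_id]

/-- The isomorphism of affine schemes attached to an isomorphism of algebras. -/
def specCIso (e : B ≃ₐ[ℂ] B') : specC B' ≅ specC B where
  hom := specCMap (e : B →ₐ[ℂ] B')
  inv := specCMap (e.symm : B' →ₐ[ℂ] B)
  hom_inv_id := by
    rw [specCMap, toSpecC_comp_specCMap, AlgHom.comp_assoc, AlgEquiv.comp_symm, AlgHom.comp_id,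
      toSpecC_specCFun]
  inv_hom_id := by
    rw [specCMap, toSpecC_comp_specCMap, AlgHom.comp_assoc, AlgEquiv.symm_comp, AlgHom.comp_id,
      toSpecC_specCFun]

/-- The structure sheaf of the big étale site. -/
def structurePresheaf : SchCᵒᵖ ⥤ Type where
  obj T := 𝒪 T.unop
  map f := TypeCat.ofHom (pullbackFun f.unop)
  map_id T := by
    ext x
    change pullbackFun (𝟙 T.unop) x = _
    rw [pullbackFun_id]
    rfl
  map_comp f g := by
    ext x
    change pullbackFun (g.unop ≫ f.unop) x = _
    rw [pullbackFun_comp]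
    rfl

lemma isSheaf_yoneda_etale (Y : SchC) : Presieve.IsSheaf etale (yoneda.obj Y) :=
  GrothendieckTopology.Subcanonical.isSheaf_of_isRepresentable _

/-- Functions are morphisms to the affine line Spec ℂ[X], and representable presheaves are sheaves.
-/
lemma isSheaf_structurePresheaf : Presieve.IsSheaf etale structurePresheaf := by
  refine Presieve.isSheaf_of_nat_equiv
    (fun T => (specCEquiv (Polynomial ℂ) T).trans
      { toFun := fun φ => φ Polynomial.X
        invFun := fun a => Polynomial.aeval a
        left_inv := fun φ => by ext; simp
        right_inv := fun a => by simp }) ?_ (isSheaf_yoneda_etale (specC (Polynomial ℂ)))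
  intro T T' f x
  change specCEquiv _ _ (f ≫ x) _ = pullbackFun f (specCEquiv _ _ x _)
  rw [specCEquiv_comp]
  rfl

/-- Functions which agree locally are equal. -/
lemma eq_of_pullbackFun_eq {T : SchC} {R : Sieve T} (hR : R ∈ etale T) {a b : 𝒪 T}
    (h : ∀ {U : SchC} (f : U ⟶ T), R f → pullbackFun f a = pullbackFun f b) : a = b := by
  refine Presieve.IsSeparatedFor.ext (isSheaf_structurePresheaf R hR).isSeparatedFor ?_
  intro U f hf
  exact h f hf

/-- Compatible families of functions can be glued. -/
lemma exists_pullbackFun_eq {T : SchC} {R : Sieve T} (hR : R ∈ etale T)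
    (a : ∀ {U : SchC} (f : U ⟶ T), R f → 𝒪 U)
    (h : ∀ {U V : SchC} (g : V ⟶ U) (f : U ⟶ T) (hf : R f),
      a (g ≫ f) (R.downward_closed hf g) = pullbackFun g (a f hf)) :
    ∃ b : 𝒪 T, ∀ {U : SchC} (f : U ⟶ T) (hf : R f), pullbackFun f b = a f hf := by
  obtain ⟨b, hb, -⟩ := isSheaf_structurePresheaf R hR (fun U f hf => a f hf)
    ((Presieve.compatible_iff_sieveCompatible _).2 fun _ _ f g hf => h g f hf)
  exact ⟨b, fun f hf => hb f hf⟩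

/-- Entries of the matrix and of its inverse are glued separately as functions. That the two glued
matrices are mutually inverse is then checked locally. -/
lemma isSheaf_GLn (n : ℕ) : Presieve.IsSheaf etale (GLn n ⋙ forget GrpCat) := by
  intro T R hR
  rw [← Presieve.isSeparatedFor_and_exists_isAmalgamation_iff_isSheafFor]
  refine ⟨?_, fun x hx => ?_⟩
  · intro x g g' hg hg'
    refine Units.ext (Matrix.ext fun i j => eq_of_pullbackFun_eq hR fun f hf => ?_)
    exact GL_apply_congr ((hg f hf).trans (hg' f hf).symm) i j
  · rw [Presieve.compatible_iff_sieveCompatible] at hx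
    have hx' {U V : SchC} (f : U ⟶ T) (g : V ⟶ U) (hf : R f) :
        (x (g ≫ f) (R.downward_closed hf g) : GL (Fin n) (𝒪 V)) =
          Matrix.GeneralLinearGroup.map (pullbackFun g).toRingHom (x f hf : GL (Fin n) (𝒪 U)) :=
      hx f g hf
    have h1 (i j : Fin n) := exists_pullbackFun_eq hR
      (fun {U} f hf => (x f hf : GL (Fin n) (𝒪 U)).val i j)
      (fun g f hf => GL_apply_congr (hx' f g hf) i j)
    have h2 (i j : Fin n) := exists_pullbackFun_eq hR
      (fun {U} f hf => (x f hf : GL (Fin n) (𝒪 U))⁻¹.val i j)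
      (fun g f hf => GL_apply_congr (congrArg (·⁻¹) (hx' f g hf)) i j)
    choose a ha using h1
    choose b hb using h2
    have ha' {U : SchC} (f : U ⟶ T) (hf : R f) : (pullbackFun f).mapMatrix (Matrix.of a) =
        (x f hf : GL (Fin n) (𝒪 U)).val := Matrix.ext fun i j => ha i j f hf
    have hb' {U : SchC} (f : U ⟶ T) (hf : R f) : (pullbackFun f).mapMatrix (Matrix.of b) =
        (x f hf : GL (Fin n) (𝒪 U))⁻¹.val := Matrix.ext fun i j => hb i j f hf
    refine ⟨(⟨Matrix.of a, Matrix.of b, ?_, ?_⟩ : GL (Fin n) (𝒪 T)), ?_⟩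
    · ext i j
      refine eq_of_pullbackFun_eq hR fun f hf => ?_
      change (pullbackFun f).mapMatrix _ i j = (pullbackFun f).mapMatrix _ i j
      rw [map_mul, ha' f hf, hb' f hf, map_one]
      exact congrFun (congrFun (Units.mul_inv (x f hf : GL (Fin n) (𝒪 _))) i) j
    · ext i j
      refine eq_of_pullbackFun_eq hR fun f hf => ?_
      change (pullbackFun f).mapMatrix _ i j = (pullbackFun f).mapMatrix _ i j
      rw [map_mul, ha' f hf, hb' f hf, map_one]
      exact congrFun (congrFun (Units.inv_mul (x f hf : GL (Fin n) (𝒪 _))) i) j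
    · intro U f hf
      exact Units.ext (ha' f hf)

/-- The presheaf is represented by the spectrum of `RepRing`, through the universal point. -/
lemma isSheaf_repSpace (r n d : ℕ) : Presieve.IsSheaf etale (repSpace r n d).space := by
  refine Presieve.isSheaf_of_nat_equiv
    (fun T => (specCEquiv (RepRing r n d) T).trans
      { toFun := fun φ => (univPoint r n d).map φ
        invFun := fun x => x.eval
        left_inv := fun φ => by
          change ((univPoint r n d).map φ).eval = φ
          rw [RepPoint.eval_map, eval_univPoint, AlgHom.comp_id]
        right_inv := fun x => univPoint_map_eval x }) ?_
    (isSheaf_yoneda_etale (specC (RepRing r n d)))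
  intro T T' f x
  change (univPoint r n d).map (specCEquiv _ _ (f ≫ x)) =
    ((univPoint r n d).map (specCEquiv _ _ x)).map (pullbackFun f)
  rw [specCEquiv_comp, RepPoint.map_comp]

end EtaleSite

/-! ### From étale algebras over Γ(T, 𝒪_T) to étale coverings of T -/

section EtaleCover

open Limits

variable {B B' : Type} [CommRing B] [Algebra ℂ B] [CommRing B'] [Algebra ℂ B'] {T : SchC}

lemma specCMap_left (φ : B →ₐ[ℂ] B') :
    (specCMap φ).left = Spec.map (CommRingCat.ofHom φ.toRingHom) := by
  have h : (Spec (CommRingCat.of B')).toSpecΓ ≫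
      Spec.map (CommRingCat.ofHom φ.toRingHom ≫ (Scheme.ΓSpecIso (CommRingCat.of B')).inv) =
      Spec.map (CommRingCat.ofHom φ.toRingHom) := by
    rw [Spec.map_comp, toSpecΓ_SpecMap_ΓSpecIso_inv_assoc]
  exact h

lemma toSpecC_specCEquiv (f : T ⟶ specC B) : toSpecC (specCEquiv B T f) = f :=
  (specCEquiv B T).symm_apply_apply f

/-- A sieve on a scheme over `ℂ` is covering if every point lifts to an étale morphism in it. -/
lemma mem_etale_of_forall_point {T : SchC} {R : Sieve T}
    (h : ∀ x : T.left, ∃ (U : SchC) (f : U ⟶ T) (y : U.left), R f ∧ Etale f.left ∧ f.left y = x) :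
    R ∈ etale T := by
  refine (GrothendieckTopology.mem_over_iff _ _).2
    ((Scheme.mem_grothendieckTopology_iff (P := @Etale)).2 ?_)
  choose U f y hR hf hy using h
  refine ⟨Scheme.Cover.mkOfCovers T.left (fun x => (U x).left) (fun x => (f x).left)
    (fun x => ⟨x, y x, hy x⟩) hf, ?_⟩
  rintro _ _ ⟨x⟩
  rw [Sieve.overEquiv_iff]
  have h1 : (Over.homMk (f x).left : Over.mk ((f x).left ≫ T.hom) ⟶ T) =
      (Over.homMk (𝟙 _) (by simp) : Over.mk ((f x).left ≫ T.hom) ⟶ U x) ≫ f x := by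
    refine Over.OverMorphism.ext ?_
    simp
  change R.arrows (Over.homMk (f x).left : Over.mk ((f x).left ≫ T.hom) ⟶ T)
  rw [h1]
  exact R.downward_closed (hR x) _

/-- A property of algebras over `Γ(T, 𝒪_T)` which holds étale locally holds on the members of an
étale covering of `T`. -/
lemma EtaleLocally.exists_mem_etale {T : SchC}
    {P : ∀ (S : Type) [CommRing S] [Algebra ℂ S], (𝒪 T →ₐ[ℂ] S) → Prop}
    (h : EtaleLocally (𝒪 T) P) :
    ∃ R ∈ etale T, ∀ (U : SchC) (f : U ⟶ T), R f →
      ∃ (S : Type) (_ : CommRing S) (_ : Algebra ℂ S) (φ : 𝒪 T →ₐ[ℂ] S) (ψ : S →ₐ[ℂ] 𝒪 U),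
        P S φ ∧ ψ.comp φ = pullbackFun f := by
  let R : Sieve T :=
    { arrows := fun U f => ∃ (S : Type) (_ : CommRing S) (_ : Algebra ℂ S) (φ : 𝒪 T →ₐ[ℂ] S)
        (ψ : S →ₐ[ℂ] 𝒪 U), P S φ ∧ ψ.comp φ = pullbackFun f
      downward_closed := by
        rintro U V f ⟨S, _, _, φ, ψ, hP, hψ⟩ g
        refine ⟨S, _, _, φ, (pullbackFun g).comp ψ, hP, ?_⟩
        rw [AlgHom.comp_assoc, hψ, ← pullbackFun_comp] }
  refine ⟨R, mem_etale_of_forall_point fun x => ?_, fun U f hf => hf⟩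
  -- A geometric point of T above x induces one of Spec Γ(T, 𝒪_T), to which the hypothesis applies.
  let K := AlgebraicClosure (T.left.residueField x)
  let k : Spec (CommRingCat.of K) ⟶ T.left :=
    Spec.map (CommRingCat.ofHom (algebraMap (T.left.residueField x) K)) ≫
      T.left.fromSpecResidueField x
  obtain ⟨S, _, _, φ, ψ, hφ, hψ, hP⟩ :=
    h K (k.appTop ≫ (Scheme.ΓSpecIso (CommRingCat.of K)).hom).hom
  let t : T ⟶ specC (𝒪 T) := toSpecC (AlgHom.id ℂ _)
  have ht : t.left = T.left.toSpecΓ := by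
    refine (toSpecC_left _).trans ?_
    exact (congrArg (T.left.toSpecΓ ≫ ·) (Spec.map_id _)).trans (Category.comp_id _)
  have hs : (specCMap φ).left = Spec.map (CommRingCat.ofHom φ.toRingHom) := specCMap_left φ
  have hse : Etale (specCMap φ).left := by
    rw [hs]
    exact (HasRingHomProperty.Spec_iff (P := @Etale)).2 hφ
  -- T need not be affine, so Spec S is pulled back along T → Spec Γ(T, 𝒪_T). The base change is
  -- étale over T, and the geometric point and its lift together give a point of it above x.
  let W : SchC := Over.mk (pullback.fst t.left (specCMap φ).left ≫ T.hom)
  let w : W ⟶ T := Over.homMk (pullback.fst t.left (specCMap φ).left)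
  let m : W ⟶ specC S := Over.homMk (pullback.snd t.left (specCMap φ).left) <| by
    rw [← Over.w (specCMap φ), ← pullback.condition_assoc, Over.w t]
    rfl
  have hw : Etale w.left := inferInstanceAs (Etale (pullback.fst t.left (specCMap φ).left))
  have hk : k ≫ t.left = Spec.map (CommRingCat.ofHom ψ) ≫ (specCMap φ).left := by
    rw [ht, hs]
    refine (Scheme.toSpecΓ_naturality k).trans ?_
    rw [← SpecMap_ΓSpecIso_hom, ← Spec.map_comp]
    refine Eq.trans ?_ (Spec.map_comp _ _)
    congr 1
    exact (CommRingCat.hom_ext hψ).symm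
  refine ⟨W, w, pullback.lift k _ hk (IsLocalRing.closedPoint K),
    ⟨S, _, _, φ, specCEquiv S W m, hP, ?_⟩, hw, ?_⟩
  · refine toSpecC_injective ?_
    rw [← toSpecC_comp_specCMap, toSpecC_specCEquiv, ← AlgHom.comp_id (pullbackFun w),
      ← comp_toSpecC]
    exact Over.OverMorphism.ext pullback.condition.symm
  · refine Eq.trans ?_ (Scheme.fromSpecResidueField_apply x (Spec.map (CommRingCat.ofHom
      (algebraMap (T.left.residueField x) K)) (IsLocalRing.closedPoint K)))
    exact congrArg (fun f : Spec (CommRingCat.of K) ⟶ T.left => f (IsLocalRing.closedPoint K))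
      (pullback.lift_fst (f := t.left) (g := (specCMap φ).left) k _ hk)

end EtaleCover

/-! ### Sections of torsors -/

section TorsorSections

variable {C : Type 1} [Category.{0} C] {J : GrothendieckTopology C} {G : Cᵒᵖ ⥤ GrpCat.{0}}

/-- Morphisms which agree locally are equal. -/
lemma hom_ext_of_mem [J.Subcanonical] {T Y : C} {R : Sieve T} (hR : R ∈ J T) {a b : T ⟶ Y}
    (h : ∀ {U : C} (f : U ⟶ T), R f → f ≫ a = f ≫ b) : a = b :=
  ((GrothendieckTopology.Subcanonical.isSheaf_of_isRepresentable (J := J)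
    (yoneda.obj Y)) R hR).isSeparatedFor.ext fun _ f hf => h f hf

/-- Compatible morphisms can be glued. -/
lemma exists_hom_glue [J.Subcanonical] {T Y : C} {R : Sieve T} (hR : R ∈ J T)
    (a : ∀ {U : C} (f : U ⟶ T), R f → (U ⟶ Y))
    (h : ∀ {U V : C} (g : V ⟶ U) (f : U ⟶ T) (hf : R f),
      a (g ≫ f) (R.downward_closed hf g) = g ≫ a f hf) :
    ∃ b : T ⟶ Y, ∀ {U : C} (f : U ⟶ T) (hf : R f), f ≫ b = a f hf := by
  obtain ⟨b, hb, -⟩ := (GrothendieckTopology.Subcanonical.isSheaf_of_isRepresentable (J := J)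
    (yoneda.obj Y)) R hR (fun U f hf => a f hf)
    ((Presieve.compatible_iff_sieveCompatible _).2 fun _ _ f g hf => h g f hf)
  exact ⟨b, fun f hf => hb f hf⟩

lemma GSpace.res_comp (P : GSpace.{0, 1} G) {T U V : C} (f : U ⟶ T) (g : V ⟶ U)
    (x : P.space.obj (op T)) : P.space.map (g ≫ f).op x = P.space.map g.op (P.space.map f.op x) := by
  rw [op_comp, P.space.map_comp]
  rfl

lemma GSpace.res_id (P : GSpace.{0, 1} G) {T : C} (x : P.space.obj (op T)) :
    P.space.map (𝟙 T).op x = x := by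
  rw [op_id, P.space.map_id]
  rfl

variable {S : C} (P : Torsor.{0, 1} J G S)

/-- Sections of a torsor which agree locally are equal. -/
lemma Torsor.ext_of_mem {T : C} {R : Sieve T} (hR : R ∈ J T) {x y : P.P.space.obj (op T)}
    (h : ∀ {U : C} (f : U ⟶ T), R f → P.P.space.map f.op x = P.P.space.map f.op y) : x = y :=
  (P.isSheaf R hR).isSeparatedFor.ext fun _ f hf => h f hf

/-- Compatible sections of a torsor can be glued. -/
lemma Torsor.exists_glue {T : C} {R : Sieve T} (hR : R ∈ J T)
    (a : ∀ {U : C} (f : U ⟶ T), R f → P.P.space.obj (op U))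
    (h : ∀ {U V : C} (g : V ⟶ U) (f : U ⟶ T) (hf : R f),
      a (g ≫ f) (R.downward_closed hf g) = P.P.space.map g.op (a f hf)) :
    ∃ b : P.P.space.obj (op T), ∀ {U : C} (f : U ⟶ T) (hf : R f),
      P.P.space.map f.op b = a f hf := by
  obtain ⟨b, hb, -⟩ := P.isSheaf R hR (fun U f hf => a f hf)
    ((Presieve.compatible_iff_sieveCompatible _).2 fun _ _ f g hf => h g f hf)
  exact ⟨b, fun f hf => hb f hf⟩

lemma Torsor.π_res {T U : C} (f : U ⟶ T) (x : P.P.space.obj (op T)) :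
    P.π (op U) (P.P.space.map f.op x) = f ≫ P.π (op T) x :=
  P.π_naturality f.op x

/-- Torsors have sections locally over every morphism to the base. -/
lemma Torsor.exists_local_section {T : C} (b : T ⟶ S) : ∃ R ∈ J T, ∀ (U : C) (f : U ⟶ T), R f →
    ∃ x : P.P.space.obj (op U), P.π _ x = f ≫ b := by
  obtain ⟨R, hR, h⟩ := P.locally_trivial
  exact ⟨R.pullback b, J.pullback_stable b hR, fun U f hf => h U (f ≫ b) hf⟩

/-- The structure group of a torsor acts freely. -/
lemma Torsor.smul_left_injective {T : C} {x : P.P.space.obj (op T)} {g g' : G.obj (op T)}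
    (h : g • x = g' • x) : g = g' :=
  (P.simply_transitive (op T) x (g' • x) (P.π_smul _ _ _).symm).unique h rfl

end TorsorSections

/-! ### Lifting, pullback and gluing of morphisms in a quotient stack -/

section QuotientStackMorphisms

variable {C : Type 1} [Category.{0} C] {J : GrothendieckTopology C} {G : Cᵒᵖ ⥤ GrpCat.{0}}
  {X : GSpace.{0, 0} G}

namespace QuotientStack

/-- The sections over `T` of the torsor of an object of the quotient stack. -/
abbrev sections (ξ : QuotientStack.{0, 1} J X) (T : C) : Type 1 := ξ.torsor.P.space.obj (op T)

/-- The map on sections given by a morphism of the quotient stack. -/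
abbrev Hom.onSections {ξ η : QuotientStack.{0, 1} J X} (φ : ξ ⟶ η) {T : C} (x : ξ.sections T) :
    η.sections T := φ.map.app (op T) x

variable {ξ η θ : QuotientStack.{0, 1} J X}

lemma hom_ext {φ ψ : ξ ⟶ η} (hb : φ.base = ψ.base)
    (h : ∀ (T : C) (x : ξ.sections T), Hom.onSections φ x = Hom.onSections ψ x) : φ = ψ :=
  Hom.ext hb (GSpace.Hom.ext (funext fun T => funext fun x => h T.unop x))

lemma comp_onSections (φ : ξ ⟶ η) (ψ : η ⟶ θ) {T : C} (x : ξ.sections T) :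
    Hom.onSections (φ ≫ ψ) x = Hom.onSections ψ (Hom.onSections φ x) := rfl

lemma comp_base (φ : ξ ⟶ η) (ψ : η ⟶ θ) : (φ ≫ ψ).base = φ.base ≫ ψ.base := rfl

lemma onSections_res (φ : ξ ⟶ η) {T U : C} (f : U ⟶ T) (x : ξ.sections T) :
    Hom.onSections φ (ξ.torsor.P.space.map f.op x) =
      η.torsor.P.space.map f.op (Hom.onSections φ x) := φ.map.naturality f.op x

lemma onSections_smul (φ : ξ ⟶ η) {T : C} (g : G.obj (op T)) (x : ξ.sections T) :
    Hom.onSections φ (g • x) = g • Hom.onSections φ x := φ.map.equivariant _ g x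

lemma π_onSections (φ : ξ ⟶ η) {T : C} (x : ξ.sections T) :
    η.torsor.π (op T) (Hom.onSections φ x) = ξ.torsor.π (op T) x ≫ φ.base := φ.comm_π _ x

lemma toX_onSections (φ : ξ ⟶ η) {T : C} (x : ξ.sections T) :
    η.toX.app (op T) (Hom.onSections φ x) = ξ.toX.app (op T) x := φ.comm_toX _ x

/-- A morphism of the quotient stack is injective on the sections over a given morphism to the
base. -/
lemma onSections_injective (φ : ξ ⟶ η) {T : C} {x y : ξ.sections T}
    (hπ : ξ.torsor.π (op T) x = ξ.torsor.π (op T) y)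
    (h : Hom.onSections φ x = Hom.onSections φ y) : x = y := by
  obtain ⟨g, rfl, -⟩ := ξ.torsor.simply_transitive _ x y hπ
  have h1 : (1 : G.obj (op T)) • Hom.onSections φ x = g • Hom.onSections φ x := by
    rw [one_smul, ← onSections_smul]
    exact h
  rw [← η.torsor.smul_left_injective h1, one_smul]

/-- Sections lift uniquely along morphisms of the quotient stack. -/
lemma exists_section_lift [J.Subcanonical] (φ : ξ ⟶ η) {T : C} (b : T ⟶ ξ.base) (y : η.sections T)
    (h : η.torsor.π (op T) y = b ≫ φ.base) :
    ∃ x : ξ.sections T, ξ.torsor.π (op T) x = b ∧ Hom.onSections φ x = y := by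
  obtain ⟨R, hR, hsec⟩ := ξ.torsor.exists_local_section b
  -- Local sections of ξ can be corrected by the group so that they hit y. The correction is unique
  -- by `onSections_injective`, so the local lifts glue.
  have key {U : C} (f : U ⟶ T) (hf : R f) : ∃ x : ξ.sections U,
      ξ.torsor.π (op U) x = f ≫ b ∧ Hom.onSections φ x = η.torsor.P.space.map f.op y := by
    obtain ⟨x, hx⟩ := hsec U f hf
    obtain ⟨g, hg, -⟩ := η.torsor.simply_transitive _ (Hom.onSections φ x)
      (η.torsor.P.space.map f.op y) (by
        rw [π_onSections, hx, Torsor.π_res, h, Category.assoc])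
    exact ⟨g • x, by rw [ξ.torsor.π_smul, hx], by rw [onSections_smul, hg]⟩
  choose a ha1 ha2 using @key
  obtain ⟨x, hx⟩ := ξ.torsor.exists_glue hR (fun f hf => a f hf) fun g f hf =>
    onSections_injective φ (by rw [ha1, Torsor.π_res, ha1, Category.assoc])
      (by rw [ha2, onSections_res, ha2, GSpace.res_comp])
  refine ⟨x, ?_, ?_⟩
  · refine hom_ext_of_mem hR fun f hf => ?_
    rw [← Torsor.π_res, hx f hf, ha1]
  · refine η.torsor.ext_of_mem hR fun f hf => ?_
    rw [← onSections_res, hx f hf, ha2]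

/-- The morphism of the quotient stack with given base and given maps on sections. -/
def homMk (u : ξ.base ⟶ η.base) (V : ∀ {T : C}, ξ.sections T → η.sections T)
    (hπ : ∀ {T : C} (x : ξ.sections T), η.torsor.π (op T) (V x) = ξ.torsor.π (op T) x ≫ u)
    (hX : ∀ {T : C} (x : ξ.sections T), η.toX.app (op T) (V x) = ξ.toX.app (op T) x)
    (hres : ∀ {T U : C} (f : U ⟶ T) (x : ξ.sections T),
      V (ξ.torsor.P.space.map f.op x) = η.torsor.P.space.map f.op (V x))
    (hsmul : ∀ {T : C} (g : G.obj (op T)) (x : ξ.sections T), V (g • x) = g • V x) : ξ ⟶ η where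
  base := u
  map := ⟨fun T => V (T := T.unop), fun f x => hres f.unop x, fun _ g x => hsmul g x⟩
  comm_π := fun _ x => hπ x
  comm_toX := fun _ x => hX x

/-- Morphisms with the same base are equal if they are so after composition with a morphism. -/
lemma hom_ext_of_comp (φ : ξ ⟶ η) {χ χ' : θ ⟶ ξ} (hb : χ.base = χ'.base) (h : χ ≫ φ = χ' ≫ φ) :
    χ = χ' :=
  hom_ext hb fun T x => onSections_injective φ (by rw [π_onSections, π_onSections, hb]) (by
    rw [← comp_onSections, h, comp_onSections])

/-- Morphisms lift along morphisms of the quotient stack if their bases do. -/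
lemma exists_hom_lift [J.Subcanonical] (φ : ξ ⟶ η) (φ' : θ ⟶ η) (g : θ.base ⟶ ξ.base)
    (h : g ≫ φ.base = φ'.base) : ∃ χ : θ ⟶ ξ, χ.base = g ∧ χ ≫ φ = φ' := by
  choose χ hχ1 hχ2 using fun (T : C) (x : θ.sections T) =>
    exists_section_lift φ (θ.torsor.π (op T) x ≫ g) (Hom.onSections φ' x) (by
      rw [π_onSections, ← h, Category.assoc])
  refine ⟨homMk g (χ _) (hχ1 _) (fun {T} x => ?_) (fun {T U} f x => ?_) (fun {T} a x => ?_), rfl,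
    hom_ext h hχ2⟩
  · rw [← toX_onSections φ' x, ← hχ2, toX_onSections]
  · refine onSections_injective φ ?_ ?_
    · rw [hχ1, Torsor.π_res, Torsor.π_res, hχ1, Category.assoc]
    · rw [hχ2, onSections_res, onSections_res, hχ2]
  · refine onSections_injective φ ?_ ?_
    · rw [hχ1, ξ.torsor.π_smul, hχ1, θ.torsor.π_smul]
    · rw [hχ2, onSections_smul, onSections_smul, hχ2]

/-- Every morphism of the quotient stack is strongly cartesian. -/
lemma isStronglyCartesian [J.Subcanonical] (φ : ξ ⟶ η) {b : ξ.base ⟶ η.base} (hb : φ.base = b) :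
    (proj J X).IsStronglyCartesian (R := ξ.base) (S := η.base) b φ := by
  subst hb
  have : (proj J X).IsHomLift (R := ξ.base) (S := η.base) φ.base φ := .map φ
  refine { universal_property' := ?_ }
  intro θ g φ' hφ'
  obtain ⟨χ, rfl, hχ⟩ := exists_hom_lift φ φ' g
    (@IsHomLift.eq_of_isHomLift _ _ _ _ (proj J X) θ η (g ≫ φ.base) φ' hφ')
  refine ⟨χ, ⟨.map χ, hχ⟩, ?_⟩
  rintro χ' ⟨hlift, h⟩
  exact hom_ext_of_comp φ (@IsHomLift.eq_of_isHomLift _ _ _ _ (proj J X) θ ξ _ χ' hlift).symm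
    (h.trans hχ.symm)

/-- The sections of the pullback of a torsor along a morphism of the bases. -/
def pullbackSpace (ξ : QuotientStack.{0, 1} J X) {S' : C} (f : S' ⟶ ξ.base) : GSpace.{0, 1} G where
  space :=
    { obj := fun T => {z : (T.unop ⟶ S') × ξ.torsor.P.space.obj T // ξ.torsor.π T z.2 = z.1 ≫ f}
      map := fun h => TypeCat.ofHom fun z => ⟨(h.unop ≫ z.1.1, ξ.torsor.P.space.map h z.1.2),
        by rw [ξ.torsor.π_naturality, z.2, Category.assoc]⟩
      map_id := fun T => by
        refine ConcreteCategory.hom_ext _ _ fun z => Subtype.ext (Prod.ext (Category.id_comp _) ?_)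
        exact ξ.torsor.P.res_id (T := T.unop) z.1.2
      map_comp := fun h k => by
        refine ConcreteCategory.hom_ext _ _ fun z => Subtype.ext (Prod.ext (Category.assoc _ _ _) ?_)
        exact ξ.torsor.P.res_comp h.unop k.unop z.1.2 }
  action := fun T =>
    { smul := fun g z => ⟨(z.1.1, g • z.1.2), by rw [ξ.torsor.π_smul, z.2]⟩
      one_smul := fun z => Subtype.ext (Prod.ext rfl (one_smul _ _))
      mul_smul := fun g h z => Subtype.ext (Prod.ext rfl (mul_smul _ _ _)) }
  map_smul := fun h g z => Subtype.ext (Prod.ext rfl (ξ.torsor.P.map_smul h g z.1.2))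

lemma isSheaf_pullbackSpace [J.Subcanonical] (ξ : QuotientStack.{0, 1} J X) {S' : C}
    (f : S' ⟶ ξ.base) : Presieve.IsSheaf J (ξ.pullbackSpace f).space := by
  intro T R hR a ha
  rw [Presieve.compatible_iff_sieveCompatible] at ha
  obtain ⟨c, hc⟩ := exists_hom_glue hR (fun h hh => (a h hh).1.1) fun g h hh =>
    congrArg (fun z => z.1.1) (ha _ g hh)
  obtain ⟨x, hx⟩ := ξ.torsor.exists_glue hR (fun h hh => (a h hh).1.2) fun g h hh =>
    congrArg (fun z => z.1.2) (ha _ g hh)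
  refine ⟨⟨(c, x), hom_ext_of_mem hR fun h hh => ?_⟩,
    fun U h hh => Subtype.ext (Prod.ext (hc h hh) (hx h hh)), ?_⟩
  · rw [← Torsor.π_res, hx h hh, (a h hh).2, ← hc h hh, Category.assoc]
  · intro z hz
    refine Subtype.ext (Prod.ext (hom_ext_of_mem hR fun h hh => ?_)
      (ξ.torsor.ext_of_mem hR fun h hh => ?_))
    · exact (congrArg (fun z => z.1.1) (hz h hh)).trans (hc h hh).symm
    · exact (congrArg (fun z => z.1.2) (hz h hh)).trans (hx h hh).symm

/-- The pullback of a torsor with an equivariant morphism to `X` along a morphism of the bases. -/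
def pullback [J.Subcanonical] (ξ : QuotientStack.{0, 1} J X) {S' : C} (f : S' ⟶ ξ.base) :
    QuotientStack.{0, 1} J X where
  base := S'
  torsor :=
    { P := ξ.pullbackSpace f
      isSheaf := ξ.isSheaf_pullbackSpace f
      π := fun T z => z.1.1
      π_naturality := fun h z => rfl
      π_smul := fun T g z => rfl
      simply_transitive := fun T y z hyz => by
        obtain ⟨g, hg, hg'⟩ := ξ.torsor.simply_transitive T y.1.2 z.1.2 (by
          rw [y.2, z.2]; exact congrArg (· ≫ f) hyz)
        exact ⟨g, Subtype.ext (Prod.ext hyz hg), fun h hh => hg' h (congrArg (fun z => z.1.2) hh)⟩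
      locally_trivial := by
        obtain ⟨R, hR, h⟩ := ξ.torsor.exists_local_section f
        refine ⟨R, hR, fun U k hk => ?_⟩
        obtain ⟨x, hx⟩ := h U k hk
        exact ⟨⟨(k, x), hx⟩, rfl⟩ }
  toX :=
    { app := fun T z => ξ.toX.app T z.1.2
      naturality := fun h z => ξ.toX.naturality h z.1.2
      equivariant := fun T g z => ξ.toX.equivariant T g z.1.2 }

/-- The projection from the pullback. -/
def pullbackMap [J.Subcanonical] (ξ : QuotientStack.{0, 1} J X) {S' : C} (f : S' ⟶ ξ.base) :
    ξ.pullback f ⟶ ξ where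
  base := f
  map := ⟨fun _ z => z.1.2, fun _ _ => rfl, fun _ _ _ => rfl⟩
  comm_π := fun _ z => z.2
  comm_toX := fun _ _ => rfl

variable (J X) in
lemma isFibered_proj [J.Subcanonical] : (proj.{0, 1} J X).IsFibered :=
  .of_exists_isStronglyCartesian fun ξ _ f =>
    ⟨ξ.pullback f, ξ.pullbackMap f, isStronglyCartesian _ rfl⟩

/-- A morphism of the quotient stack can be defined on the sections lying over a covering sieve
of the base. -/
lemma exists_hom_of_local [J.Subcanonical] (hX : Presieve.IsSeparated J X.space)
    (u : ξ.base ⟶ η.base) {R : Sieve ξ.base} (hR : R ∈ J ξ.base)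
    (V : ∀ {T : C} (x : ξ.sections T), R (ξ.torsor.π (op T) x) → η.sections T)
    (hπ : ∀ {T : C} (x : ξ.sections T) (h), η.torsor.π (op T) (V x h) = ξ.torsor.π (op T) x ≫ u)
    (hX' : ∀ {T : C} (x : ξ.sections T) (h), η.toX.app (op T) (V x h) = ξ.toX.app (op T) x)
    (hres : ∀ {T U : C} (f : U ⟶ T) (x : ξ.sections T) (h) (h'),
      V (ξ.torsor.P.space.map f.op x) h' = η.torsor.P.space.map f.op (V x h))
    (hsmul : ∀ {T : C} (g : G.obj (op T)) (x : ξ.sections T) (h) (h'),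
      V (g • x) h' = g • V x h) :
    ∃ Ψ : ξ ⟶ η, Ψ.base = u ∧
      ∀ {T : C} (x : ξ.sections T) (h), Hom.onSections Ψ x = V x h := by
  have hR' {T : C} (x : ξ.sections T) : R.pullback (ξ.torsor.π (op T) x) ∈ J T :=
    J.pullback_stable _ hR
  have hmem {T U : C} (x : ξ.sections T) (f : U ⟶ T) (hf : R.pullback (ξ.torsor.π (op T) x) f) :
      R (ξ.torsor.π (op U) (ξ.torsor.P.space.map f.op x)) := by
    rw [Torsor.π_res]; exact hf
  have hV {T : C} {x y : ξ.sections T} (hxy : x = y) (h) (h') : V x h = V y h' := by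
    subst hxy; rfl
  -- Restrictions of x along the pulled-back sieve lie over R, where V is defined; their images are
  -- compatible and glue in the sheaf η.
  have key {T : C} (x : ξ.sections T) : ∃ y : η.sections T, ∀ {U : C} (f : U ⟶ T)
      (hf : R.pullback (ξ.torsor.π (op T) x) f),
      η.torsor.P.space.map f.op y = V (ξ.torsor.P.space.map f.op x) (hmem x f hf) := by
    refine η.torsor.exists_glue (hR' x) (fun f hf => V _ (hmem x f hf)) fun g f hf => ?_
    have h2 := hmem x (g ≫ f) ((R.pullback _).downward_closed hf g)
    rw [GSpace.res_comp] at h2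
    exact (hV (ξ.torsor.P.res_comp f g x) _ h2).trans (hres _ _ _ _)
  choose Y hY using @key
  refine ⟨homMk u Y (fun {T} x => ?_) (fun {T} x => ?_) (fun {T U} f x => ?_)
    (fun {T} g x => ?_), rfl, fun {T} x h => ?_⟩
  · refine hom_ext_of_mem (hR' x) fun k hk => ?_
    rw [← Torsor.π_res, hY x k hk, hπ, Torsor.π_res, Category.assoc]
  · refine (hX (R.pullback (ξ.torsor.π (op T) x)) (hR' x)).ext fun U k hk => ?_
    rw [← η.toX.naturality, ← ξ.toX.naturality, hY x k hk, hX']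
  · refine η.torsor.ext_of_mem (hR' (ξ.torsor.P.space.map f.op x)) fun k hk => ?_
    have h1 : R.pullback (ξ.torsor.π (op T) x) (k ≫ f) := by
      rw [Sieve.pullback_apply] at hk ⊢
      rwa [Category.assoc, ← Torsor.π_res]
    rw [hY _ k hk]
    refine Eq.trans ?_ (η.torsor.P.res_comp f k (Y x))
    rw [hY x _ h1]
    exact hV (ξ.torsor.P.res_comp f k x).symm _ _
  · have hk' {U : C} (k : U ⟶ T) (hk : R.pullback (ξ.torsor.π (op T) (g • x)) k) :
      R.pullback (ξ.torsor.π (op T) x) k := by rwa [ξ.torsor.π_smul] at hk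
    refine η.torsor.ext_of_mem (hR' (g • x)) fun k hk => ?_
    rw [hY _ k hk, η.torsor.P.map_smul, hY x k (hk' k hk)]
    have h2 := hmem _ k hk
    rw [ξ.torsor.P.map_smul] at h2
    exact (hV (ξ.torsor.P.map_smul k.op g x) _ h2).trans (hsmul _ _ _ _)
  · refine η.torsor.ext_of_mem (hR' x) fun k hk => ?_
    exact (hY x k hk).trans (hres _ _ _ _)

/-- The tautological section of the pullback of a torsor along the image of a section. -/
def tautSection [J.Subcanonical] (ξ : QuotientStack.{0, 1} J X) {T : C} (x : ξ.sections T) :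
    (ξ.pullback (ξ.torsor.π (op T) x)).sections T :=
  ⟨(𝟙 T, x), (Category.id_comp _).symm⟩

lemma pullbackMap_tautSection [J.Subcanonical] {T : C} (x : ξ.sections T) :
    Hom.onSections (ξ.pullbackMap (ξ.torsor.π (op T) x)) (ξ.tautSection x) = x := rfl

lemma π_tautSection [J.Subcanonical] {T : C} (x : ξ.sections T) :
    (ξ.pullback (ξ.torsor.π (op T) x)).torsor.π (op T) (ξ.tautSection x) = 𝟙 T := rfl

/-- Morphisms of the quotient stack glue. -/
lemma exists_unique_hom_glue [J.Subcanonical] (hX : Presieve.IsSeparated J X.space)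
    (u : ξ.base ⟶ η.base) {R : Sieve ξ.base} (hR : R ∈ J ξ.base)
    (ψ : ∀ {θ : QuotientStack.{0, 1} J X} (φ : θ ⟶ ξ), R φ.base → (θ ⟶ η))
    (hψ : ∀ {θ : QuotientStack.{0, 1} J X} (φ : θ ⟶ ξ) (h : R φ.base), (ψ φ h).base = φ.base ≫ u)
    (hψ' : ∀ {θ' θ : QuotientStack.{0, 1} J X} (χ : θ' ⟶ θ) (φ : θ ⟶ ξ) (h : R φ.base)
      (h' : R (χ ≫ φ).base), ψ (χ ≫ φ) h' = χ ≫ ψ φ h) :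
    ∃! Ψ : ξ ⟶ η, Ψ.base = u ∧
      ∀ {θ : QuotientStack.{0, 1} J X} (φ : θ ⟶ ξ) (h : R φ.base), φ ≫ Ψ = ψ φ h := by
  -- A section x is the image of the tautological section of the pullback of ξ along π(x).
  -- Evaluating there turns a family of morphisms into a map on sections.
  let V {T : C} (x : ξ.sections T) (h : R (ξ.torsor.π (op T) x)) : η.sections T :=
    Hom.onSections (ψ (ξ.pullbackMap (ξ.torsor.π (op T) x)) h) (ξ.tautSection x)
  -- V may be computed through any φ along which x lifts: the pullback of ξ along π(x) factors
  -- through φ, and ψ is compatible with precomposition. Compatibility of V with restriction and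
  -- with the action follows.
  have key {θ : QuotientStack.{0, 1} J X} (φ : θ ⟶ ξ) (h : R φ.base) {T : C} (y : θ.sections T)
      {x : ξ.sections T} (hx : Hom.onSections φ y = x) (h') :
      V x h' = Hom.onSections (ψ φ h) y := by
    subst hx
    obtain ⟨χ, hχ, hχ'⟩ := exists_hom_lift φ
      (ξ.pullbackMap (ξ.torsor.π (op T) (Hom.onSections φ y))) (θ.torsor.π (op T) y)
      (π_onSections φ y).symm
    have h1 : Hom.onSections χ (ξ.tautSection (Hom.onSections φ y)) = y := by
      refine onSections_injective φ ?_ ?_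
      · rw [π_onSections, π_tautSection, hχ]
        exact Category.id_comp _
      · rw [← comp_onSections, hχ', pullbackMap_tautSection]
    have h2 : ψ (ξ.pullbackMap (ξ.torsor.π (op T) (Hom.onSections φ y))) h' = χ ≫ ψ φ h := by
      have h3 : R (χ ≫ φ).base := by rw [hχ']; exact h'
      rw [← hψ' χ φ h h3]
      congr 1
      exact hχ'.symm
    change Hom.onSections (ψ _ _) _ = _
    rw [h2, comp_onSections, h1]
  obtain ⟨Ψ, hΨ, hΨ'⟩ := exists_hom_of_local hX u hR V
    (fun {T} x h => by
      refine (π_onSections _ _).trans ((congrArg (𝟙 T ≫ ·) (hψ _ h)).trans (Category.id_comp _)))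
    (fun {T} x h => (toX_onSections _ _).trans rfl)
    (fun {T U} f x h h' => (key (ξ.pullbackMap (ξ.torsor.π (op T) x)) h
      ((ξ.pullback _).torsor.P.space.map f.op (ξ.tautSection x)) rfl h').trans
        (onSections_res _ _ _))
    (fun {T} g x h h' => (key (ξ.pullbackMap (ξ.torsor.π (op T) x)) h
      (g • ξ.tautSection x) rfl h').trans (onSections_smul _ _ _))
  refine ⟨Ψ, ⟨hΨ, fun {θ} φ h => hom_ext ?_ fun T y => ?_⟩, ?_⟩
  · rw [hψ, comp_base, hΨ]
  · have h' : R (ξ.torsor.π (op T) (Hom.onSections φ y)) := by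
      rw [π_onSections]
      exact R.downward_closed h _
    rw [comp_onSections, hΨ' _ h', key φ h y rfl]
  · rintro Ψ' ⟨hb, h⟩
    refine hom_ext (hb.trans hΨ.symm) fun T x => ?_
    refine η.torsor.ext_of_mem (J.pullback_stable (ξ.torsor.π (op T) x) hR) fun k hk => ?_
    have hk' : R (ξ.torsor.π _ (ξ.torsor.P.space.map k.op x)) := by
      rw [Torsor.π_res]; exact hk
    rw [← onSections_res, ← onSections_res, hΨ' _ hk']
    exact congrArg (fun φ => Hom.onSections φ (ξ.tautSection _)) (h (ξ.pullbackMap _) hk')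

end QuotientStack

end QuotientStackMorphisms

/-! ### Descent data in the quotient stack -/

namespace Descent

open QuotientStack

variable {C : Type 1} [Category.{0} C] {J : GrothendieckTopology C} {G : Cᵒᵖ ⥤ GrpCat.{0}}
  {X : GSpace.{0, 0} G} {S : C} {R : Sieve S}

/-- The domain of an arrow of a sieve. -/
abbrev dom (o : R.arrows.category) : C := o.obj.left

/-- An arrow of a sieve, as a morphism. -/
abbrev arr (o : R.arrows.category) : dom o ⟶ S := o.obj.hom

/-- An arrow of a sieve, as an object of the category of arrows. -/
abbrev mk {U : C} (b : U ⟶ S) (hb : R b) : R.arrows.category := Presieve.categoryMk R.arrows b hb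

/-- A morphism in the category of arrows of a sieve. -/
abbrev arrHom {o' o : R.arrows.category} (k : dom o' ⟶ dom o) (h : k ≫ arr o = arr o') : o' ⟶ o :=
  ObjectProperty.homMk (Over.homMk k h)

/-- The morphism of the domains given by a morphism in the category of arrows of a sieve. -/
abbrev left {o' o : R.arrows.category} (m : o' ⟶ o) : dom o' ⟶ dom o := m.hom.left

lemma left_arr {o' o : R.arrows.category} (m : o' ⟶ o) : left m ≫ arr o = arr o' :=
  Over.w m.hom

lemma arrHom_ext {o' o : R.arrows.category} {m m' : o' ⟶ o} (h : left m = left m') : m = m' :=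
  ObjectProperty.hom_ext _ (Over.OverMorphism.ext h)

variable {F : R.arrows.category ⥤ QuotientStack.{0, 1} J X} (α : F ⋙ proj J X ≅ R.arrows.diagram)

/-- The isomorphism of the base of the torsor at an arrow of the sieve with the domain of the
arrow. -/
def baseIso (o : R.arrows.category) : (F.obj o).base ≅ dom o := α.app o

lemma map_base_baseIso {o' o : R.arrows.category} (m : o' ⟶ o) :
    (F.map m).base ≫ (baseIso α o).hom = (baseIso α o').hom ≫ left m := α.hom.naturality m

/-- The image of a section of the torsor at an arrow of the sieve in the domain of the arrow. -/
def chart {o : R.arrows.category} {T : C} (p : (F.obj o).sections T) : T ⟶ dom o :=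
  (F.obj o).torsor.π (op T) p ≫ (baseIso α o).hom

lemma chart_map {o' o : R.arrows.category} (m : o' ⟶ o) {T : C} (p : (F.obj o').sections T) :
    chart α (Hom.onSections (F.map m) p) = chart α p ≫ left m := by
  rw [chart, π_onSections, Category.assoc, map_base_baseIso, chart, Category.assoc]

lemma chart_res {o : R.arrows.category} {T U : C} (f : U ⟶ T) (p : (F.obj o).sections T) :
    chart α ((F.obj o).torsor.P.space.map f.op p) = f ≫ chart α p := by
  rw [chart, Torsor.π_res, chart, Category.assoc]

lemma chart_smul {o : R.arrows.category} {T : C} (g : G.obj (op T)) (p : (F.obj o).sections T) :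
    chart α (g • p) = chart α p := by
  rw [chart, Torsor.π_smul, chart]

lemma π_eq_of_chart_eq {o : R.arrows.category} {T : C} {p q : (F.obj o).sections T}
    (h : chart α p = chart α q) : (F.obj o).torsor.π (op T) p = (F.obj o).torsor.π (op T) q :=
  (cancel_mono (baseIso α o).hom).1 h

lemma map_injective {o' o : R.arrows.category} (m : o' ⟶ o) {T : C} {p q : (F.obj o').sections T}
    (hc : chart α p = chart α q)
    (h : Hom.onSections (F.map m) p = Hom.onSections (F.map m) q) : p = q :=
  onSections_injective (F.map m) (π_eq_of_chart_eq α hc) h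

lemma exists_lift [J.Subcanonical] {o' o : R.arrows.category} (m : o' ⟶ o) {T : C}
    (p : (F.obj o).sections T) (c : T ⟶ dom o') (h : chart α p = c ≫ left m) :
    ∃ q : (F.obj o').sections T, chart α q = c ∧ Hom.onSections (F.map m) q = p := by
  obtain ⟨q, hq, hq'⟩ := exists_section_lift (F.map m) (c ≫ (baseIso α o').inv) p (by
    rw [← cancel_mono (baseIso α o).hom, Category.assoc, map_base_baseIso, Category.assoc,
      Iso.inv_hom_id_assoc, ← h, chart])
  exact ⟨q, by rw [chart, hq, Category.assoc, Iso.inv_hom_id, Category.comp_id], hq'⟩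

lemma map_comp_onSections {o'' o' o : R.arrows.category} (m' : o'' ⟶ o') (m : o' ⟶ o)
    {k : o'' ⟶ o} (hk : left k = left m' ≫ left m) {T : C} (p : (F.obj o'').sections T) :
    Hom.onSections (F.map k) p = Hom.onSections (F.map m) (Hom.onSections (F.map m') p) := by
  obtain rfl : k = m' ≫ m := arrHom_ext hk
  rw [F.map_comp, comp_onSections]

/-- A section over `T` of the torsor obtained by descent: a morphism `f : T ⟶ S`, and compatible
sections of the given torsors over all arrows of the sieve which factor through `f`. -/
structure Sec (T : C) where
  /-- the morphism to the base -/
  f : T ⟶ S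
  /-- the section over an arrow of the sieve -/
  s : ∀ (o : R.arrows.category) (a : dom o ⟶ T), a ≫ f = arr o → (F.obj o).sections (dom o)
  chart_s : ∀ (o : R.arrows.category) (a : dom o ⟶ T) (h : a ≫ f = arr o), chart α (s o a h) = 𝟙 _
  map_s : ∀ {o' o : R.arrows.category} (m : o' ⟶ o) (a : dom o ⟶ T) (h : a ≫ f = arr o)
    (h' : (left m ≫ a) ≫ f = arr o'), Hom.onSections (F.map m) (s o' (left m ≫ a) h') =
      (F.obj o).torsor.P.space.map (left m).op (s o a h)

variable {α}

lemma Sec.ext {T : C} {y z : Sec α T} (hf : y.f = z.f) (hs : ∀ o a h h', y.s o a h = z.s o a h') :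
    y = z := by
  obtain ⟨f, s, _, _⟩ := y
  obtain ⟨f', s', _, _⟩ := z
  obtain rfl : f = f' := hf
  obtain rfl : s = s' := funext fun o => funext fun a => funext fun h => hs o a h h
  rfl

/-- The restriction of a section. -/
def Sec.res {T U : C} (k : U ⟶ T) (y : Sec α T) : Sec α U where
  f := k ≫ y.f
  s o a h := y.s o (a ≫ k) (by rw [Category.assoc, h])
  chart_s o a h := y.chart_s _ _ _
  map_s m a h h' := by
    have := y.map_s m (a ≫ k) (by rw [Category.assoc, h]) (by
      rw [← h']; simp only [Category.assoc])
    simpa only [Category.assoc] using this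

lemma Sec.s_congr {T : C} (y : Sec α T) {o : R.arrows.category} {a a' : dom o ⟶ T} (h : a = a')
    (ha) (ha') : y.s o a ha = y.s o a' ha' := by subst h; rfl

/-- The action of the structure group. -/
def Sec.smul {T : C} (g : G.obj (op T)) (y : Sec α T) : Sec α T where
  f := y.f
  s o a h := (G.map a.op g : G.obj (op (dom o))) • y.s o a h
  chart_s o a h := by rw [chart_smul, y.chart_s]
  map_s m a h h' := by
    rw [onSections_smul, y.map_s m a h h', GSpace.map_smul, op_comp, G.map_comp]
    rfl

variable (α) in
/-- The total space of the torsor obtained by descent. -/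
def space : GSpace.{0, 1} G where
  space :=
    { obj := fun T => Sec α T.unop
      map := fun k => TypeCat.ofHom (Sec.res k.unop)
      map_id := fun T => ConcreteCategory.hom_ext _ _ fun y =>
        Sec.ext (Category.id_comp _) fun o a h h' => Sec.s_congr y (Category.comp_id _) _ _
      map_comp := fun k l => ConcreteCategory.hom_ext _ _ fun y =>
        Sec.ext (Category.assoc _ _ _) fun o a h h' =>
          Sec.s_congr y (Category.assoc _ _ _).symm _ _ }
  action := fun T =>
    { smul := Sec.smul
      one_smul := fun y => Sec.ext rfl fun o a h h' => by
        change (G.map a.op 1 : G.obj (op (dom o))) • y.s o a h = y.s o a h'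
        rw [map_one, one_smul]
      mul_smul := fun g g' y => Sec.ext rfl fun o a h h' => by
        change (G.map a.op (g * g') : G.obj (op (dom o))) • y.s o a h =
          (G.map a.op g : G.obj (op (dom o))) • (G.map a.op g' : G.obj (op (dom o))) • y.s o a h'
        rw [map_mul, mul_smul] }
  map_smul := fun {T T'} k g y => Sec.ext rfl fun o a h h' => by
    change (G.map (a ≫ k.unop).op g : G.obj (op (dom o))) • y.s o (a ≫ k.unop) _ =
      (G.map a.op (G.map k g) : G.obj (op (dom o))) • y.s o (a ≫ k.unop) _
    rw [op_comp, G.map_comp]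
    rfl

section Subcanonical

variable [J.Subcanonical]

variable (α) in
-- This supplies the components of `glue`: p restricted along a lifts uniquely to the torsor at o'
-- once its chart is required to be the identity. Quantifying over m avoids transporting along
-- equalities of arrows.
lemma exists_restrict {o' o : R.arrows.category} {T : C} (p : (F.obj o).sections T)
    (a : dom o' ⟶ T) (h : a ≫ chart α p ≫ arr o = arr o') :
    ∃ q : (F.obj o').sections (dom o'), chart α q = 𝟙 _ ∧
      ∀ m : o' ⟶ o, left m = a ≫ chart α p →
        Hom.onSections (F.map m) q = (F.obj o).torsor.P.space.map a.op p := by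
  obtain ⟨q, hq, hq'⟩ := exists_lift α (arrHom (a ≫ chart α p) (by rw [Category.assoc, h]))
    ((F.obj o).torsor.P.space.map a.op p) (𝟙 (dom o')) (by
      rw [chart_res]; exact (Category.id_comp _).symm)
  refine ⟨q, hq, fun m hm => ?_⟩
  rwa [show m = arrHom (a ≫ chart α p) (by rw [Category.assoc, h]) from arrHom_ext hm]

variable (α) in
/-- The section of the torsor obtained by descent given by a section of one of the given
torsors. -/
def glue {o : R.arrows.category} {T : C} (p : (F.obj o).sections T) : Sec α T where
  f := chart α p ≫ arr o
  s _ a h := (exists_restrict α p a h).choose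
  chart_s o' a h := (exists_restrict α p a h).choose_spec.1
  map_s {o'' o'} m a h h' := by
    have h1 := (exists_restrict α p a h).choose_spec
    have h2 := (exists_restrict α p (left m ≫ a) h').choose_spec
    let k : o' ⟶ o := arrHom (a ≫ chart α p) (by rw [Category.assoc, h])
    refine map_injective α k ?_ ?_
    · rw [chart_map, h2.1, chart_res, h1.1, Category.id_comp, Category.comp_id]
    · rw [onSections_res, h1.2 k rfl, ← GSpace.res_comp,
        ← map_comp_onSections m k (k := m ≫ k) rfl]
      exact h2.2 (m ≫ k) (Category.assoc _ _ _).symm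

lemma map_glue_s {o : R.arrows.category} {T : C} (p : (F.obj o).sections T)
    {o' : R.arrows.category} (a : dom o' ⟶ T) (h) (m : o' ⟶ o) (hm : left m = a ≫ chart α p) :
    Hom.onSections (F.map m) ((glue α p).s o' a h) = (F.obj o).torsor.P.space.map a.op p :=
  (exists_restrict α p a h).choose_spec.2 m hm

/-- Transition maps are injective on sections with a fixed chart, so a family is recognised as `glue
α p` after mapping it to the torsor at o. The compatibilities of `glue` with restriction, action and
transition all follow from this. -/
lemma eq_glue {o : R.arrows.category} {T : C} {p : (F.obj o).sections T} {y : Sec α T}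
    (hf : y.f = chart α p ≫ arr o)
    (hs : ∀ (o' : R.arrows.category) (a : dom o' ⟶ T) (h) (m : o' ⟶ o), left m = a ≫ chart α p →
      Hom.onSections (F.map m) (y.s o' a h) = (F.obj o).torsor.P.space.map a.op p) :
    y = glue α p := by
  refine Sec.ext hf fun o' a h h' => ?_
  let m : o' ⟶ o := arrHom (a ≫ chart α p) (by rw [Category.assoc]; exact h')
  refine map_injective α m ?_ ?_
  · rw [Sec.chart_s, Sec.chart_s]
  · rw [map_glue_s p a h' m rfl, hs o' a h m rfl]

lemma glue_res {o : R.arrows.category} {T U : C} (k : U ⟶ T) (p : (F.obj o).sections T) :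
    glue α ((F.obj o).torsor.P.space.map k.op p) = (glue α p).res k := by
  refine (eq_glue ?_ fun o' a h m hm => ?_).symm
  · rw [chart_res, Category.assoc]
    rfl
  · rw [chart_res, ← Category.assoc] at hm
    rw [← GSpace.res_comp]
    exact map_glue_s p (a ≫ k) (by rw [Category.assoc]; exact h) m hm

lemma glue_smul {o : R.arrows.category} {T : C} (g : G.obj (op T)) (p : (F.obj o).sections T) :
    glue α (g • p) = (glue α p).smul g := by
  refine (eq_glue ?_ fun o' a h m hm => ?_).symm
  · rw [chart_smul]
    rfl
  · rw [chart_smul] at hm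
    rw [GSpace.map_smul, ← map_glue_s p a _ m hm]
    exact onSections_smul _ _ _

lemma glue_map {o' o : R.arrows.category} (k : o' ⟶ o) {T : C} (p : (F.obj o').sections T) :
    glue α (Hom.onSections (F.map k) p) = glue α p := by
  refine (eq_glue ?_ fun o'' a h m hm => ?_).symm
  · rw [chart_map, Category.assoc, left_arr]
    rfl
  · rw [chart_map, ← Category.assoc] at hm
    let l : o'' ⟶ o' := arrHom (a ≫ chart α p) (by rw [Category.assoc]; exact h)
    rw [← onSections_res, ← map_glue_s p a h l rfl, ← map_comp_onSections l k hm]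

/-- The sections of the torsor obtained by descent lying over a given morphism to the domain of an
arrow of the sieve come from unique sections of the given torsor. -/
lemma exists_glue_eq {o : R.arrows.category} {T : C} (y : Sec α T) (k : T ⟶ dom o)
    (h : y.f = k ≫ arr o) : ∃ p : (F.obj o).sections T, chart α p = k ∧ glue α p = y := by
  have hy : R y.f := by
    rw [h]
    exact R.downward_closed o.property k
  let m : mk y.f hy ⟶ o := arrHom k h.symm
  -- As y.f itself belongs to the sieve, y has a component at the identity of T. This component
  -- determines y, and its image in the torsor at o is the section sought.
  obtain ⟨r, hr, hr'⟩ : ∃ r : (F.obj (mk y.f hy)).sections T, chart α r = 𝟙 T ∧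
      ∀ (o' : R.arrows.category) (n : o' ⟶ mk y.f hy) (a : dom o' ⟶ T), left n = a → ∀ ha,
        Hom.onSections (F.map n) (y.s o' a ha) =
          (F.obj (mk y.f hy)).torsor.P.space.map a.op r := by
    refine ⟨y.s (mk y.f hy) (𝟙 T) (Category.id_comp _), y.chart_s _ _ _, ?_⟩
    rintro o' n _ rfl ha
    refine Eq.trans ?_ (y.map_s n (𝟙 T) (Category.id_comp _)
      ((congrArg (· ≫ y.f) (Category.comp_id (left n))).trans ha))
    congr 1
    exact y.s_congr (Category.comp_id _).symm _ _
  have hc : chart α (Hom.onSections (F.map m) r) = k := by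
    rw [chart_map, hr]
    exact Category.id_comp _
  refine ⟨Hom.onSections (F.map m) r, hc, (eq_glue (by rw [hc, h]) fun o' a ha l hl => ?_).symm⟩
  let n : o' ⟶ mk y.f hy := arrHom a ha
  rw [hc] at hl
  rw [map_comp_onSections n m hl, ← onSections_res, hr' o' n a rfl]

/-- The section p is recovered from the component of `glue α p` at the arrow `chart α p ≫ arr o` and
the identity of T. -/
lemma glue_injective {o : R.arrows.category} {T : C} {p q : (F.obj o).sections T}
    (hc : chart α p = chart α q) (h : glue α p = glue α q) : p = q := by
  have hR : R (chart α p ≫ arr o) := R.downward_closed o.property _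
  let m : mk (chart α p ≫ arr o) hR ⟶ o := arrHom (chart α p) rfl
  have h1 {r : (F.obj o).sections T} (hr : chart α p = chart α r) (hf) :
      Hom.onSections (F.map m)
        ((glue α r).s (mk (chart α p ≫ arr o) hR) (𝟙 T) hf) = r :=
    (map_glue_s r (𝟙 T) hf m (by rw [← hr]; exact (Category.id_comp _).symm)).trans
      (GSpace.res_id _ _)
  rw [← h1 rfl (Category.id_comp _)]
  simp only [h]
  exact h1 hc (by rw [← h]; exact Category.id_comp _)

lemma glue_s {T : C} (y : Sec α T) (o : R.arrows.category) (a : dom o ⟶ T) (h) :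
    glue α (y.s o a h) = y.res a := by
  refine (eq_glue ?_ fun o' b hb m hm => ?_).symm
  · rw [y.chart_s, Category.id_comp]
    exact h
  · rw [y.chart_s, Category.comp_id] at hm
    subst hm
    exact y.map_s m a h _

end Subcanonical

end Descent

/-! ### The descended torsor: sheaf property, group action and map to X -/

namespace Descent

open QuotientStack

variable {C : Type 1} [Category.{0} C] {J : GrothendieckTopology C} {G : Cᵒᵖ ⥤ GrpCat.{0}}
  {X : GSpace.{0, 0} G} {S : C} {R : Sieve S}
  {F : R.arrows.category ⥤ QuotientStack.{0, 1} J X} {α : F ⋙ proj J X ≅ R.arrows.diagram}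

lemma Sec.res_comp {T U V : C} (k : U ⟶ T) (l : V ⟶ U) (y : Sec α T) :
    y.res (l ≫ k) = (y.res k).res l :=
  (space α).res_comp k l y

lemma Sec.smul_res {T U : C} (k : U ⟶ T) (g : G.obj (op T)) (y : Sec α T) :
    (y.smul g).res k = (y.res k).smul (G.map k.op g) :=
  (space α).map_smul k.op g y

/-- Transition maps commute with the maps to X, so the images of the components of y form a
compatible family on the pulled-back sieve and glue in the sheaf X. -/
lemma exists_toX (hX : Presieve.IsSheaf J X.space) (hR : R ∈ J S) {T : C} (y : Sec α T) :
    ∃ x : X.space.obj (op T), ∀ (o : R.arrows.category) (a : dom o ⟶ T) (h),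
      X.space.map a.op x = (F.obj o).toX.app _ (y.s o a h) := by
  obtain ⟨x, hx, -⟩ := hX _ (J.pullback_stable y.f hR)
    (fun U k hk => (F.obj (mk (k ≫ y.f) hk)).toX.app _ (y.s (mk (k ≫ y.f) hk) k rfl))
    ((Presieve.compatible_iff_sieveCompatible _).2 fun U V k l hk => by
      have hk' : R ((l ≫ k) ≫ y.f) := by
        rw [Category.assoc]; exact R.downward_closed hk l
      let m : mk ((l ≫ k) ≫ y.f) hk' ⟶ mk (k ≫ y.f) hk := arrHom l (Category.assoc _ _ _).symm
      refine Eq.trans ?_ ((F.obj (mk (k ≫ y.f) hk)).toX.naturality l.op _)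
      refine (toX_onSections (F.map m) _).symm.trans ?_
      exact congrArg _ (y.map_s m k rfl rfl))
  refine ⟨x, ?_⟩
  rintro ⟨⟨U, ⟨⟨⟩⟩, b⟩, hb⟩ a h
  change U ⟶ T at a
  obtain rfl : a ≫ y.f = b := h
  exact hx a hb

/-- The image in `X` of a section of the torsor obtained by descent. -/
def toX (hX : Presieve.IsSheaf J X.space) (hR : R ∈ J S) {T : C} (y : Sec α T) :
    X.space.obj (op T) :=
  (exists_toX hX hR y).choose

lemma toX_spec (hX : Presieve.IsSheaf J X.space) (hR : R ∈ J S) {T : C} (y : Sec α T)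
    (o : R.arrows.category) (a : dom o ⟶ T) (h) :
    X.space.map a.op (toX hX hR y) = (F.obj o).toX.app _ (y.s o a h) :=
  (exists_toX hX hR y).choose_spec o a h

lemma eq_toX (hX : Presieve.IsSheaf J X.space) (hR : R ∈ J S) {T : C} (y : Sec α T)
    {x : X.space.obj (op T)} (h : ∀ (o : R.arrows.category) (a : dom o ⟶ T) (h),
      X.space.map a.op x = (F.obj o).toX.app _ (y.s o a h)) : x = toX hX hR y :=
  (hX _ (J.pullback_stable y.f hR)).isSeparatedFor.ext fun _ k hk =>
    (h (mk (k ≫ y.f) hk) k rfl).trans (toX_spec hX hR y (mk (k ≫ y.f) hk) k rfl).symm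

variable [J.Subcanonical]

/-- Sections of the torsor obtained by descent which agree locally are equal. -/
lemma Sec.ext_of_mem {T : C} {Q : Sieve T} (hQ : Q ∈ J T) {y z : Sec α T}
    (h : ∀ {U : C} (k : U ⟶ T), Q k → y.res k = z.res k) : y = z := by
  refine Sec.ext (hom_ext_of_mem hQ fun k hk => congrArg Sec.f (h k hk)) fun o a ha ha' => ?_
  refine (F.obj o).torsor.ext_of_mem (J.pullback_stable a hQ) fun k hk => glue_injective (α := α) ?_ ?_
  · rw [chart_res, chart_res, Sec.chart_s, Sec.chart_s]
  · rw [glue_res, glue_res, glue_s, glue_s, ← Sec.res_comp, ← Sec.res_comp, h _ hk]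

/-- Compatible sections of the torsor obtained by descent can be glued. -/
lemma Sec.exists_glue {T : C} {Q : Sieve T} (hQ : Q ∈ J T)
    (y : ∀ {U : C} (k : U ⟶ T), Q k → Sec α U)
    (h : ∀ {U V : C} (g : V ⟶ U) (k : U ⟶ T) (hk : Q k),
      y (g ≫ k) (Q.downward_closed hk g) = (y k hk).res g) :
    ∃ z : Sec α T, ∀ {U : C} (k : U ⟶ T) (hk : Q k), z.res k = y k hk := by
  obtain ⟨f, hf⟩ := exists_hom_glue hQ (fun k hk => (y k hk).f) fun g k hk => by
    rw [h]; rfl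
  -- The component at o is glued inside the torsor at o: over k, the section y (k ≫ a) comes from a
  -- unique section there with chart k.
  have hs (o : R.arrows.category) (a : dom o ⟶ T) (ha : a ≫ f = arr o) :
      ∃ p : (F.obj o).sections (dom o), chart α p = 𝟙 _ ∧ ∀ {U : C} (k : U ⟶ dom o)
        (hk : Q.pullback a k), glue α ((F.obj o).torsor.P.space.map k.op p) = y (k ≫ a) hk := by
    choose p hp hp' using fun {U : C} (k : U ⟶ dom o) (hk : Q.pullback a k) =>
      exists_glue_eq (o := o) (y (k ≫ a) hk) k (by
        rw [← ha, ← Category.assoc]; exact (hf (k ≫ a) hk).symm)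
    obtain ⟨q, hq⟩ := (F.obj o).torsor.exists_glue (J.pullback_stable a hQ)
      (fun k hk => p k hk) fun g k hk => by
        refine glue_injective (α := α) ?_ ?_
        · rw [hp, chart_res, hp]
        · rw [hp', glue_res, hp']
          refine Eq.trans ?_ (h g (k ≫ a) hk)
          congr 1
          exact Category.assoc _ _ _
    refine ⟨q, hom_ext_of_mem (J.pullback_stable a hQ) fun k hk => ?_, fun k hk => ?_⟩
    · rw [← chart_res, hq k hk, hp, Category.comp_id]
    · rw [hq k hk, hp']
  choose s hs1 hs2 using hs
  refine ⟨⟨f, s, hs1, fun {o' o} m a ha ha' => ?_⟩, fun {U} k hk => ?_⟩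
  · refine (F.obj o).torsor.ext_of_mem (J.pullback_stable (left m ≫ a) hQ) fun k hk => ?_
    refine glue_injective (α := α) ?_ ?_
    · rw [chart_res, chart_map, hs1, chart_res, chart_res, hs1, Category.id_comp, Category.comp_id]
    · have hk' : Q ((k ≫ left m) ≫ a) := by rw [Category.assoc]; exact hk
      rw [← onSections_res, glue_map, hs2 _ _ _ _ hk, ← GSpace.res_comp, hs2 _ _ _ _ hk']
      congr 1
      exact (Category.assoc _ _ _).symm
  · refine Sec.ext (hf k hk) fun o a ha ha' => ?_
    refine glue_injective (α := α) ?_ ?_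
    · rw [Sec.chart_s, Sec.chart_s]
    · have hk' : Q (𝟙 _ ≫ a ≫ k) := by
        rw [Category.id_comp]; exact Q.downward_closed hk a
      have := hs2 o (a ≫ k) (by rw [Category.assoc]; exact ha) (𝟙 _) hk'
      rw [GSpace.res_id] at this
      refine this.trans ?_
      rw [glue_s, ← h a k hk]
      congr 1
      exact Category.id_comp _

variable (α) in
lemma isSheaf_space : Presieve.IsSheaf J (space α).space := by
  intro T Q hQ y hy
  rw [Presieve.compatible_iff_sieveCompatible] at hy
  obtain ⟨z, hz⟩ := Sec.exists_glue hQ (fun k hk => y k hk) fun g k hk => hy _ g hk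
  exact ⟨z, fun U k hk => hz k hk, fun z' hz' => Sec.ext_of_mem hQ fun k hk =>
    (hz' k hk).trans (hz k hk).symm⟩

/-- When the common base morphism lies in the sieve, y and z both come from sections of the single
torsor at that arrow, which is simply transitive. -/
lemma exists_unique_smul_eq_of_mem {T : C} {y z : Sec α T} (h : y.f = z.f) (hy : R y.f) :
    ∃! g : G.obj (op T), y.smul g = z := by
  obtain ⟨p, hp, hp'⟩ := exists_glue_eq (o := mk y.f hy) y (𝟙 T) (Category.id_comp _).symm
  obtain ⟨q, hq, hq'⟩ := exists_glue_eq (o := mk y.f hy) z (𝟙 T)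
    (h.symm.trans (Category.id_comp _).symm)
  obtain ⟨g, hg, hg'⟩ := (F.obj _).torsor.simply_transitive _ p q
    (π_eq_of_chart_eq α (hp.trans hq.symm))
  refine ⟨g, by rw [← hp', ← hq', ← hg, glue_smul], fun g' h' => hg' g' ?_⟩
  refine glue_injective (α := α) (by rw [chart_smul, hp, hq]) ?_
  rw [glue_smul, hp', hq', h']

/-- The group elements exist over the pulled-back sieve, and their uniqueness makes them compatible.
They glue because G is a sheaf. -/
lemma exists_unique_smul_eq (hG : Presieve.IsSheaf J (G ⋙ forget GrpCat)) {T : C} {y z : Sec α T}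
    (hR : R ∈ J S) (h : y.f = z.f) : ∃! g : G.obj (op T), y.smul g = z := by
  have hQ := J.pullback_stable y.f hR
  have key {U : C} (k : U ⟶ T) (hk : R.pullback y.f k) :
      ∃! g : G.obj (op U), (y.res k).smul g = z.res k :=
    exists_unique_smul_eq_of_mem (congrArg (k ≫ ·) h) hk
  choose g hg hg' using @key
  obtain ⟨γ, hγ, -⟩ := hG _ hQ (fun U k hk => g k hk)
    ((Presieve.compatible_iff_sieveCompatible _).2 fun U V k l hk => by
      refine (hg' _ _ _ ?_).symm
      rw [Sec.res_comp, Sec.res_comp, ← hg k hk]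
      exact (Sec.smul_res l _ _).symm)
  refine ⟨γ, Sec.ext_of_mem hQ fun k hk => ?_, fun γ' hγ' => ?_⟩
  · rw [Sec.smul_res, ← hg k hk]
    exact congrArg (fun g => (y.res k).smul g) (hγ k hk)
  · refine (hG _ hQ).isSeparatedFor.ext fun U k hk => ?_
    refine (hg' k hk _ ?_).trans (hγ k hk).symm
    rw [← hγ', Sec.smul_res]
    rfl

variable (α) in
-- Each member of the descent datum has local sections, which `glue` carries to the descended
-- torsor; local existence over a covering sieve suffices by transitivity of the topology.
lemma locally_nonempty (hR : R ∈ J S) :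
    ∃ Q ∈ J S, ∀ (U : C) (f : U ⟶ S), Q f → ∃ y : Sec α U, y.f = f := by
  let Q : Sieve S :=
    { arrows := fun U f => ∃ y : Sec α U, y.f = f
      downward_closed := by
        rintro U V _ ⟨y, rfl⟩ k
        exact ⟨y.res k, rfl⟩ }
  refine ⟨Q, J.transitive hR Q fun U b hb => ?_, fun U f hf => hf⟩
  obtain ⟨Q', hQ', h⟩ := (F.obj (mk b hb)).torsor.exists_local_section (baseIso α (mk b hb)).inv
  refine J.superset_covering (fun V k hk => ?_) hQ'
  obtain ⟨p, hp⟩ := h V k hk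
  refine ⟨glue α p, ?_⟩
  have hk' : chart α p = k := by
    rw [chart, hp, Category.assoc, Iso.inv_hom_id]
    exact Category.comp_id k
  exact congrArg (· ≫ b) hk'

variable (α) in
/-- The torsor obtained by descent. -/
def torsor (hG : Presieve.IsSheaf J (G ⋙ forget GrpCat)) (hR : R ∈ J S) : Torsor.{0, 1} J G S where
  P := space α
  isSheaf := isSheaf_space α
  π _ y := Sec.f y
  π_naturality _ _ := rfl
  π_smul _ _ _ := rfl
  simply_transitive _ _ _ h := exists_unique_smul_eq hG hR h
  locally_trivial := locally_nonempty α hR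

variable (α) in
/-- The object of the quotient stack obtained by descent. -/
def obj (hG : Presieve.IsSheaf J (G ⋙ forget GrpCat)) (hX : Presieve.IsSheaf J X.space)
    (hR : R ∈ J S) : QuotientStack.{0, 1} J X where
  base := S
  torsor := torsor α hG hR
  toX :=
    { app := fun T y => toX hX hR (y : Sec α T.unop)
      naturality := fun {T T'} f y => by
        refine (eq_toX hX hR (Sec.res f.unop y) fun o a h => ?_).symm
        refine Eq.trans ?_ (toX_spec hX hR y o (a ≫ f.unop) _)
        rw [op_comp, X.space.map_comp]
        rfl
      equivariant := fun T g y => by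
        refine (eq_toX hX hR (Sec.smul (T := T.unop) g y) fun o a h => ?_).symm
        rw [X.map_smul, toX_spec hX hR y o a h]
        exact ((F.obj o).toX.equivariant _ _ _).symm }

lemma toX_glue (hX : Presieve.IsSheaf J X.space) (hR : R ∈ J S) {o : R.arrows.category} {T : C}
    (p : (F.obj o).sections T) : toX hX hR (glue α p) = (F.obj o).toX.app _ p := by
  refine (eq_toX hX hR _ fun o' a h => ?_).symm
  let m : o' ⟶ o := arrHom (a ≫ chart α p) (by rw [Category.assoc]; exact h)
  rw [← (F.obj o).toX.naturality, ← map_glue_s p a h m rfl, toX_onSections]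

variable (α) in
/-- The morphism from a member of the descent datum to the object obtained by descent. -/
def ofMember (hG : Presieve.IsSheaf J (G ⋙ forget GrpCat)) (hX : Presieve.IsSheaf J X.space)
    (hR : R ∈ J S) (o : R.arrows.category) : F.obj o ⟶ obj α hG hX hR :=
  homMk (η := obj α hG hX hR) ((baseIso α o).hom ≫ arr o) (fun p => glue α p)
    (fun _ => Category.assoc _ _ _) (fun p => toX_glue hX hR p) (fun f p => glue_res f p)
    (fun g p => glue_smul g p)

lemma map_ofMember (hG : Presieve.IsSheaf J (G ⋙ forget GrpCat)) (hX : Presieve.IsSheaf J X.space)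
    (hR : R ∈ J S) {o' o : R.arrows.category} (m : o' ⟶ o) :
    F.map m ≫ ofMember α hG hX hR o = ofMember α hG hX hR o' := by
  refine hom_ext ?_ fun T p => glue_map m p
  change (F.map m).base ≫ (baseIso α o).hom ≫ arr o = (baseIso α o').hom ≫ arr o'
  rw [← left_arr m, ← Category.assoc, map_base_baseIso, Category.assoc]

end Descent

/-- The quotient of a sheaf by a sheaf of groups is a stack in groupoids. -/
theorem QuotientStack.isStackInGroupoids {C : Type 1} [Category.{0} C] {J : GrothendieckTopology C}
    [J.Subcanonical] {G : Cᵒᵖ ⥤ GrpCat.{0}} (X : GSpace.{0, 0} G)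
    (hG : Presieve.IsSheaf J (G ⋙ forget GrpCat)) (hX : Presieve.IsSheaf J X.space) :
    IsStackInGroupoids J (proj.{0, 1} J X) where
  fibered := isFibered_proj J X
  groupoids _ := isStronglyCartesian _ rfl
  glue_hom _ _ u _ hR ψ hψ hψ' := exists_unique_hom_glue hX.isSeparated u hR ψ hψ hψ'
  effective _ _ hR _ α :=
    ⟨Descent.obj α hG hX hR, Iso.refl _, Descent.ofMember α hG hX hR,
      Descent.map_ofMember hG hX hR, fun _ => Category.comp_id _⟩

/-! ### Quotient stacks which are gerbes -/

namespace QuotientStack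

variable {C : Type 1} [Category.{0} C] {J : GrothendieckTopology C} {G : Cᵒᵖ ⥤ GrpCat.{0}}
  {X : GSpace.{0, 0} G}

/-- The sections over `T` of the trivial torsor over `S`. -/
@[ext]
structure TrivialSec (G : Cᵒᵖ ⥤ GrpCat.{0}) (S T : C) : Type 1 where
  /-- the morphism to the base -/
  hom : T ⟶ S
  /-- the element of the group -/
  elt : G.obj (op T)

lemma exists_group_glue (hG : Presieve.IsSheaf J (G ⋙ forget GrpCat)) {T : C} {R : Sieve T}
    (hR : R ∈ J T) (a : ∀ {U : C} (f : U ⟶ T), R f → G.obj (op U))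
    (h : ∀ {U V : C} (g : V ⟶ U) (f : U ⟶ T) (hf : R f),
      a (g ≫ f) (R.downward_closed hf g) = G.map g.op (a f hf)) :
    ∃ b : G.obj (op T), ∀ {U : C} (f : U ⟶ T) (hf : R f), G.map f.op b = a f hf := by
  obtain ⟨b, hb, -⟩ := hG R hR (fun U f hf => a f hf)
    ((Presieve.compatible_iff_sieveCompatible _).2 fun _ _ f g hf => h g f hf)
  exact ⟨b, fun f hf => hb f hf⟩

lemma group_ext_of_mem (hG : Presieve.IsSheaf J (G ⋙ forget GrpCat)) {T : C} {R : Sieve T}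
    (hR : R ∈ J T) {a b : G.obj (op T)}
    (h : ∀ {U : C} (f : U ⟶ T), R f → G.map f.op a = G.map f.op b) : a = b :=
  (hG R hR).isSeparatedFor.ext fun _ f hf => h f hf

variable (G) in
/-- The trivial torsor, as a presheaf with an action. -/
def trivialSpace (S : C) : GSpace.{0, 1} G where
  space :=
    { obj := fun T => TrivialSec G S T.unop
      map := fun f => TypeCat.ofHom fun x => ⟨f.unop ≫ x.hom, G.map f x.elt⟩
      map_id := fun T => ConcreteCategory.hom_ext _ _ fun x =>
        TrivialSec.ext (Category.id_comp _) (by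
          change G.map (𝟙 T) x.elt = x.elt
          rw [G.map_id]
          rfl)
      map_comp := fun f g => ConcreteCategory.hom_ext _ _ fun x =>
        TrivialSec.ext (Category.assoc _ _ _) (by
          change G.map (f ≫ g) x.elt = G.map g (G.map f x.elt)
          rw [G.map_comp]
          rfl) }
  action := fun T =>
    { smul := fun g x => ⟨x.hom, (g * x.elt : G.obj T)⟩
      one_smul := fun x => TrivialSec.ext rfl (one_mul (x.elt : G.obj T))
      mul_smul := fun g h x => TrivialSec.ext rfl (mul_assoc g h (x.elt : G.obj T)) }
  map_smul := fun f g x => TrivialSec.ext rfl (map_mul (G.map f).hom g x.elt)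

variable (G) in
lemma isSheaf_trivialSpace [J.Subcanonical] (hG : Presieve.IsSheaf J (G ⋙ forget GrpCat)) (S : C) :
    Presieve.IsSheaf J (trivialSpace G S).space := by
  intro T R hR a ha
  rw [Presieve.compatible_iff_sieveCompatible] at ha
  obtain ⟨c, hc⟩ := exists_hom_glue hR (fun h hh => (a h hh).hom) fun g h hh =>
    congrArg TrivialSec.hom (ha _ g hh)
  obtain ⟨x, hx⟩ := exists_group_glue hG hR (fun h hh => (a h hh).elt) fun g h hh =>
    congrArg TrivialSec.elt (ha _ g hh)
  refine ⟨⟨c, x⟩, fun U h hh => TrivialSec.ext (hc h hh) (hx h hh), fun z hz =>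
    TrivialSec.ext (hom_ext_of_mem hR fun h hh => ?_) (group_ext_of_mem hG hR fun h hh => ?_)⟩
  · exact (congrArg TrivialSec.hom (hz h hh)).trans (hc h hh).symm
  · exact (congrArg TrivialSec.elt (hz h hh)).trans (hx h hh).symm

/-- The trivial torsor with the equivariant morphism to `X` given by a section of `X`. -/
def trivialObj [J.Subcanonical] (hG : Presieve.IsSheaf J (G ⋙ forget GrpCat)) {S : C}
    (x : X.space.obj (op S)) : QuotientStack.{0, 1} J X where
  base := S
  torsor :=
    { P := trivialSpace G S
      isSheaf := isSheaf_trivialSpace G hG S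
      π := fun T y => TrivialSec.hom y
      π_naturality := fun f y => rfl
      π_smul := fun T g y => rfl
      simply_transitive := fun T y z h =>
        ⟨(TrivialSec.elt z * (TrivialSec.elt y)⁻¹ : G.obj T),
          TrivialSec.ext h (inv_mul_cancel_right (G := G.obj T) _ _),
          fun g hg => eq_mul_inv_of_mul_eq (G := G.obj T) (congrArg TrivialSec.elt hg)⟩
      locally_trivial := ⟨⊤, J.top_mem S, fun U f _ => ⟨⟨f, (1 : G.obj (op U))⟩, rfl⟩⟩ }
  toX :=
    { app := fun T y => (TrivialSec.elt y : G.obj T) • X.space.map (TrivialSec.hom y).op x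
      naturality := fun {T T'} f y => by
        refine Eq.trans ?_ (X.map_smul f (TrivialSec.elt y : G.obj T) _).symm
        exact congrArg (fun z => (G.map f (TrivialSec.elt y) : G.obj T') • z)
          (ConcreteCategory.congr_hom (X.space.map_comp (TrivialSec.hom y).op f) x)
      equivariant := fun T g y => mul_smul g (TrivialSec.elt y : G.obj T) _ }

/-- A morphism from an object whose torsor has a section can be defined by the image of this
section. -/
lemma exists_hom_of_section {ξ η : QuotientStack.{0, 1} J X} (u : ξ.base ⟶ η.base)
    (p : ξ.sections ξ.base) (hp : ξ.torsor.π _ p = 𝟙 ξ.base) (q : η.sections ξ.base)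
    (hq : η.torsor.π _ q = u) (hX : η.toX.app _ q = ξ.toX.app _ p) : ∃ ψ : ξ ⟶ η, ψ.base = u := by
  have hπ {T : C} (x : ξ.sections T) :
      ξ.torsor.π (op T) (ξ.torsor.P.space.map (ξ.torsor.π (op T) x).op p) =
        ξ.torsor.π (op T) x := by
    rw [Torsor.π_res, hp]
    exact Category.comp_id _
  -- The section p trivialises ξ: each x is g·p for a unique g, and the morphism sends it to g·q.
  choose g hg hg' using fun (T : C) (x : ξ.sections T) =>
    ξ.torsor.simply_transitive (op T) _ x (hπ x)
  refine ⟨homMk u (fun {T} x => g T x • η.torsor.P.space.map (ξ.torsor.π (op T) x).op q)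
    (fun {T} x => ?_) (fun {T} x => ?_) (fun {T U} f x => ?_) (fun {T} h x => ?_), rfl⟩
  · rw [Torsor.π_smul, Torsor.π_res, hq]
  · rw [η.toX.equivariant, η.toX.naturality, hX, ← ξ.toX.naturality, ← ξ.toX.equivariant, hg]
  · have h1 : g U (ξ.torsor.P.space.map f.op x) = G.map f.op (g T x) := by
      refine (hg' _ _ _ ?_).symm
      change G.map f.op (g T x) • ξ.torsor.P.space.map _ p = _
      rw [Torsor.π_res, GSpace.res_comp, ← GSpace.map_smul]
      exact congrArg _ (hg T x)
    rw [h1, GSpace.map_smul, Torsor.π_res, GSpace.res_comp]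
  · have h1 : g T (h • x) = h * g T x := by
      refine (hg' _ _ _ ?_).symm
      change (h * g T x) • ξ.torsor.P.space.map _ p = _
      rw [Torsor.π_smul, mul_smul]
      exact congrArg _ (hg T x)
    rw [h1, Torsor.π_smul, mul_smul]

/-- An invariant morphism from `X` to `Y` induces morphisms from the bases of the torsors. -/
lemma exists_descend [J.Subcanonical] {Y : C} (κ : ∀ {T : C}, X.space.obj (op T) → (T ⟶ Y))
    (hκ : ∀ {T U : C} (f : U ⟶ T) (x : X.space.obj (op T)), κ (X.space.map f.op x) = f ≫ κ x)
    (hκ' : ∀ {T : C} (g : G.obj (op T)) (x : X.space.obj (op T)), κ (g • x) = κ x)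
    (ξ : QuotientStack.{0, 1} J X) :
    ∃ q : ξ.base ⟶ Y, ∀ {T : C} (p : ξ.sections T),
      ξ.torsor.π (op T) p ≫ q = κ (ξ.toX.app (op T) p) := by
  -- Two sections over the same point of the base differ by the group, so their images in Y agree.
  -- The values on local sections therefore glue to a morphism on the base.
  have hinv {T : C} {p p' : ξ.sections T} (h : ξ.torsor.π (op T) p = ξ.torsor.π (op T) p') :
      κ (ξ.toX.app (op T) p) = κ (ξ.toX.app (op T) p') := by
    obtain ⟨g, rfl, -⟩ := ξ.torsor.simply_transitive _ p p' h
    rw [ξ.toX.equivariant, hκ']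
  have hres {T U : C} (f : U ⟶ T) (p : ξ.sections T) :
      κ (ξ.toX.app (op U) (ξ.torsor.P.space.map f.op p)) = f ≫ κ (ξ.toX.app (op T) p) := by
    rw [ξ.toX.naturality, hκ]
  obtain ⟨R, hR, hsec⟩ := ξ.torsor.locally_trivial
  choose p hp using hsec
  obtain ⟨q, hq⟩ := exists_hom_glue (Y := Y) hR (fun {U} f hf => κ (ξ.toX.app (op U) (p U f hf)))
    fun {U V} g f hf => by
      rw [← hres]
      exact hinv (by rw [hp, Torsor.π_res, hp])
  refine ⟨q, fun {T} y => hom_ext_of_mem (J.pullback_stable (ξ.torsor.π (op T) y) hR)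
    fun {U} k hk => ?_⟩
  rw [← hres, ← Category.assoc]
  refine (hq _ hk).trans (hinv ?_)
  exact (hp _ _ _).trans (Torsor.π_res _ _ _).symm

/-- Morphisms from the base of a torsor are determined by their composites with the projection from
the torsor. -/
lemma base_hom_ext [J.Subcanonical] {ξ : QuotientStack.{0, 1} J X} {Y : C} {a b : ξ.base ⟶ Y}
    (h : ∀ {T : C} (p : ξ.sections T), ξ.torsor.π (op T) p ≫ a = ξ.torsor.π (op T) p ≫ b) :
    a = b := by
  obtain ⟨R, hR, hsec⟩ := ξ.torsor.locally_trivial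
  refine hom_ext_of_mem hR fun {U} f hf => ?_
  obtain ⟨p, rfl⟩ := hsec U f hf
  exact h p

/-- If `G` acts locally transitively on the sections of `X` with a given image in `Y`, then objects
of the quotient stack with the same image in `Y` are locally isomorphic. -/
lemma locally_connected [J.Subcanonical] {Y : C} (κ : ∀ {T : C}, X.space.obj (op T) → (T ⟶ Y))
    (htrans : ∀ {T : C} (x y : X.space.obj (op T)), κ x = κ y → ∃ R ∈ J T, ∀ (U : C) (f : U ⟶ T),
      R f → ∃ g : G.obj (op U), g • X.space.map f.op x = X.space.map f.op y)
    (q : ∀ ξ : QuotientStack.{0, 1} J X, ξ.base ⟶ Y)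
    (hq : ∀ (ξ : QuotientStack.{0, 1} J X) {T : C} (p : ξ.sections T),
      ξ.torsor.π (op T) p ≫ q ξ = κ (ξ.toX.app (op T) p))
    (ξ η : QuotientStack.{0, 1} J X) (e : ξ.base ⟶ η.base) (he : e ≫ q η = q ξ) :
    ∃ R ∈ J ξ.base, ∀ (θ : QuotientStack.{0, 1} J X) (φ : θ ⟶ ξ), R φ.base →
      ∃ ψ : θ ⟶ η, ψ.base = φ.base ≫ e := by
  -- Arrows over which ξ and η both have sections, with the same image in X. Such a pair of sections
  -- is all that `exists_hom_of_section` needs.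
  let R : Sieve ξ.base :=
    { arrows := fun U f => ∃ (p : ξ.sections U) (p' : η.sections U), ξ.torsor.π _ p = f ∧
        η.torsor.π _ p' = f ≫ e ∧ η.toX.app _ p' = ξ.toX.app _ p
      downward_closed := by
        rintro U V _ ⟨p, p', rfl, h, hX⟩ k
        exact ⟨ξ.torsor.P.space.map k.op p, η.torsor.P.space.map k.op p', Torsor.π_res _ _ _,
          by rw [Torsor.π_res, h, Category.assoc], by rw [η.toX.naturality, hX, ξ.toX.naturality]⟩ }
  refine ⟨R, ?_, fun θ φ h => ?_⟩
  · obtain ⟨R₁, hR₁, h₁⟩ := ξ.torsor.locally_trivial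
    obtain ⟨R₂, hR₂, h₂⟩ := η.torsor.exists_local_section e
    refine J.transitive (J.intersection_covering hR₁ hR₂) R ?_
    rintro U f ⟨hf₁, hf₂⟩
    obtain ⟨p, rfl⟩ := h₁ U f hf₁
    obtain ⟨p', hp'⟩ := h₂ U _ hf₂
    obtain ⟨Q, hQ, h⟩ := htrans (ξ.toX.app _ p) (η.toX.app _ p') (by
      rw [← hq, ← hq, hp', Category.assoc, he])
    refine J.superset_covering (fun V k hk => ?_) hQ
    obtain ⟨g, hg⟩ := h V k hk
    refine ⟨g • ξ.torsor.P.space.map k.op p, η.torsor.P.space.map k.op p', ?_, ?_, ?_⟩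
    · rw [Torsor.π_smul, Torsor.π_res]
    · rw [Torsor.π_res, hp', Category.assoc]
    · rw [ξ.toX.equivariant, ξ.toX.naturality, hg, η.toX.naturality]
  · obtain ⟨p, p', hp, hp', hX⟩ := h
    obtain ⟨s, hs, rfl⟩ := exists_section_lift φ (𝟙 _) p (by
      rw [hp]; exact (Category.id_comp _).symm)
    exact exists_hom_of_section (φ.base ≫ e) s hs p' hp' (hX.trans (toX_onSections φ s))

/-! ### Automorphisms coming from a central subgroup -/

section Band

variable {A : Cᵒᵖ ⥤ CommGrpCat.{0}}

variable (X) in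
/-- A central subgroup `A` of `G` acting trivially on `X`. -/
structure CentralSubgroup (A : Cᵒᵖ ⥤ CommGrpCat.{0}) where
  /-- the inclusion -/
  i : ∀ {T : C}, A.obj (op T) →* G.obj (op T)
  i_map : ∀ {T U : C} (f : U ⟶ T) (a : A.obj (op T)), i (A.map f.op a) = G.map f.op (i a)
  injective : ∀ {T : C}, Function.Injective (i (T := T))
  comm : ∀ {T : C} (a : A.obj (op T)) (g : G.obj (op T)), i a * g = g * i a
  smul_eq : ∀ {T : C} (a : A.obj (op T)) (x : X.space.obj (op T)), i a • x = x

variable (Z : CentralSubgroup X A) (ξ : QuotientStack.{0, 1} J X)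

/-- The endomorphism of an object of the quotient stack given by a section over the base of a
central subgroup acting trivially on `X`. -/
def centralEnd (a : A.obj (op ξ.base)) : ξ ⟶ ξ :=
  homMk (𝟙 _) (fun {T} p => Z.i (A.map (ξ.torsor.π (op T) p).op a) • p)
    (fun {T} p => by rw [Torsor.π_smul]; exact (Category.comp_id _).symm)
    (fun {T} p => by rw [ξ.toX.equivariant, Z.smul_eq])
    (fun {T U} f p => by
      rw [GSpace.map_smul, ← Z.i_map, Torsor.π_res, op_comp, A.map_comp]
      rfl)
    (fun {T} g p => by rw [Torsor.π_smul, ← mul_smul, ← mul_smul, Z.comm])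

lemma centralEnd_one : centralEnd Z ξ 1 = 𝟙 ξ := by
  refine hom_ext rfl fun T p => ?_
  change Z.i (A.map (ξ.torsor.π (op T) p).op 1) • p = p
  rw [map_one, map_one, one_smul]

lemma centralEnd_mul (a b : A.obj (op ξ.base)) :
    centralEnd Z ξ (a * b) = centralEnd Z ξ b ≫ centralEnd Z ξ a := by
  refine hom_ext (Category.comp_id _).symm fun T p => ?_
  change Z.i (A.map (ξ.torsor.π (op T) p).op (a * b)) • p =
    Z.i (A.map (ξ.torsor.π (op T) (Z.i (A.map (ξ.torsor.π (op T) p).op b) • p)).op a) •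
      Z.i (A.map (ξ.torsor.π (op T) p).op b) • p
  rw [Torsor.π_smul, map_mul, map_mul, mul_smul]

/-- The automorphism of an object of the quotient stack given by a section over the base of a
central subgroup acting trivially on `X`. -/
def centralAut : A.obj (op ξ.base) →* Aut ξ where
  toFun a :=
    { hom := centralEnd Z ξ a
      inv := centralEnd Z ξ a⁻¹
      hom_inv_id := by rw [← centralEnd_mul, inv_mul_cancel, centralEnd_one]
      inv_hom_id := by rw [← centralEnd_mul, mul_inv_cancel, centralEnd_one] }
  map_one' := Iso.ext (centralEnd_one Z ξ)
  map_mul' a b := Iso.ext (centralEnd_mul Z ξ a b)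

lemma centralAut_injective (hA : Presieve.IsSeparated J (A ⋙ forget CommGrpCat)) :
    Function.Injective (centralAut Z ξ) := by
  intro a b h
  obtain ⟨R, hR, hsec⟩ := ξ.torsor.locally_trivial
  refine (hA R hR).ext fun U f hf => ?_
  obtain ⟨p, rfl⟩ := hsec U f hf
  refine Z.injective (ξ.torsor.smul_left_injective (x := p) ?_)
  exact congrArg (fun φ : Aut ξ => Hom.onSections φ.hom p) h

/-- Over a section p, the automorphism acts as an element of G fixing the image of p in X, hence as
an element of A. Centrality makes this element depend only on the image of p in the base, so the
local elements glue to a section of A over the base. -/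
lemma mem_range_centralAut (hA : Presieve.IsSheaf J (A ⋙ forget CommGrpCat))
    (hstab : ∀ {T : C} (g : G.obj (op T)) (x : X.space.obj (op T)), g • x = x → ∃ a, Z.i a = g)
    {φ : Aut ξ} (hφ : φ.hom.base = 𝟙 ξ.base) : φ ∈ Set.range (centralAut Z ξ) := by
  have key {T : C} (p : ξ.sections T) : ∃ a : A.obj (op T), Z.i a • p = Hom.onSections φ.hom p := by
    obtain ⟨g, hg, -⟩ := ξ.torsor.simply_transitive _ p (Hom.onSections φ.hom p) (by
      rw [π_onSections, hφ]; exact (Category.comp_id _).symm)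
    obtain ⟨a, rfl⟩ := hstab g (ξ.toX.app _ p) (by
      rw [← ξ.toX.equivariant, hg, toX_onSections])
    exact ⟨a, hg⟩
  choose c hc using @key
  have huniq {T : C} {p : ξ.sections T} {a : A.obj (op T)}
      (h : Z.i a • p = Hom.onSections φ.hom p) : a = c p :=
    Z.injective (ξ.torsor.smul_left_injective (h.trans (hc p).symm))
  have hres {T U : C} (f : U ⟶ T) (p : ξ.sections T) :
      c (ξ.torsor.P.space.map f.op p) = A.map f.op (c p) := by
    refine (huniq ?_).symm
    rw [Z.i_map, ← GSpace.map_smul, hc, onSections_res]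
  have hπ {T : C} {p p' : ξ.sections T} (h : ξ.torsor.π (op T) p = ξ.torsor.π (op T) p') :
      c p = c p' := by
    obtain ⟨g, rfl, -⟩ := ξ.torsor.simply_transitive _ p p' h
    refine huniq ?_
    rw [onSections_smul, ← hc, ← mul_smul, ← mul_smul, Z.comm]
  obtain ⟨R, hR, hsec⟩ := ξ.torsor.locally_trivial
  choose s hs using hsec
  obtain ⟨a, ha, -⟩ := hA R hR (fun U f hf => c (s U f hf))
    ((Presieve.compatible_iff_sieveCompatible _).2 fun U V f g hf => by
      refine Eq.trans ?_ (hres g (s U f hf))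
      exact hπ (by rw [hs, Torsor.π_res, hs]))
  refine ⟨a, Iso.ext (hom_ext hφ.symm fun T p => ?_)⟩
  change Z.i (A.map (ξ.torsor.π (op T) p).op a) • p = _
  rw [← hc]
  congr 2
  refine (hA _ (J.pullback_stable (ξ.torsor.π (op T) p) hR)).isSeparatedFor.ext fun U k hk => ?_
  refine Eq.trans ?_ ((ha _ hk).trans ((hπ ?_).trans (hres k p)))
  · exact (ConcreteCategory.congr_hom (A.map_comp (ξ.torsor.π (op T) p).op k.op) a).symm
  · exact (hs _ _ _).trans (Torsor.π_res _ _ _).symm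

/-- The quotient stack of `X` by `G` is a gerbe over `Y` banded by `A` if `A` is a central subgroup
of `G` which is the stabilizer of every section of `X`, and `X ⟶ Y` is an invariant morphism with
local sections, such that `G` acts locally transitively on its fibers. -/
theorem isGerbe [J.Subcanonical] (hG : Presieve.IsSheaf J (G ⋙ forget GrpCat))
    (hX : Presieve.IsSheaf J X.space) (hA : Presieve.IsSheaf J (A ⋙ forget CommGrpCat))
    (hstab : ∀ {T : C} (g : G.obj (op T)) (x : X.space.obj (op T)), g • x = x → ∃ a, Z.i a = g)
    {Y : C} (κ : ∀ {T : C}, X.space.obj (op T) → (T ⟶ Y))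
    (hκ : ∀ {T : C} (f : T ⟶ Y), ∃ x : X.space.obj (op T), κ x = f)
    (htrans : ∀ {T : C} (x y : X.space.obj (op T)), κ x = κ y → ∃ R ∈ J T, ∀ (U : C) (f : U ⟶ T),
      R f → ∃ g : G.obj (op U), g • X.space.map f.op x = X.space.map f.op y)
    (q : ∀ ξ : QuotientStack.{0, 1} J X, ξ.base ⟶ Y)
    (hq : ∀ (ξ : QuotientStack.{0, 1} J X) {T : C} (p : ξ.sections T),
      ξ.torsor.π (op T) p ≫ q ξ = κ (ξ.toX.app (op T) p)) :
    IsGerbe J (proj.{0, 1} J X) A Y q where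
  stack := isStackInGroupoids X hG hX
  natural {ξ η} φ := base_hom_ext fun {T} p => by
    refine (Category.assoc _ _ _).symm.trans ?_
    refine (congrArg (· ≫ q η) (π_onSections φ p)).symm.trans ?_
    rw [hq, hq, toX_onSections]
  locally_nonempty S s := by
    -- Every morphism to Y lifts to X without refinement, so the maximal sieve works, with trivial
    -- torsors.
    refine ⟨⊤, J.top_mem S, fun U f _ => ?_⟩
    obtain ⟨x, hx⟩ := hκ (f ≫ s)
    refine ⟨trivialObj hG x, Iso.refl U, ?_⟩
    refine (hq (trivialObj hG x) (⟨𝟙 U, (1 : G.obj (op U))⟩ : TrivialSec G U U)).trans ?_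
    rw [← hx]
    congr 1
    change (1 : G.obj (op U)) • X.space.map (𝟙 U).op x = x
    rw [one_smul, op_id, X.space.map_id]
    rfl
  locally_connected ξ η e he := locally_connected κ htrans q hq ξ η e.hom he
  band := by
    refine ⟨fun ξ => centralAut Z ξ, fun ξ => centralAut_injective Z ξ hA.isSeparated,
      fun ξ φ => ⟨?_, mem_range_centralAut Z ξ hA hstab⟩, fun {ξ η} φ a => ?_⟩
    · rintro ⟨a, rfl⟩
      rfl
    · refine hom_ext ((Category.id_comp _).trans (Category.comp_id _).symm) fun T p => ?_
      change Hom.onSections φ (Z.i (A.map (ξ.torsor.π (op T) p).op (A.map φ.base.op a)) • p) =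
        Z.i (A.map (η.torsor.π (op T) (Hom.onSections φ p)).op a) • Hom.onSections φ p
      rw [onSections_smul, π_onSections, op_comp, A.map_comp]
      rfl

end Band

end QuotientStack

/-! ### The character stack -/

/-- The function underlying a section of `μ₂`. -/
def mu2Val {T : SchC} (a : rootsOfUnity 2 (𝒪 T)) : 𝒪 T := ((a : (𝒪 T)ˣ) : 𝒪 T)

lemma mu2Val_injective {T : SchC} : Function.Injective (mu2Val (T := T)) :=
  fun _ _ h => Subtype.ext (Units.ext h)

lemma mu2Val_sq {T : SchC} (a : rootsOfUnity 2 (𝒪 T)) : mu2Val a ^ 2 = 1 :=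
  congrArg Units.val a.2

lemma isSheaf_mu2 : Presieve.IsSheaf etale (mu2 ⋙ forget CommGrpCat) := by
  intro T R hR
  rw [← Presieve.isSeparatedFor_and_exists_isAmalgamation_iff_isSheafFor]
  refine ⟨?_, fun x hx => ?_⟩
  · intro x g g' hg hg'
    refine mu2Val_injective (eq_of_pullbackFun_eq hR fun f hf => ?_)
    exact congrArg mu2Val ((hg f hf).trans (hg' f hf).symm)
  · rw [Presieve.compatible_iff_sieveCompatible] at hx
    obtain ⟨b, hb⟩ := exists_pullbackFun_eq hR (fun f hf => mu2Val (x f hf)) fun g f hf =>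
      congrArg mu2Val (hx f g hf)
    have hb2 : b ^ 2 = 1 := eq_of_pullbackFun_eq hR fun f hf => by
      rw [map_pow, map_one, hb f hf]
      exact mu2Val_sq _
    exact ⟨rootsOfUnity.mkOfPowEq b hb2, fun U f hf => mu2Val_injective (hb f hf)⟩

/-! ### The scalar subgroup μ₂ and its trivial action -/

section Scalars

variable {n : ℕ} {R : Type} [CommRing R]

lemma transp_scalar (a : Rˣ) : transp (Matrix.GeneralLinearGroup.scalar (Fin n) a) =
    Matrix.GeneralLinearGroup.scalar (Fin n) a :=
  Units.ext (Matrix.diagonal_transpose _)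

lemma scalar_mul_comm (a : Rˣ) (g : GL (Fin n) R) :
    Matrix.GeneralLinearGroup.scalar (Fin n) a * g =
      g * Matrix.GeneralLinearGroup.scalar (Fin n) a :=
  Units.ext (Matrix.scalar_comm (a : R) (fun _ => Commute.all _ _) g.val)

lemma RepPoint.scalar_smul [Algebra ℂ R] {r d : ℕ} {a : Rˣ} (ha : a ^ 2 = 1)
    (x : RepPoint r n d R) : Matrix.GeneralLinearGroup.scalar (Fin n) a • x = x := by
  refine RepPoint.ext (funext fun k => ?_)
  change Matrix.GeneralLinearGroup.scalar (Fin n) a * x.D k *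
    transp (Matrix.GeneralLinearGroup.scalar (Fin n) a) = x.D k
  rw [transp_scalar, scalar_mul_comm, mul_assoc, ← map_mul, ← sq, ha, map_one,
    mul_one]

lemma scalar_injective [NeZero n] :
    Function.Injective (Matrix.GeneralLinearGroup.scalar (Fin n) : Rˣ → GL (Fin n) R) := by
  intro a b h
  refine Units.ext ?_
  have h1 := GL_apply_congr h 0 0
  simpa [Matrix.GeneralLinearGroup.scalar] using h1

end Scalars

/-! ### The canonical morphism and the gerbe over ℂ* -/

section

/-- Scalar matrices with square `1` form a central subgroup of `GL_n` acting trivially on the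
representation variety. -/
def scalarSubgroup (r n d : ℕ) [NeZero n] :
    QuotientStack.CentralSubgroup (repSpace r n d) mu2 where
  i {T} := (Matrix.GeneralLinearGroup.scalar (Fin n)).comp (rootsOfUnity 2 (𝒪 T)).subtype
  i_map {T _} f a := (Matrix.GeneralLinearGroup.map_scalar (pullbackFun f).toRingHom
    ((show rootsOfUnity 2 (𝒪 T) from a) : (𝒪 T)ˣ)).symm
  injective h := Subtype.ext (scalar_injective h)
  comm {T} a g := scalar_mul_comm (a : rootsOfUnity 2 (𝒪 T)).1 g
  smul_eq {T} a x := RepPoint.scalar_smul (a : rootsOfUnity 2 (𝒪 T)).2 x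

lemma toCharVariety_smul {r n d : ℕ} {T : SchC} (g : GL (Fin n) (𝒪 T)) (x : RepPoint r n d (𝒪 T)) :
    toCharVariety (g • x) = toCharVariety x :=
  congrArg toSpecC (AlgHom.ext fun a => a.2 (𝒪 T) g x)

lemma toCharVariety_map {r n d : ℕ} {T U : SchC} (f : U ⟶ T) (x : RepPoint r n d (𝒪 T)) :
    toCharVariety (x.map (pullbackFun f)) = f ≫ toCharVariety x := by
  refine Eq.trans ?_ (comp_toSpecC f _).symm
  rw [toCharVariety, RepPoint.eval_map, AlgHom.comp_assoc]

lemma smul_map_pullbackFun_eq {r n d : ℕ} {T U : SchC} {f : U ⟶ T} {x y : RepPoint r n d (𝒪 T)}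
    {S : Type} [CommRing S] [Algebra ℂ S] {φ : 𝒪 T →ₐ[ℂ] S} {ψ : S →ₐ[ℂ] 𝒪 U}
    (hψ : ψ.comp φ = pullbackFun f) {g : GL (Fin n) S} (hg : g • x.map φ = y.map φ) :
    g.map ψ.toRingHom • x.map (pullbackFun f) = y.map (pullbackFun f) := by
  rw [← hψ, ← RepPoint.map_comp, ← RepPoint.map_comp, ← hg, RepPoint.map_smul]

/-- The map to the spectrum of invariants is constant on orbits, so it descends along every torsor
by `QuotientStack.exists_descend`. -/
lemma exists_isCanonical (r n d : ℕ) : ∃ q : ∀ ξ : CharStack r n d,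
    (QuotientStack.proj etale (repSpace r n d)).obj ξ ⟶ charVariety r n d, IsCanonical q := by
  choose q hq using fun ξ : CharStack r n d => QuotientStack.exists_descend
    (fun {T} (x : RepPoint r n d (𝒪 T)) => toCharVariety x)
    (fun {T U} f x => toCharVariety_map f x) (fun {T} g x => toCharVariety_smul g x) ξ
  exact ⟨q, fun ξ T p => hq ξ p⟩

variable {n d : ℕ} [NeZero n]

/-- The character variety is `ℂ*`. -/
def charVarietyIso (hz : IsPrimitiveRoot (zeta n d) n) (hn : Odd n) : charVariety 2 n d ≅ Gm :=
  specCIso (laurentEquivInvariants hz hn)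

/-- Under the identification with ℂ*, the quotient map becomes det D₁/det D₂; this turns equality of
images into the hypothesis of `RepPoint.etaleLocally_exists_smul_eq`. -/
lemma toCharVariety_charVarietyIso (hz : IsPrimitiveRoot (zeta n d) n) (hn : Odd n) {T : SchC}
    (x : RepPoint 2 n d (𝒪 T)) :
    toCharVariety x ≫ (charVarietyIso hz hn).hom = toSpecC (laurentLift x.detRatio) := by
  refine (toSpecC_comp_specCMap _ _).trans ?_
  rw [eval_laurentEquivInvariants]

lemma laurentLift_injective {R : Type} [CommRing R] [Algebra ℂ R] {u v : Rˣ}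
    (h : laurentLift u = laurentLift v) : u = v := by
  refine Units.ext ?_
  rw [← laurentLift_laurentUnit u, h, laurentLift_laurentUnit]

lemma exists_laurentLift_eq {R : Type} [CommRing R] [Algebra ℂ R]
    (φ : LaurentPolynomial ℂ →ₐ[ℂ] R) : ∃ u : Rˣ, laurentLift u = φ :=
  ⟨Units.map (φ : LaurentPolynomial ℂ →* R) laurentUnit,
    laurent_algHom_ext (laurentLift_laurentUnit _)⟩

/-- The character stack is a gerbe banded by `μ₂` over `ℂ*`. -/
theorem isGerbe_charStack (hz : IsPrimitiveRoot (zeta n d) n) (hn : Odd n)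
    (q : ∀ ξ : CharStack 2 n d,
      (QuotientStack.proj etale (repSpace 2 n d)).obj ξ ⟶ charVariety 2 n d)
    (hq : IsCanonical q) :
    IsGerbe etale (QuotientStack.proj etale (repSpace 2 n d)) mu2 Gm
      (fun ξ => q ξ ≫ (charVarietyIso hz hn).hom) := by
  refine QuotientStack.isGerbe (scalarSubgroup 2 n d) (isSheaf_GLn n) (isSheaf_repSpace 2 n d)
    isSheaf_mu2 (fun {T} g x hg => ?_)
    (fun {T} (x : RepPoint 2 n d (𝒪 T)) => toSpecC (laurentLift x.detRatio))
    (fun {T} f => ?_) (fun {T} x y h => ?_) _ (fun ξ {T} p => ?_)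
  · obtain ⟨a, ha, rfl⟩ := RepPoint.stabilizer (R := 𝒪 T) hz hn hg
    exact ⟨(⟨a, ha⟩ : rootsOfUnity 2 (𝒪 T)), rfl⟩
  · obtain ⟨φ, rfl⟩ := toSpecC_surjective f
    obtain ⟨u, rfl⟩ := exists_laurentLift_eq φ
    exact ⟨sectionPoint hz u, by rw [detRatio_sectionPoint]⟩
  · obtain ⟨R, hR, hloc⟩ := (RepPoint.etaleLocally_exists_smul_eq (R := 𝒪 T) hz hn x y
      (laurentLift_injective (toSpecC_injective h))).exists_mem_etale
    refine ⟨R, hR, fun U f hf => ?_⟩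
    obtain ⟨S, _, _, φ, ψ, ⟨g, hg⟩, hψ⟩ := hloc U f hf
    refine ⟨(g.map ψ.toRingHom : GL (Fin n) (𝒪 U)), ?_⟩
    exact smul_map_pullbackFun_eq hψ hg
  · refine (Category.assoc _ _ _).symm.trans ?_
    refine Eq.trans ?_ (toCharVariety_charVarietyIso hz hn _)
    exact congrArg (· ≫ (charVarietyIso hz hn).hom) (hq ξ (op T) p)

end

end CharacterStack

end

open CharacterStack
theorem theorem3p4 (n d : ℕ) (hd : Even d) (hnd : Nat.Coprime d n) :
    IsReduced (RepRing 2 n d) ∧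
    ∃ (e : charVariety 2 n d ≅ Gm)
      (q : ∀ ξ : CharStack 2 n d,
        (QuotientStack.proj etale (repSpace 2 n d)).obj ξ ⟶ charVariety 2 n d),
      IsCanonical q ∧
      IsGerbe etale (QuotientStack.proj etale (repSpace 2 n d)) mu2 Gm (fun ξ => q ξ ≫ e.hom) := by
  have hn : Odd n := odd_of_even_of_coprime hd hnd
  -- Oddness also excludes n = 0, so no separate positivity assumption is needed; for d = 0,
  -- coprimality forces n = 1.
  have : NeZero n := ⟨hn.pos.ne'⟩
  have hz := zeta_isPrimitiveRoot hd hnd (NeZero.ne n)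
  obtain ⟨q, hq⟩ := exists_isCanonical 2 n d
  exact ⟨isReduced_repRing hz hn, charVarietyIso hz hn, q, hq, isGerbe_charStack hz hn q hq⟩
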